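/- Let $n,k,\ell$ be positive integers with $n\ge 2\ell>2k$ or $n>2\ell=2k$, let $[n]=\{1,\dots,n\}$, $[a,b]=\{a,a+1,\dots,b\}$, and let $\binom{[n]}{k}$ denote the collection of all $k$-element subsets of $[n]$. Put $\binom{a}{b}=0$ for $b<0$, and $$M_1=\left(\binom{n-1}{k-1}+\binom{n-2}{k-1}\right)\binom{n-2}{\ell-2},\qquad M_2=\left(\binom{n-1}{k-1}+1\right)\left(\binom{n-1}{\ell-1}-\binom{n-k-1}{\ell-1}\right),$$ $$\mathcal A_1=\left\{A\in\tbinom{[n]}{k}:1\in A\text{ or }2\in A\right\},\qquad \mathcal B_1=\left\{B\in\tbinom{[n]}{\ell}:[2]\subseteq B\right\},$$ $$\mathcal A_2=\left\{A\in\tbinom{[n]}{k}:1\in A\right\}\cup\{[2,k+1]\},\qquad \mathcal B_2=\left\{B\in\tbinom{[n]}{\ell}:1\in B,\ B\cap[2,k+1]\ne\emptyset\right\}.$$ Call a pair $(\mathcal A,\mathcal B)$ with $\mathcal A\subseteq\binom{[n]}{k}$ and $\mathcal B\subseteq\binom{[n]}{\ell}$ admissible if $\mathcal A$ and $\mathcal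 B$ are cross-intersecting (that is, $A\cap B\neq\emptyset$ for all $A\in\mathcal A$, $B\in\mathcal B$) and $\bigcap_{F\in\mathcal A\cup\mathcal B}F=\emptyset$. Two pairs are isomorphic if a permutation of $[n]$ carries one to the other; when $k=\ell$, the pairs are regarded as unordered, i.e. the two families may also be interchanged. Then every admissible pair satisfies $|\mathcal A||\mathcal B|\le\max\{M_1,M_2\}$. The pairs $(\mathcal A_1,\mathcal B_1)$ and $(\mathcal A_2,\mathcal B_2)$ are admissible, with $|\mathcal A_1||\mathcal B_1|=M_1$ and $|\mathcal A_2||\mathcal B_2|=M_2$. If $\ell\ge2$, then an admissible pair $(\mathcal A,\mathcal B)$ satisfies $|\mathcal A||\mathcal B|=\max\{M_1,M_2\}$ if and only if either $M_1\ge M_2$ and $(\mathcal A,\mathcal B)$ is isomorphic to $(\mathcal A_1,\mathcal B_1)$, or $M_2\ge M_1$ and $(\mathcal A,\mathcal B)$ is isomorphic to $(\mathcal A_2,\mathcal B_2)$. -/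

import Mathlib

open Finset

namespace CrossInt

/-- The binomial coefficient `a` choose `b` with an integer lower index: it is `0` when `b < 0`. -/
def binom (a : ℕ) (b : ℤ) : ℕ := if b < 0 then 0 else a.choose b.toNat

/-- The collection of all `k`-element subsets of `[n]`. The ground set `[n] = {1, …, n}` is
modelled by `Fin n`, the element `i : Fin n` standing for the number `i + 1`. -/
abbrev uniform (n k : ℕ) : Finset (Finset (Fin n)) := powersetCard k univ

/-- The number `j ∈ {1, 2, …}` belongs to the set `F ⊆ [n]`. -/
abbrev Has {n : ℕ} (F : Finset (Fin n)) (j : ℕ) : Prop := ∃ i ∈ F, (i : ℕ) + 1 = j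

/-- The interval `[a, b] = {a, a + 1, …, b}`, as a subset of `[n]`. -/
def interval (n a b : ℕ) : Finset (Fin n) :=
  univ.filter fun i => a ≤ (i : ℕ) + 1 ∧ (i : ℕ) + 1 ≤ b

/-- Every member of `𝒜` meets every member of `ℬ`. -/
def CrossIntersecting {n : ℕ} (𝒜 ℬ : Finset (Finset (Fin n))) : Prop :=
  ∀ A ∈ 𝒜, ∀ B ∈ ℬ, (A ∩ B).Nonempty

/-- A cross-intersecting pair of `k`-subsets and `ℓ`-subsets of `[n]` with no element of `[n]`
common to all members of both families. -/
structure NontrivialCross (n k ℓ : ℕ) (𝒜 ℬ : Finset (Finset (Fin n))) : Prop where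
  left : 𝒜 ⊆ uniform n k
  right : ℬ ⊆ uniform n ℓ
  cross : CrossIntersecting 𝒜 ℬ
  inter : (⋂ F ∈ 𝒜 ∪ ℬ, (F : Set (Fin n))) = ∅

/-- The family obtained from `ℱ` by relabelling the ground set by `σ`. -/
def relabel {n : ℕ} (σ : Equiv.Perm (Fin n)) (ℱ : Finset (Finset (Fin n))) :
    Finset (Finset (Fin n)) :=
  ℱ.image fun F => F.image σ

/-- The pair `(𝒜, ℬ)` of families of `k`-sets and `ℓ`-sets is isomorphic to `(𝒜', ℬ')`: some
permutation of `[n]` carries one pair to the other. If `k = ℓ` the two families play the same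
role, and the pair is unordered. -/
def IsoPair {n : ℕ} (k ℓ : ℕ) (𝒜 ℬ 𝒜' ℬ' : Finset (Finset (Fin n))) : Prop :=
  ∃ σ : Equiv.Perm (Fin n),
    (𝒜 = relabel σ 𝒜' ∧ ℬ = relabel σ ℬ') ∨ (k = ℓ ∧ 𝒜 = relabel σ ℬ' ∧ ℬ = relabel σ 𝒜')

/-- `{A : 1 ∈ A or 2 ∈ A}`. -/
def A₁ (n k : ℕ) : Finset (Finset (Fin n)) := (uniform n k).filter fun A => Has A 1 ∨ Has A 2

/-- `{B : [2] ⊆ B}`. -/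
def B₁ (n ℓ : ℕ) : Finset (Finset (Fin n)) := (uniform n ℓ).filter fun B => interval n 1 2 ⊆ B

/-- `{A : 1 ∈ A} ∪ {[2, k + 1]}`. -/
def A₂ (n k : ℕ) : Finset (Finset (Fin n)) :=
  ((uniform n k).filter fun A => Has A 1) ∪ {interval n 2 (k + 1)}

/-- `{B : 1 ∈ B, B ∩ [2, k + 1] ≠ ∅}`. -/
def B₂ (n k ℓ : ℕ) : Finset (Finset (Fin n)) :=
  (uniform n ℓ).filter fun B => Has B 1 ∧ (B ∩ interval n 2 (k + 1)).Nonempty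

/-- The first bound. -/
def bound₁ (n k ℓ : ℕ) : ℕ :=
  (binom (n - 1) (k - 1) + binom (n - 2) (k - 1)) * binom (n - 2) (ℓ - 2)

/-- The second bound (the subtraction is one of a smaller from a larger number). -/
def bound₂ (n k ℓ : ℕ) : ℕ :=
  (binom (n - 1) (k - 1) + 1) * (binom (n - 1) (ℓ - 1) - binom (n - k - 1) (ℓ - 1))

end CrossInt

/-!
Write `n = N + 2`, `k = i + 2`, `ℓ = j + 2` (singletons, `k = 1`, are treated directly). A star of
`k`-sets has `(N + 1).choose (i + 1)` members, a star of `ℓ`-sets has `(N + 1).choose (j + 1)`, and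
`N.choose i`, `N.choose j` sets contain two given points.

*One family is larger than a star.* Here the bound is purely numerical: `Feasible` records which
pairs of cardinalities occur for cross-intersecting families. By the Kruskal–Katona theorem one may
replace both families by initial segments, so a family with more members than a star may be assumed
to contain a full star, whose centre then lies in every member of the other family. Removing star
and centre gives a feasible pair on one point less (`Feasible.peel_left`). Iterating this gives
Hilton–Milner type trade-offs between the two cardinalities (`Feasible.weighted_sum_le`,
`Feasible.add_mul_lt`). The boundary of the feasible region, cut into a few pieces by peeling once or
twice more, then lies on or below chords on which the product is at most the maximum of the two
extremal products, with equality only in the two extremal corners (`Feasible.mul_lt_max_or`,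
`Feasible.mul_lt_max_of_right`).

*No family is larger than a star.* The product is then strictly below the second extremal product
(`mul_lt_of_card_le_star`). If some point has degree larger than `N.choose i` in the first family or
`N.choose j` in the second, this follows by applying the trade-offs to the links of that point
(`mul_lt_or_degree_le`). If all degrees are that small, double counting suffices unless `3 ≤ k` and
`ℓ` is less than about `n / 3`. In that range one shifts the families. Either shifting creates a
common point, in which case all members meet a fixed pair of points and both families are small, or
one arrives at shifted families. In these, two members have more than `s` elements (counted with
multiplicity) among the first `s` points for some `s` (`exists_lt_initCount_add`), and the reflection
principle bounds the number of such sets (`card_reach_le`).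

*Uniqueness.* Only two pairs of cardinalities are left (`card_mul_card_lt_or`). For each of them,
averaging the degrees yields a point at which the trade-offs for the links can only hold if all
members of the second family contain that point (`exists_pair_of_card`, `exists_star_of_card`).
-/

namespace CrossInt

/-! ### Feasible cardinalities and the Kruskal–Katona theorem -/

/-- Some cross-intersecting pair of families of `k`-subsets and `l`-subsets of an `n`-set has at
least `a` and at least `b` members. Only lower bounds on the two cardinalities are asked for, so
that the relation is downward closed in `(a, b)`. -/
def Feasible (n k l a b : ℕ) : Prop :=
  ∃ 𝒜 ℬ : Finset (Finset (Fin n)), 𝒜 ⊆ uniform n k ∧ ℬ ⊆ uniform n l ∧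
    CrossIntersecting 𝒜 ℬ ∧ a ≤ #𝒜 ∧ b ≤ #ℬ

namespace Feasible

variable {n k l a b : ℕ}

lemma symm (h : Feasible n k l a b) : Feasible n l k b a := by
  obtain ⟨𝒜, ℬ, h1, h2, h3, h4, h5⟩ := h
  exact ⟨ℬ, 𝒜, h2, h1, fun B hB A hA => by rw [inter_comm]; exact h3 A hA B hB, h5, h4⟩

lemma mono {a' b' : ℕ} (h : Feasible n k l a b) (ha : a' ≤ a) (hb : b' ≤ b) :
    Feasible n k l a' b' := by
  obtain ⟨𝒜, ℬ, h1, h2, h3, h4, h5⟩ := h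
  exact ⟨𝒜, ℬ, h1, h2, h3, ha.trans h4, hb.trans h5⟩

lemma left_le (h : Feasible n k l a b) : a ≤ n.choose k := by
  obtain ⟨𝒜, ℬ, h1, h2, h3, h4, h5⟩ := h
  refine h4.trans ((card_le_card h1).trans ?_)
  simp

lemma right_le (h : Feasible n k l a b) : b ≤ n.choose l := h.symm.left_le

lemma left_pos (h : Feasible n k l a b) (ha : 0 < a) (hb : 0 < b) : 0 < k := by
  obtain ⟨𝒜, ℬ, h1, h2, h3, h4, h5⟩ := h
  obtain ⟨A, hA⟩ := card_pos.1 (ha.trans_le h4)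
  obtain ⟨B, hB⟩ := card_pos.1 (hb.trans_le h5)
  have := (mem_powersetCard.1 (h1 hA)).2
  rw [← this]
  exact card_pos.2 ((h3 A hA B hB).mono inter_subset_left)

lemma right_pos (h : Feasible n k l a b) (ha : 0 < a) (hb : 0 < b) : 0 < l :=
  h.symm.left_pos hb ha

/-- A single `k`-set excludes the `l`-sets inside its complement. -/
lemma add_choose_le (h : Feasible n k l a b) (ha : 0 < a) :
    b + (n - k).choose l ≤ n.choose l := by
  obtain ⟨𝒜, ℬ, h1, h2, h3, h4, h5⟩ := h
  obtain ⟨A, hA⟩ := card_pos.1 (ha.trans_le h4)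
  have hAk := (mem_powersetCard.1 (h1 hA)).2
  have hd : Disjoint ℬ (powersetCard l Aᶜ) := by
    rw [disjoint_left]
    intro B hB hB'
    obtain ⟨x, hx⟩ := h3 A hA B hB
    rw [mem_inter] at hx
    exact mem_compl.1 ((mem_powersetCard.1 hB').1 hx.2) hx.1
  have h6 : ℬ ∪ powersetCard l Aᶜ ⊆ uniform n l :=
    union_subset h2 (powersetCard_mono (subset_univ _))
  have h7 := card_le_card h6
  rw [card_union_of_disjoint hd, card_powersetCard, card_powersetCard, card_compl, hAk,
    card_univ, Fintype.card_fin] at h7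
  omega

lemma choose_add_le (h : Feasible n k l a b) (hb : 0 < b) :
    a + (n - l).choose k ≤ n.choose k := h.symm.add_choose_le hb

end Feasible

/-- Cross-intersecting families of subsets of any finite set `S` can be moved to `Fin #S`. -/
lemma feasible_card {α : Type*} [DecidableEq α] {S : Finset α} {k l : ℕ}
    {𝒜 ℬ : Finset (Finset α)} (h𝒜 : 𝒜 ⊆ powersetCard k S) (hℬ : ℬ ⊆ powersetCard l S)
    (h : ∀ A ∈ 𝒜, ∀ B ∈ ℬ, (A ∩ B).Nonempty) : Feasible #S k l #𝒜 #ℬ := by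
  let ι : Fin #S ↪ α := ⟨fun i => (S.equivFin.symm i : S), fun i j hij => by
    simpa using Subtype.ext hij⟩
  let g : Finset α → Finset (Fin #S) := fun A => univ.filter fun i => ι i ∈ A
  have hg : ∀ A ⊆ S, (g A).map ι = A := by
    intro A hA
    ext x
    simp only [g, mem_map, mem_filter, mem_univ, true_and]
    constructor
    · rintro ⟨i, hi, rfl⟩; exact hi
    · intro hx
      have hιx : ι (S.equivFin ⟨x, hA hx⟩) = x :=
        congrArg Subtype.val (S.equivFin.symm_apply_apply ⟨x, hA hx⟩)
      exact ⟨_, hιx.symm ▸ hx, hιx⟩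
  have hinj : ∀ (r : ℕ) (𝒞 : Finset (Finset α)), 𝒞 ⊆ powersetCard r S →
      Set.InjOn g (𝒞 : Set (Finset α)) := by
    intro r 𝒞 h𝒞 A hA B hB hAB
    rw [← hg A (mem_powersetCard.1 (h𝒞 hA)).1, ← hg B (mem_powersetCard.1 (h𝒞 hB)).1, hAB]
  have huni : ∀ (r : ℕ) (𝒞 : Finset (Finset α)), 𝒞 ⊆ powersetCard r S →
      𝒞.image g ⊆ uniform #S r := by
    intro r 𝒞 h𝒞 A hA
    obtain ⟨B, hB, rfl⟩ := mem_image.1 hA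
    obtain ⟨h1, h2⟩ := mem_powersetCard.1 (h𝒞 hB)
    refine mem_powersetCard.2 ⟨subset_univ _, ?_⟩
    rw [← card_map ι, hg B h1, h2]
  refine ⟨𝒜.image g, ℬ.image g, huni k 𝒜 h𝒜, huni l ℬ hℬ, ?_,
    (card_image_of_injOn (hinj k 𝒜 h𝒜)).ge, (card_image_of_injOn (hinj l ℬ hℬ)).ge⟩
  intro A hA B hB
  obtain ⟨A', hA', rfl⟩ := mem_image.1 hA
  obtain ⟨B', hB', rfl⟩ := mem_image.1 hB
  obtain ⟨x, hx⟩ := h A' hA' B' hB'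
  rw [mem_inter] at hx
  have hxS := (mem_powersetCard.1 (h𝒜 hA')).1 hx.1
  have hιx : ι (S.equivFin ⟨x, hxS⟩) = x :=
    congrArg Subtype.val (S.equivFin.symm_apply_apply ⟨x, hxS⟩)
  refine ⟨S.equivFin ⟨x, hxS⟩, mem_inter.2 ⟨mem_filter.2 ⟨mem_univ _, ?_⟩,
    mem_filter.2 ⟨mem_univ _, ?_⟩⟩⟩
  · rw [hιx]; exact hx.1
  · rw [hιx]; exact hx.2

/-- Initial segments of the colexicographic order exist in every possible size. -/
lemma exists_isInitSeg_card (n r t : ℕ) (ht : t ≤ n.choose r) :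
    ∃ 𝒞 : Finset (Finset (Fin n)), Colex.IsInitSeg 𝒞 r ∧ #𝒞 = t := by
  induction t with
  | zero => exact ⟨∅, Colex.isInitSeg_empty, rfl⟩
  | succ t ih =>
    obtain ⟨𝒞, h𝒞, hc⟩ := ih (by omega)
    have hsub : 𝒞 ⊆ uniform n r := fun A hA => mem_powersetCard.2 ⟨subset_univ _, h𝒞.1 hA⟩
    have hne : (uniform n r \ 𝒞).Nonempty := by
      rw [← card_pos, card_sdiff_of_subset hsub, card_powersetCard, card_univ, Fintype.card_fin]
      omega
    obtain ⟨s, hs, hmin⟩ := exists_min_image (uniform n r \ 𝒞) toColex hne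
    rw [mem_sdiff] at hs
    refine ⟨insert s 𝒞, ⟨?_, ?_⟩, by rw [card_insert_of_notMem hs.2, hc]⟩
    · intro A hA
      rcases mem_insert.1 (mem_coe.1 hA) with rfl | hA
      · exact (mem_powersetCard.1 hs.1).2
      · exact h𝒞.1 hA
    · intro A B hA hB
      rcases mem_insert.1 hA with rfl | hA
      · by_contra hcon
        rw [mem_insert, not_or] at hcon
        have := hmin B (mem_sdiff.2 ⟨mem_powersetCard.2 ⟨subset_univ _, hB.2⟩, hcon.2⟩)
        exact absurd hB.1 (not_lt.2 this)
      · exact mem_insert_of_mem (h𝒞.2 hA hB)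

/-- In an initial segment of the colexicographic order on `r`-subsets of `Fin (n + 1)` whose shadow
on the `(k + 1)`-sets has at most `n.choose (k + 1)` members, no set contains the last point:
otherwise the shadow would contain all `(k + 1)`-sets avoiding the last point, and one more. -/
lemma last_notMem_of_card_shadow_le {n k i : ℕ} {𝒞 : Finset (Finset (Fin (n + 1)))}
    (h𝒞 : Colex.IsInitSeg 𝒞 (k + 1 + i)) (hr : k + 1 + i ≤ n)
    (hs : #(shadow^[i] 𝒞) ≤ n.choose (k + 1)) : ∀ C ∈ 𝒞, Fin.last n ∉ C := by
  intro C hC hlast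
  have hall : ∀ T : Finset (Fin (n + 1)), #T = k + 1 + i → Fin.last n ∉ T → T ∈ 𝒞 := by
    intro T hT hTl
    refine h𝒞.2 hC ⟨?_, hT⟩
    rw [Colex.toColex_lt_toColex_iff_exists_forall_lt]
    exact ⟨Fin.last n, hlast, hTl, fun b hb _ => lt_of_le_of_ne (Fin.le_last b)
      (fun h => hTl (h ▸ hb))⟩
  obtain ⟨D, hD1, hD2, hD3⟩ : ∃ D : Finset (Fin (n + 1)), {Fin.last n} ⊆ D ∧ D ⊆ C ∧
      #D = k + 1 := by
    refine exists_subsuperset_card_eq (singleton_subset_iff.2 hlast) (by simp) ?_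
    rw [h𝒞.1 hC]; omega
  have hDs : D ∈ shadow^[i] 𝒞 :=
    mem_shadow_iterate_iff_exists_mem_card_add.2 ⟨C, hC, hD2, by rw [h𝒞.1 hC, hD3]⟩
  have hsub : insert D (powersetCard (k + 1) (univ.erase (Fin.last n))) ⊆ shadow^[i] 𝒞 := by
    refine insert_subset hDs fun T hT => ?_
    rw [mem_powersetCard] at hT
    obtain ⟨U, hU1, hU2, hU3⟩ : ∃ U, T ⊆ U ∧ U ⊆ univ.erase (Fin.last n) ∧ #U = k + 1 + i := by
      refine exists_subsuperset_card_eq hT.1 (by omega) ?_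
      rw [card_erase_of_mem (mem_univ _), card_univ, Fintype.card_fin]; omega
    refine mem_shadow_iterate_iff_exists_mem_card_add.2 ⟨U, hall U hU3 ?_, hU1, by omega⟩
    exact fun h => absurd (hU2 h) (by simp)
  have h1 := card_le_card hsub
  rw [card_insert_of_notMem, card_powersetCard, card_erase_of_mem (mem_univ _), card_univ,
    Fintype.card_fin, Nat.add_sub_cancel] at h1
  · omega
  · intro h
    exact absurd ((mem_powersetCard.1 h).1 (singleton_subset_iff.1 hD1)) (by simp)

/-- If the family of `(k + 1)`-sets is at least as large as a star, one may assume by the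
Kruskal–Katona theorem that it contains a full star, whose centre then lies in every `(l + 1)`-set
of the other family; removing the star and the centre leaves a pair on one point less. -/
lemma Feasible.peel_left {n k l a b : ℕ} (h : Feasible (n + 1) (k + 1) (l + 1) (n.choose k + a) b)
    (hkl : k + l + 1 ≤ n) : Feasible n (k + 1) l a b := by
  obtain ⟨𝒜, ℬ, h1, h2, h3, h4, h5⟩ := h
  obtain ⟨i, hi⟩ : ∃ i, n = k + 1 + i + l := ⟨n - (k + l + 1), by omega⟩
  -- The complements of the members of `ℬ`; their iterated shadow misses `𝒜`.
  let 𝒟 : Finset (Finset (Fin (n + 1))) := ℬ.image compl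
  have h𝒟c : #𝒟 = #ℬ := card_image_of_injective _ compl_injective
  have h𝒟 : (𝒟 : Set (Finset (Fin (n + 1)))).Sized (k + 1 + i) := by
    intro D hD
    obtain ⟨B, hB, rfl⟩ := mem_image.1 (mem_coe.1 hD)
    rw [card_compl, (mem_powersetCard.1 (h2 hB)).2, Fintype.card_fin]; omega
  have hdis : Disjoint (shadow^[i] 𝒟) 𝒜 := by
    rw [disjoint_left]
    intro T hT hTA
    obtain ⟨D, hD, hTD, -⟩ := mem_shadow_iterate_iff_exists_mem_card_add.1 hT
    obtain ⟨B, hB, rfl⟩ := mem_image.1 hD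
    obtain ⟨x, hx⟩ := h3 T hTA B hB
    rw [mem_inter] at hx
    exact mem_compl.1 (hTD hx.1) hx.2
  have hcard : #(shadow^[i] 𝒟) + #𝒜 ≤ (n + 1).choose (k + 1) := by
    rw [← card_union_of_disjoint hdis]
    refine (card_le_card (union_subset ?_ h1)).trans (by simp : #(uniform (n + 1) (k + 1)) ≤ _)
    intro T hT
    refine mem_powersetCard.2 ⟨subset_univ _, ?_⟩
    have := h𝒟.shadow_iterate (k := i) (mem_coe.2 hT)
    omega
  have h6 : #ℬ ≤ (n + 1).choose (k + 1 + i) := by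
    have := card_le_card h2
    rw [card_powersetCard, card_univ, Fintype.card_fin] at this
    rwa [← Nat.choose_symm_of_eq_add (show n + 1 = l + 1 + (k + 1 + i) by omega)]
  obtain ⟨𝒞, h𝒞, h𝒞c⟩ := exists_isInitSeg_card (n + 1) (k + 1 + i) #ℬ h6
  have hkk : #(shadow^[i] 𝒞) ≤ #(shadow^[i] 𝒟) := iterated_kk h𝒟 (by rw [h𝒞c, h𝒟c]) h𝒞
  rw [Nat.choose_succ_succ'] at hcard
  have hlast := last_notMem_of_card_shadow_le h𝒞 (by omega) (by omega)
  let cs : Fin n ↪ Fin (n + 1) := Fin.castSuccEmb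
  -- Pull the segment back to `Fin n` and complement.
  let g : Finset (Fin (n + 1)) → Finset (Fin n) := fun C => univ.filter fun x => cs x ∉ C
  have hgC : ∀ C ∈ 𝒞, ((g C)ᶜ).map cs = C := by
    intro C hC
    ext x
    simp only [g, mem_map, mem_compl, mem_filter, mem_univ, true_and, not_not]
    constructor
    · rintro ⟨y, hy, rfl⟩; exact hy
    · intro hx
      have hx' : x ≠ Fin.last n := fun h => hlast C hC (h ▸ hx)
      have hcx : cs (x.castPred hx') = x := Fin.castSucc_castPred x hx'
      exact ⟨_, hcx.symm ▸ hx, hcx⟩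
  let ℬ' := 𝒞.image g
  have hℬ' : #ℬ' = #𝒞 := by
    refine card_image_of_injOn fun C hC D hD hCD => ?_
    rw [← hgC C hC, ← hgC D hD, hCD]
  have hℬu : ℬ' ⊆ uniform n l := by
    intro B hB
    obtain ⟨C, hC, rfl⟩ := mem_image.1 hB
    refine mem_powersetCard.2 ⟨subset_univ _, ?_⟩
    have e1 := congrArg card (hgC C hC)
    rw [card_map, card_compl, Fintype.card_fin, h𝒞.1 hC] at e1
    have e2 := card_le_univ (g C)
    rw [Fintype.card_fin] at e2
    omega
  let 𝒜' := (uniform n (k + 1)).filter fun A => ∀ B ∈ ℬ', (A ∩ B).Nonempty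
  refine ⟨𝒜', ℬ', filter_subset _ _, hℬu, fun A hA => (mem_filter.1 hA).2, ?_, by omega⟩
  have hc : #(uniform n (k + 1) \ 𝒜') ≤ #(shadow^[i] 𝒞) := by
    rw [← card_map (mapEmbedding cs).toEmbedding]
    refine card_le_card fun T hT => ?_
    obtain ⟨A, hA, rfl⟩ := mem_map.1 hT
    simp only [𝒜', mem_sdiff, mem_filter, not_and, not_forall] at hA
    obtain ⟨B, hB, hAB⟩ := hA.2 hA.1
    obtain ⟨C, hC, rfl⟩ := mem_image.1 hB
    have hAk := (mem_powersetCard.1 hA.1).2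
    refine mem_shadow_iterate_iff_exists_mem_card_add.2 ⟨C, hC, ?_, ?_⟩
    · rw [← hgC C hC]
      refine map_subset_map.2 fun x hx => ?_
      rw [mem_compl]
      exact fun hx' => hAB ⟨x, mem_inter.2 ⟨hx, hx'⟩⟩
    · rw [h𝒞.1 hC]
      simp [hAk]
  have h𝒜u : 𝒜' ⊆ uniform n (k + 1) := filter_subset _ _
  rw [card_sdiff_of_subset h𝒜u, card_powersetCard, card_univ, Fintype.card_fin] at hc
  omega

lemma Feasible.peel_right {n k l a b : ℕ}
    (h : Feasible (n + 1) (k + 1) (l + 1) a (n.choose l + b))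
    (hkl : k + l + 1 ≤ n) : Feasible n k (l + 1) a b :=
  (h.symm.peel_left (by omega)).symm

/-! ### Trade-offs between the two cardinalities -/

lemma choose_mul_choose_sub (n k l : ℕ) :
    n.choose k * (n - k).choose l = n.choose l * (n - l).choose k := by
  by_cases h : k + l ≤ n
  · have h1 := Nat.choose_mul (n := n) (Nat.le_add_right k l)
    have h2 := Nat.choose_mul (n := n) (Nat.le_add_left l k)
    rw [Nat.add_sub_cancel_left] at h1
    rw [Nat.add_sub_cancel] at h2
    rw [← h1, ← h2, Nat.choose_symm_add]
  · by_cases hk : n < k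
    · rw [Nat.choose_eq_zero_of_lt hk, Nat.choose_eq_zero_of_lt (show n - l < k by omega)]; simp
    · rw [Nat.choose_eq_zero_of_lt (show n - k < l by omega)]
      by_cases hl : n < l
      · rw [Nat.choose_eq_zero_of_lt hl]; simp
      · rw [Nat.choose_eq_zero_of_lt (show n - l < k by omega)]; simp

lemma le_choose {n k : ℕ} (hk : 0 < k) (hkn : k < n) : n ≤ n.choose k := by
  induction n generalizing k with
  | zero => omega
  | succ n ih =>
    obtain ⟨k, rfl⟩ : ∃ j, k = j + 1 := ⟨k - 1, by omega⟩
    rcases (Nat.lt_succ_iff.1 hkn).lt_or_eq with h | h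
    · rw [Nat.choose_succ_succ' n k]
      have : n ≤ n.choose (k + 1) := ih (Nat.succ_pos k) h
      have := Nat.choose_pos (show k ≤ n by omega)
      omega
    · rw [← h, Nat.choose_succ_self_right]

/-- For `n = l + k + t`, this says that the cardinalities of two stars with a common centre obey
`Feasible.weighted_sum_le`, after division by `n.choose l` and multiplication by `n`. -/
lemma star_bound {k l t : ℕ} (hk : 0 < k) (hkl : k ≤ l) :
    (l + k + t) * (k + t).choose k ≤ (l + k + t) + t * (l + k + t).choose k := by
  induction k, hk using Nat.le_induction with
  | base => simp; nlinarith
  | succ k hk ih =>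
    have ih := ih (by omega)
    have e1 := Nat.add_one_mul_choose_eq (k + t) k
    have e2 := Nat.add_one_mul_choose_eq (l + k + t) k
    have h1 := le_choose (n := l + k + t) (k := k) hk (by omega)
    rw [show l + (k + 1) + t = l + k + t + 1 by ring, show k + 1 + t = k + t + 1 by ring]
    set X := (k + t).choose k
    set Y := (l + k + t).choose k
    set Z := (k + t + 1).choose (k + 1)
    set W := (l + k + t + 1).choose (k + 1)
    obtain ⟨s, rfl⟩ : ∃ s, l = k + 1 + s := ⟨l - (k + 1), by omega⟩
    set m := k + 1 + s + k + t with hm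
    have h2 : (k + t + 1) * (m + t * Y) ≤ (k + 1) * m + t * (m * Y) := by
      have : t * m ≤ t * (Y * (k + s)) := by
        gcongr
        exact h1.trans (Nat.le_mul_of_pos_right _ (by omega))
      have e3 : m = (k + s) + (k + t + 1) := by rw [hm]; ring
      calc (k + t + 1) * (m + t * Y) = (k + 1) * m + t * m + (k + t + 1) * (t * Y) := by ring
        _ ≤ (k + 1) * m + t * (Y * (k + s)) + (k + t + 1) * (t * Y) := by omega
        _ = (k + 1) * m + t * (((k + s) + (k + t + 1)) * Y) := by ring
        _ = _ := by rw [← e3]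
    refine Nat.le_of_mul_le_mul_left (?_ : ((k + 1) * m) * _ ≤ ((k + 1) * m) * _) (by positivity)
    calc (k + 1) * m * ((m + 1) * Z) = (m + 1) * m * (Z * (k + 1)) := by ring
      _ = (m + 1) * (k + t + 1) * (m * X) := by rw [← e1]; ring
      _ ≤ (m + 1) * (k + t + 1) * (m + t * Y) := by gcongr
      _ = (m + 1) * ((k + t + 1) * (m + t * Y)) := by ring
      _ ≤ (m + 1) * ((k + 1) * m + t * (m * Y)) := by gcongr
      _ = (k + 1) * m * (m + 1) + t * m * ((m + 1) * Y) := by ring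
      _ = (k + 1) * m * (m + 1) + t * m * (W * (k + 1)) := by rw [e2]
      _ = _ := by ring

lemma choose_pred_mul {n k : ℕ} : (n + 1) * n.choose k = (k + 1) * (n + 1).choose (k + 1) := by
  rw [Nat.add_one_mul_choose_eq]; ring

lemma choose_mul_sub_le {n k l : ℕ} (h : k + l ≤ n + 1) :
    k * (n + 1).choose l ≤ (n + 1) * n.choose l := by
  have := Nat.choose_mul_succ_eq n l
  calc k * (n + 1).choose l ≤ (n + 1 - l) * (n + 1).choose l :=
        Nat.mul_le_mul_right _ (by omega)
    _ = (n + 1) * n.choose l := by rw [mul_comm, ← this]; ring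

/-- For two nonempty cross-intersecting families the cardinalities, weighted by those of the
opposite layers, have the largest sum when the `k`-sets reduce to a single set. The bound is proved
by induction along the recursion for initial segments. -/
theorem Feasible.weighted_sum_le {n k l a b : ℕ} (h : Feasible n k l a b) (hkl : k ≤ l)
    (hn : k + l ≤ n) (ha : 0 < a) (hb : 0 < b) :
    a * n.choose l + b * n.choose k + n.choose k * (n - k).choose l ≤
      n.choose k * n.choose l + n.choose l := by
  induction n generalizing k l a b with
  | zero =>
    have := h.left_pos ha hb
    omega
  | succ m ih =>
    have hk := h.left_pos ha hb
    have hl := h.right_pos ha hb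
    obtain ⟨k, rfl⟩ : ∃ j, k = j + 1 := ⟨k - 1, by omega⟩
    obtain ⟨l, rfl⟩ : ∃ j, l = j + 1 := ⟨l - 1, by omega⟩
    have eCk := choose_pred_mul (n := m) (k := k)
    have eCl := choose_pred_mul (n := m) (k := l)
    -- The pair of two stars with a common centre.
    have node : m.choose k * (m + 1).choose (l + 1) + m.choose l * (m + 1).choose (k + 1) +
        (m + 1).choose (k + 1) * (m + 1 - (k + 1)).choose (l + 1) ≤
        (m + 1).choose (k + 1) * (m + 1).choose (l + 1) + (m + 1).choose (l + 1) := by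
      obtain ⟨t, ht⟩ : ∃ t, m + 1 = (l + 1) + (k + 1) + t := ⟨m + 1 - (l + 1 + (k + 1)), by omega⟩
      have h1 := star_bound (k := k + 1) (l := l + 1) (t := t) hk hkl
      rw [choose_mul_choose_sub, show m + 1 - (l + 1) = k + 1 + t by omega]
      rw [← ht] at h1
      set Ck := (m + 1).choose (k + 1)
      set Cl := (m + 1).choose (l + 1)
      set E := (k + 1 + t).choose (k + 1)
      refine Nat.le_of_mul_le_mul_left (?_ : (m + 1) * _ ≤ (m + 1) * _) (by positivity)
      calc (m + 1) * (m.choose k * Cl + m.choose l * Ck + Cl * E)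
          = ((m + 1) * m.choose k) * Cl + ((m + 1) * m.choose l) * Ck + Cl * ((m + 1) * E) := by
            ring
        _ ≤ ((k + 1) * Ck) * Cl + ((l + 1) * Cl) * Ck + Cl * (m + 1 + t * Ck) := by
            rw [eCk, eCl]; gcongr
        _ = (l + 1 + (k + 1) + t) * (Ck * Cl) + (m + 1) * Cl := by ring
        _ = (m + 1) * (Ck * Cl) + (m + 1) * Cl := by rw [← ht]
        _ = _ := by ring
    have hCk := Nat.choose_succ_succ' m k
    have hCl := Nat.choose_succ_succ' m l
    rcases le_or_gt a (m.choose k) with ha1 | ha1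
    · rcases le_or_gt b (m.choose l) with hb1 | hb1
      · refine le_trans ?_ node
        gcongr
      · obtain ⟨b', rfl⟩ : ∃ b', b = m.choose l + b' := ⟨b - m.choose l, by omega⟩
        have h1 := h.peel_right (by omega)
        have h2 := ih h1 (by omega) (by omega) ha (by omega)
        rw [show m + 1 - (k + 1) = m - k by omega]
        obtain ⟨a', rfl⟩ : ∃ a', a = a' + 1 := ⟨a - 1, by omega⟩
        have h3 := choose_mul_sub_le (n := m) (k := k + 1) (l := l + 1) hn
        set Ck := (m + 1).choose (k + 1)
        set Cl := (m + 1).choose (l + 1)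
        set D := (m - k).choose (l + 1)
        set X1 := m.choose (l + 1)
        set X0 := m.choose k
        have h4 : a' * X1 + b' * X0 + X0 * D ≤ X0 * X1 := by linarith
        have h5 : a' * Cl + b' * Ck + Ck * D ≤ Ck * X1 := by
          refine Nat.le_of_mul_le_mul_left (?_ : (k + 1) * _ ≤ (k + 1) * _) (by positivity)
          calc (k + 1) * (a' * Cl + b' * Ck + Ck * D)
              = a' * ((k + 1) * Cl) + ((k + 1) * Ck) * (b' + D) := by ring
            _ ≤ a' * ((m + 1) * X1) + ((m + 1) * X0) * (b' + D) := by rw [← eCk]; gcongr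
            _ = (m + 1) * (a' * X1 + b' * X0 + X0 * D) := by ring
            _ ≤ (m + 1) * (X0 * X1) := by gcongr
            _ = ((m + 1) * X0) * X1 := by ring
            _ = _ := by rw [eCk]; ring
        calc _ = (a' * Cl + b' * Ck + Ck * D) + m.choose l * Ck + Cl := by ring
          _ ≤ Ck * X1 + m.choose l * Ck + Cl := by gcongr
          _ = Ck * (m.choose l + X1) + Cl := by ring
          _ = _ := by rw [← hCl]
    · obtain ⟨a', rfl⟩ : ∃ a', a = m.choose k + a' := ⟨a - m.choose k, by omega⟩
      have h1 := h.peel_left (by omega)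
      rw [choose_mul_choose_sub]
      rcases Nat.lt_or_ge k l with hlt | hge
      · have h2 := ih h1 (by omega) (by omega) (by omega) hb
        rw [choose_mul_choose_sub] at h2
        rw [show m + 1 - (l + 1) = m - l by omega]
        have h3 := choose_mul_sub_le (n := m) (k := l + 1) (l := k + 1) (by omega)
        set Ck := (m + 1).choose (k + 1)
        set Cl := (m + 1).choose (l + 1)
        set E := (m - l).choose (k + 1)
        set Z := m.choose (k + 1)
        set Y := m.choose l
        have h5 : a' * Cl + b * Ck + Cl * E ≤ Z * Cl + Cl := by
          refine Nat.le_of_mul_le_mul_left (?_ : (l + 1) * _ ≤ (l + 1) * _) (by positivity)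
          calc (l + 1) * (a' * Cl + b * Ck + Cl * E)
              = ((l + 1) * Cl) * (a' + E) + b * ((l + 1) * Ck) := by ring
            _ ≤ ((m + 1) * Y) * (a' + E) + b * ((m + 1) * Z) := by rw [← eCl]; gcongr
            _ = (m + 1) * (a' * Y + b * Z + Y * E) := by ring
            _ ≤ (m + 1) * (Z * Y + Y) := by gcongr
            _ = ((m + 1) * Y) * (Z + 1) := by ring
            _ = _ := by rw [eCl]; ring
        calc _ = (a' * Cl + b * Ck + Cl * E) + m.choose k * Cl := by ring
          _ ≤ Z * Cl + Cl + m.choose k * Cl := by gcongr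
          _ = (m.choose k + Z) * Cl + Cl := by ring
          _ = _ := by rw [← hCk]
      · obtain rfl : k = l := by omega
        have h2 := ih h1.symm (by omega) (by omega) hb (by omega)
        rw [show m + 1 - (k + 1) = m - k by omega]
        obtain ⟨b', rfl⟩ : ∃ b', b = b' + 1 := ⟨b - 1, by omega⟩
        have hYZ : m.choose k ≤ m.choose (k + 1) := by
          refine Nat.le_of_mul_le_mul_right (?_ : _ * (k + 1) ≤ _ * (k + 1)) (by positivity)
          rw [Nat.choose_succ_right_eq]
          exact Nat.mul_le_mul_left _ (by omega)
        have hY : 0 < m.choose k := Nat.choose_pos (by omega)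
        set C := (m + 1).choose (k + 1)
        set E := (m - k).choose (k + 1)
        set Z := m.choose (k + 1)
        set Y := m.choose k
        have h4 : a' + b' + E ≤ Z := by
          refine Nat.le_of_mul_le_mul_left (?_ : (Y) * _ ≤ (Y) * _) hY
          have : b' * Y ≤ b' * Z := by gcongr
          linarith
        calc _ = (a' + b' + E) * C + (Y + 1) * C := by ring
          _ ≤ Z * C + (Y + 1) * C := by gcongr
          _ = (Y + Z) * C + C := by ring
          _ = _ := by rw [← hCk]

lemma Feasible.weighted_sum_le_mul {n k l a b : ℕ} (h : Feasible n k l a b) (hn : k + l ≤ n) :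
    a * n.choose l + b * n.choose k ≤ n.choose k * n.choose l := by
  wlog hkl : k ≤ l generalizing k l a b
  · have := this h.symm (by omega) (by omega)
    rw [mul_comm (n.choose k)]; omega
  rcases Nat.eq_zero_or_pos a with rfl | ha
  · rw [zero_mul, zero_add, mul_comm]
    exact Nat.mul_le_mul_left _ h.right_le
  rcases Nat.eq_zero_or_pos b with rfl | hb
  · rw [zero_mul, add_zero]
    exact Nat.mul_le_mul_right _ h.left_le
  have h1 := h.weighted_sum_le hkl hn ha hb
  have h2 : n.choose l ≤ n.choose k * (n - k).choose l := by
    rw [choose_mul_choose_sub]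
    exact Nat.le_mul_of_pos_right _ (Nat.choose_pos (by omega))
  omega

lemma Feasible.weighted_sum_lt_mul {n k l a b : ℕ} (h : Feasible n k l a b) (hn : k + l < n)
    (ha : 0 < a) (hb : 0 < b) :
    a * n.choose l + b * n.choose k < n.choose k * n.choose l := by
  wlog hkl : k ≤ l generalizing k l a b
  · have := this h.symm (by omega) hb ha (by omega)
    rw [mul_comm (n.choose k)]; omega
  have h1 := h.weighted_sum_le hkl hn.le ha hb
  have hk := h.left_pos ha hb
  have h3 : n.choose l * 2 ≤ n.choose k * (n - k).choose l := by
    rw [choose_mul_choose_sub]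
    refine Nat.mul_le_mul_left _ ?_
    exact le_trans (by omega) (le_choose (n := n - l) (k := k) hk (by omega))
  have h4 : 0 < n.choose l := Nat.choose_pos (by omega)
  omega

lemma two_mul_choose_le {n l : ℕ} (h : 2 * (l + 1) ≤ n + 1) :
    2 * n.choose l ≤ (n + 1).choose (l + 1) := by
  have e := choose_pred_mul (n := n) (k := l)
  refine Nat.le_of_mul_le_mul_left (?_ : (l + 1) * _ ≤ (l + 1) * _) (by positivity)
  rw [← e]
  calc (l + 1) * (2 * n.choose l) = (2 * (l + 1)) * n.choose l := by ring
    _ ≤ _ := by gcongr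

/-- Once `K` is at least twice the number of `k`-sets on `n` points, enlarging the first family
from `K` to `K + a` members costs more than it gains. -/
lemma Feasible.add_mul_lt {n k l a b K : ℕ} (h : Feasible n (k + 1) l a b) (ha : 0 < a)
    (hn : k + 1 + l ≤ n) (hl : 2 * l ≤ n) (hK : 2 * n.choose k ≤ K) :
    (K + a) * b < K * n.choose l := by
  induction n generalizing l a b K with
  | zero => omega
  | succ m ih =>
    have hK0 : 0 < K := lt_of_lt_of_le
      (Nat.mul_pos two_pos (Nat.choose_pos (by omega))) hK
    have hKpos : 0 < K * (m + 1).choose l := Nat.mul_pos hK0 (Nat.choose_pos (by omega))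
    rcases Nat.eq_zero_or_pos b with rfl | hb
    · simpa using hKpos
    have hl0 := h.right_pos ha hb
    obtain ⟨l, rfl⟩ : ∃ j, l = j + 1 := ⟨l - 1, by omega⟩
    have hK1 : 2 * m.choose k ≤ K := by
      refine le_trans (Nat.mul_le_mul_left _ ?_) hK
      exact Nat.choose_le_choose _ (Nat.le_succ m)
    have h2 := two_mul_choose_le (n := m) (l := l) hl
    rcases le_or_gt a (m.choose k) with ha1 | ha1
    · rcases Nat.lt_or_ge b (m.choose l) with hb1 | hb1
      · have hlt : (K + a) * b < (K + a) * m.choose l := by gcongr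
        have h3 : 2 * (K + a) ≤ 3 * K := by omega
        nlinarith
      · obtain ⟨b', rfl⟩ : ∃ b', b = m.choose l + b' := ⟨b - m.choose l, by omega⟩
        have h1 := (h.peel_right (by omega)).weighted_sum_le_mul (by omega)
        have hX : 0 < m.choose k := Nat.choose_pos (by omega)
        have hCl := Nat.choose_succ_succ' m l
        set X := m.choose k
        set Y := m.choose l
        set Z := m.choose (l + 1)
        have hYZ : Y ≤ Z := by omega
        have hb' : b' < Z := by
          refine Nat.lt_of_mul_lt_mul_right (?_ : _ * (X) < _ * (X))
          have : 0 < a * Z := Nat.mul_pos ha (lt_of_lt_of_le (Nat.choose_pos (by omega)) hYZ)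
          nlinarith
        rw [hCl]
        -- `K * (Z - b') ≥ K * a * Z / X ≥ 2 * a * Z ≥ a * (Y + Z) > a * (Y + b')`.
        have h4 : a * Z * K + b' * X * K ≤ X * Z * K := by nlinarith
        have h5 : X * (2 * a * Z) ≤ a * Z * K := by nlinarith [Nat.zero_le (a * Z)]
        have h6 : X * (2 * a * Z + b' * K) ≤ X * (Z * K) := by nlinarith
        have h7 := Nat.le_of_mul_le_mul_left h6 hX
        have h8 : a * (Y + b') < a * (2 * Z) := by gcongr; omega
        nlinarith
    · obtain ⟨a', rfl⟩ : ∃ a', a = m.choose k + a' := ⟨a - m.choose k, by omega⟩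
      have h1 := ih (K := K + m.choose k) (h.peel_left (by omega)) (by omega) (by omega)
        (by omega) (by omega)
      have h3 : 2 * (K + m.choose k) ≤ 3 * K := by omega
      calc (K + (m.choose k + a')) * b = (K + m.choose k + a') * b := by ring
        _ < _ := h1
        _ ≤ _ := by nlinarith

/-! ### Comparisons between binomial coefficients -/

lemma choose_succ_left_ratio (i u : ℕ) :
    ((i + u + 1).choose i : ℚ) = (i + u).choose i * (i + u + 1) / (u + 1) := by
  rw [eq_div_iff (by positivity)]
  have := Nat.choose_mul_succ_eq (i + u) i
  rw [show i + u + 1 - i = u + 1 by omega] at this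
  exact_mod_cast this.symm

lemma choose_succ_succ_ratio (n i : ℕ) :
    ((n + 1).choose (i + 1) : ℚ) = n.choose i * (n + 1) / (i + 1) := by
  rw [eq_div_iff (by positivity)]
  have := Nat.add_one_mul_choose_eq n i
  rw [mul_comm (n + 1)] at this
  exact_mod_cast this.symm

lemma choose_succ_right_ratio (i u : ℕ) :
    ((i + u).choose (i + 1) : ℚ) = (i + u).choose i * u / (i + 1) := by
  rw [eq_div_iff (by positivity)]
  have := Nat.choose_succ_right_eq (i + u) i
  rw [show i + u - i = u by omega] at this
  exact_mod_cast this

lemma choose_add_two_ratio (i u : ℕ) :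
    ((i + u + 2).choose i : ℚ) =
      (i + u).choose i * (i + u + 1) * (i + u + 2) / ((u + 1) * (u + 2)) := by
  have h := choose_succ_left_ratio i (u + 1)
  have h1 := choose_succ_left_ratio i u
  rw [show i + (u + 1) + 1 = i + u + 2 by ring, show i + (u + 1) = i + u + 1 by ring] at h
  rw [h, h1]
  push_cast
  field_simp
  ring

lemma choose_add_two_succ_ratio (i u : ℕ) :
    ((i + u + 2).choose (i + 1) : ℚ) =
      (i + u).choose i * (i + u + 1) * (i + u + 2) / ((u + 1) * (i + 1)) := by
  have h := choose_succ_succ_ratio (i + u + 1) i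
  rw [show i + u + 1 + 1 = i + u + 2 by ring] at h
  rw [h, choose_succ_left_ratio]
  push_cast
  field_simp
  ring

lemma choose_add_three_succ_ratio (i u : ℕ) :
    ((i + u + 3).choose (i + 1) : ℚ) =
      (i + u).choose i * (i + u + 1) * (i + u + 2) * (i + u + 3) /
        ((u + 1) * (u + 2) * (i + 1)) := by
  have h := choose_succ_succ_ratio (i + u + 2) i
  rw [show i + u + 2 + 1 = i + u + 3 by ring] at h
  rw [h, choose_add_two_ratio]
  push_cast
  field_simp
  ring

/-- The steepness hypothesis of `mul_lt_of_chord_steep` for the chord that `Feasible.weighted_sum_le`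
gives on `M + 1` points. -/
lemma choose_steep {M i J : ℕ} (hij : i ≤ J) (hM : 2 * J + 2 ≤ M) :
    (M + 3).choose (J + 2) * (M + 1).choose i ≤
      (M + 3).choose (i + 1) * (M + 1).choose (J + 2) := by
  obtain ⟨u, hu⟩ : ∃ u, M = i + u := ⟨M - i, by omega⟩
  obtain ⟨v, hv⟩ : ∃ v, M + 1 = J + 1 + v := ⟨M - J, by omega⟩
  obtain ⟨s, hs⟩ : ∃ s, J = i + s := ⟨J - i, by omega⟩
  obtain ⟨t, ht⟩ : ∃ t, v = J + 2 + t := ⟨v - (J + 2), by omega⟩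
  have hu' : u = i + 2 * s + 2 + t := by omega
  have a1 := choose_succ_left_ratio i u
  have a2 := choose_add_three_succ_ratio i u
  have b1 := choose_succ_right_ratio (J + 1) v
  have b2 := choose_add_two_succ_ratio (J + 1) v
  rw [← hu] at a1 a2
  rw [← hv] at b1 b2
  have key : ((M + 3).choose (J + 2) * (M + 1).choose i : ℚ) ≤
      (M + 3).choose (i + 1) * (M + 1).choose (J + 2) := by
    rw [a1, a2, show J + 2 = J + 1 + 1 by rfl, show M + 3 = M + 1 + 2 by rfl, b2, b1, ← sub_nonneg]
    have hx : (0 : ℚ) ≤ M.choose i := by positivity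
    have hy : (0 : ℚ) ≤ (M + 1).choose (J + 1) := by positivity
    subst hs ht hu'
    push_cast
    generalize (M.choose i : ℚ) = x at hx ⊢
    generalize ((M + 1).choose (i + s + 1) : ℚ) = y at hy ⊢
    field_simp
    ring_nf
    positivity
  exact_mod_cast key

lemma choose_add_mul_choose_le {M i J : ℕ} (hij : i ≤ J) (hM : 2 * J + 2 ≤ M) :
    ((M + 2).choose (J + 1) + (M + 1).choose (J + 1)) * M.choose i ≤
      ((M + 3).choose (i + 1) + (M + 1).choose i) * M.choose (J + 1) := by
  obtain ⟨u, hu⟩ : ∃ u, M = i + u := ⟨M - i, by omega⟩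
  obtain ⟨v, hv⟩ : ∃ v, M = J + v := ⟨M - J, by omega⟩
  obtain ⟨s, hs⟩ : ∃ s, J = i + s := ⟨J - i, by omega⟩
  obtain ⟨t, ht⟩ : ∃ t, v = J + 2 + t := ⟨v - (J + 2), by omega⟩
  have hu' : u = i + 2 * s + 2 + t := by omega
  have a1 := choose_succ_left_ratio i u
  have a2 := choose_add_three_succ_ratio i u
  have b1 := choose_succ_right_ratio J v
  have b2 := choose_add_two_succ_ratio J v
  have b3 := choose_succ_succ_ratio (J + v) J
  rw [← hu] at a1 a2
  rw [← hv] at b1 b2 b3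
  have key : (((M + 2).choose (J + 1) + (M + 1).choose (J + 1)) * M.choose i : ℚ) ≤
      ((M + 3).choose (i + 1) + (M + 1).choose i) * M.choose (J + 1) := by
    rw [a1, a2, b1, b2, b3, ← sub_nonneg]
    have hx : (0 : ℚ) ≤ M.choose i := by positivity
    have hy : (0 : ℚ) ≤ M.choose J := by positivity
    subst hs ht hu'
    have hM' : (M : ℚ) = 2 * i + 2 * s + t + 2 := by rw [hu]; push_cast; ring
    generalize (M.choose i : ℚ) = x at hx ⊢
    generalize (M.choose (i + s) : ℚ) = y at hy ⊢
    rw [hM']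
    push_cast
    field_simp
    ring_nf
    positivity
  exact_mod_cast key

/-- The difference of the two outer binomial coefficients is the sum of `(M + 2 - r).choose (J + 1)`
over `r ≤ i + 1`; only the first four terms are kept. -/
lemma choose_sub_choose_ge {M i J : ℕ} (hi : 2 ≤ i) (hM : i ≤ M) :
    (M + 2).choose (J + 1) + (M + 1).choose (J + 1) + M.choose (J + 1) + (M - 1).choose (J + 1) +
      (M + 1 - i).choose (J + 2) ≤ (M + 3).choose (J + 2) := by
  obtain ⟨m, rfl⟩ : ∃ m, M = m + 1 := ⟨M - 1, by omega⟩
  have h1 := Nat.choose_succ_succ' (m + 1 + 2) (J + 1)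
  have h2 := Nat.choose_succ_succ' (m + 1 + 1) (J + 1)
  have h3 := Nat.choose_succ_succ' (m + 1) (J + 1)
  have h4 := Nat.choose_succ_succ' m (J + 1)
  have h5 : (m + 1 + 1 - i).choose (J + 2) ≤ m.choose (J + 2) :=
    Nat.choose_le_choose _ (by omega)
  simp only [Nat.add_sub_cancel, add_assoc, Nat.reduceAdd] at *
  omega

lemma star_product_poly_nonneg (i s t : ℕ) {M u v : ℚ} (hM : M = 2 * i + 2 * s + t + 6)
    (hu : u = i + 2 * s + 4 + t) (hv : v = i + 2 + s + 2 + t) :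
    0 ≤ v * (v + 1) * (M + v - 1) * (M + 2) * (M + 3) -
      M * (M + 1) * (M + v + 3) * (i + 3) * (u + 2) := by
  subst hM hu hv
  ring_nf
  positivity

lemma edge_point_poly_nonneg (s t w : ℕ) {i M u v J : ℚ} (hi : 3 * i = 2 * s + t + w - 1)
    (hM : M = 2 * i + 2 * s + t + 2) (hu : u = i + 2 * s + 2 + t) (hv : v = i + s + 2 + t)
    (hJ : J = i + s) :
    0 ≤ ((M + 2) * (M + 3) + (i + 1) * (u + 2)) * (M + 1) * (v + 1) -
        (M + 2) * (u + 1) * (u + 2) * (i + 1) - (M + 2) * (M + u + 5) * (J + 1) * (v + 1) := by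
  obtain rfl : i = (2 * s + t + w - 1) / 3 := by linarith
  subst hM hu hv hJ
  ring_nf
  positivity

/-- A corner of the boundary, with `N = M + 2` and `j = J + 1`: the first family is a star together
with the `(N - 1).choose i` sets that avoid its centre and contain two given points, the second one
consists of the sets that contain the centre and one of the two points. -/
lemma add_mul_add_lt {M i J D : ℕ} (hi : 1 ≤ i) (hij : i ≤ J) (hM : 2 * J + 2 ≤ M)
    (hD : D = (M + 1 - i).choose (J + 2)) :
    ((M + 3).choose (i + 1) + (M + 1).choose i) *
      ((M + 2).choose (J + 1) + (M + 1).choose (J + 1)) <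
      ((M + 3).choose (i + 1) + 1) * ((M + 3).choose (J + 2) - D) := by
  obtain ⟨u, hu⟩ : ∃ u, M = i + u := ⟨M - i, by omega⟩
  obtain ⟨v, hv⟩ : ∃ v, M = J + v := ⟨M - J, by omega⟩
  obtain ⟨s, hs⟩ : ∃ s, J = i + s := ⟨J - i, by omega⟩
  obtain ⟨t, ht⟩ : ∃ t, v = J + 2 + t := ⟨v - (J + 2), by omega⟩
  have hu' : u = i + 2 * s + 2 + t := by omega
  have a1 := choose_succ_left_ratio i u
  have a2 := choose_add_three_succ_ratio i u
  have b1 := choose_succ_right_ratio J v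
  have b2 := choose_add_two_succ_ratio J v
  have b3 := choose_succ_succ_ratio (J + v) J
  rw [← hu] at a1 a2
  rw [← hv] at b1 b2 b3
  have hpos : 0 < (M + 2).choose (J + 1) := Nat.choose_pos (by omega)
  rcases hi.eq_or_lt with rfl | hi
  · have hX : (M + 3).choose (J + 2) - D =
        (M + 2).choose (J + 1) + (M + 1).choose (J + 1) + M.choose (J + 1) := by
      have h1 := Nat.choose_succ_succ' (M + 2) (J + 1)
      have h2 := Nat.choose_succ_succ' (M + 1) (J + 1)
      have h3 := Nat.choose_succ_succ' M (J + 1)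
      simp only [Nat.add_sub_cancel, add_assoc, Nat.reduceAdd] at *
      omega
    have key : ((M + 1).choose 1 * ((M + 2).choose (J + 1) + (M + 1).choose (J + 1)) : ℚ) ≤
        ((M + 3).choose (1 + 1) + 1) * M.choose (J + 1) := by
      have c1 : ((M + 3).choose (1 + 1) : ℚ) = (M + 3) * (M + 2) / 2 := by
        have := choose_succ_succ_ratio (M + 2) 1
        rw [show M + 3 = M + 2 + 1 by rfl, this, Nat.choose_one_right]
        push_cast
        ring
      rw [c1, Nat.choose_one_right, b1, b2, b3, ← sub_nonneg]
      have hy : (0 : ℚ) ≤ M.choose J := by positivity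
      subst hs ht hu'
      have hM' : (M : ℚ) = 4 + 2 * s + t := by rw [hu]; push_cast; ring
      generalize (M.choose (1 + s) : ℚ) = y at hy ⊢
      push_cast
      rw [hM']
      field_simp
      ring_nf
      positivity
    have key' : (M + 1).choose 1 * ((M + 2).choose (J + 1) + (M + 1).choose (J + 1)) ≤
        ((M + 3).choose (1 + 1) + 1) * M.choose (J + 1) := by exact_mod_cast key
    rw [hX]
    linarith
  · obtain ⟨h, rfl⟩ : ∃ h, i = h + 2 := ⟨i - 2, by omega⟩
    have hge := choose_sub_choose_ge (J := J) hi (show h + 2 ≤ M by omega)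
    rw [← hD] at hge
    have b4 := choose_succ_left_ratio (J + 1) (v - 2)
    rw [show J + 1 + (v - 2) + 1 = M by omega, show J + 1 + (v - 2) = M - 1 by omega,
      show ((v - 2 : ℕ) : ℚ) + 1 = v - 1 by rw [Nat.cast_sub (by omega)]; push_cast; ring] at b4
    have hv1 : ((v : ℚ) - 1) ≠ 0 := by
      have : (2 : ℚ) ≤ v := by exact_mod_cast (show 2 ≤ v by omega)
      linarith
    have b5 : ((M - 1).choose (J + 1) : ℚ) = M.choose (J + 1) * (v - 1) / M := by
      have hM0 : (M : ℚ) ≠ 0 := by exact_mod_cast (show M ≠ 0 by omega)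
      have : (↑(J + 1) + ↑(v - 2) + 1 : ℚ) = M := by
        rw [Nat.cast_sub (by omega), hv]; push_cast; ring
      rw [this] at b4
      rw [b4]
      field_simp
    have key : ((M + 1).choose (h + 2) * ((M + 2).choose (J + 1) + (M + 1).choose (J + 1)) : ℚ) ≤
        (M + 3).choose (h + 2 + 1) * (M.choose (J + 1) + (M - 1).choose (J + 1)) := by
      have hMu : ((h + 2 : ℕ) : ℚ) + u = M := by rw [hu]; push_cast; ring
      have hMv : (J : ℚ) + v = M := by rw [hv]; push_cast; ring
      have hu'' : (u : ℚ) = h + 2 * s + 4 + t := by rw [hu']; push_cast; ring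
      have hv'' : (v : ℚ) = h + 2 + s + 2 + t := by rw [ht, hs]; push_cast; ring
      have hM' : (M : ℚ) = 2 * h + 2 * s + t + 6 := by rw [← hMu, hu'']; push_cast; ring
      have hp := star_product_poly_nonneg h s t hM' hu'' hv''
      have hMp : (0 : ℚ) < M := by rw [hM']; positivity
      rw [b5, a1, a2, b1, b2, b3, ← sub_nonneg, hMu, hMv]
      have hx : (0 : ℚ) ≤ M.choose (h + 2) := by positivity
      have hy : (0 : ℚ) ≤ M.choose J := by positivity
      have hu0 : (0 : ℚ) ≤ u := by positivity
      have hv0 : (0 : ℚ) ≤ v := by positivity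
      have hJ0 : (0 : ℚ) ≤ J := by positivity
      have hh0 : (0 : ℚ) ≤ h := by positivity
      push_cast
      have hJv : (M : ℚ) - v = J := by linarith
      generalize (M.choose (h + 2) : ℚ) = x at *
      generalize (M.choose J : ℚ) = y at *
      clear * - hp hx hy hu0 hv0 hJ0 hh0 hMp
      generalize (M : ℚ) = M at *
      generalize (u : ℚ) = u at *
      generalize (v : ℚ) = v at *
      generalize (J : ℚ) = J at *
      generalize (h : ℚ) = h at *
      have : x * (M + 1) * (M + 2) * (M + 3) / ((u + 1) * (u + 2) * (h + 2 + 1)) *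
          (y * v / (J + 1) + y * v / (J + 1) * (v - 1) / M) -
          x * (M + 1) / (u + 1) * (y * (M + 1) * (M + 2) / ((v + 1) * (J + 1)) +
          y * (M + 1) / (J + 1)) = x * y * (M + 1) * (v * (v + 1) * (M + v - 1) * (M + 2) *
          (M + 3) - M * (M + 1) * (M + v + 3) * (h + 3) * (u + 2)) /
          ((u + 1) * (u + 2) * (h + 3) * (J + 1) * (v + 1) * M) := by
        field_simp
        ring
      rw [this]
      positivity
    have key' : (M + 1).choose (h + 2) * ((M + 2).choose (J + 1) + (M + 1).choose (J + 1)) ≤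
        (M + 3).choose (h + 2 + 1) * (M.choose (J + 1) + (M - 1).choose (J + 1)) := by
      exact_mod_cast key
    have h3 : (M + 2).choose (J + 1) + (M + 1).choose (J + 1) + M.choose (J + 1) +
        (M - 1).choose (J + 1) ≤ (M + 3).choose (J + 2) - D := by omega
    have h4 := Nat.mul_le_mul_left ((M + 3).choose (h + 2 + 1) + 1) h3
    linarith

lemma edge_point_identity (x y M : ℚ) {i u v J : ℚ} (hi : 0 ≤ i) (hu : 0 ≤ u) (hv : 0 ≤ v)
    (hJ : 0 ≤ J) :
    (x * (M + 1) * (M + 2) * (M + 3) / ((u + 1) * (u + 2) * (i + 1)) +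
        x * (M + 1) / (u + 1)) * (y * (M + 1) / (J + 1)) -
      (x * (y * (M + 1) * (M + 2) / ((v + 1) * (J + 1))) +
        (x * (M + 1) * (M + 2) * (M + 3) / ((u + 1) * (u + 2) * (i + 1)) +
          x * (M + 1) * (M + 2) / ((u + 1) * (i + 1))) * y) =
    x * y * (M + 1) * (((M + 2) * (M + 3) + (i + 1) * (u + 2)) * (M + 1) *
          (v + 1) - (M + 2) * (u + 1) * (u + 2) * (i + 1) -
          (M + 2) * (M + u + 5) * (J + 1) * (v + 1)) /
            ((i + 1) * (v + 1) * (J + 1) * (u + 1) * (u + 2)) := by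
  field_simp
  ring

/-- A point of the boundary at which both competing bounds are close to sharp; which of the two
dominates depends on whether `M` exceeds about five times `i`. -/
lemma edge_point_le_max {M i J : ℕ} (hij : i ≤ J) (hM : 2 * J + 2 ≤ M) :
    ((M + 3).choose (i + 1) + (M + 1).choose i + M.choose i) *
        ((M + 2).choose (J + 1) + M.choose J) + M.choose (i + 1) * M.choose J ≤
      max (((M + 3).choose (i + 1) + (M + 2).choose (i + 1)) * (M + 2).choose (J + 1))
        (((M + 3).choose (i + 1) + (M + 1).choose i) *
          ((M + 2).choose (J + 1) + (M + 1).choose (J + 1))) := by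
  obtain ⟨u, hu⟩ : ∃ u, M = i + u := ⟨M - i, by omega⟩
  obtain ⟨v, hv⟩ : ∃ v, M = J + v := ⟨M - J, by omega⟩
  obtain ⟨s, hs⟩ : ∃ s, J = i + s := ⟨J - i, by omega⟩
  obtain ⟨t, ht⟩ : ∃ t, v = J + 2 + t := ⟨v - (J + 2), by omega⟩
  have hu' : u = i + 2 * s + 2 + t := by omega
  have a1 := choose_succ_left_ratio i u
  have a2 := choose_add_three_succ_ratio i u
  have a3 := choose_add_two_succ_ratio i u
  have a4 := choose_succ_right_ratio i u
  have b2 := choose_add_two_succ_ratio J v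
  have b3 := choose_succ_succ_ratio (J + v) J
  rw [← hu] at a1 a2 a3 a4
  rw [← hv] at b2 b3
  have hsplit : (M + 2).choose (i + 1) = (M + 1).choose i + M.choose i + M.choose (i + 1) := by
    have h1 := Nat.choose_succ_succ' (M + 1) i
    have h2 := Nat.choose_succ_succ' M i
    simp only [add_assoc, Nat.reduceAdd] at *
    omega
  have hx : (0 : ℚ) ≤ M.choose i := by positivity
  have hy : (0 : ℚ) ≤ M.choose J := by positivity
  have hMu : (M : ℚ) = i + u := by rw [hu]; push_cast; ring
  have hMv : (M : ℚ) = J + v := by rw [hv]; push_cast; ring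
  have hs' : (J : ℚ) = i + s := by rw [hs]; push_cast; ring
  have ht' : (v : ℚ) = i + s + 2 + t := by rw [ht, hs]; push_cast; ring
  have hu'' : (u : ℚ) = i + 2 * s + 2 + t := by rw [hu']; push_cast; ring
  rcases le_or_gt (4 * i + 4) u with hc | hc
  · refine le_max_of_le_left ?_
    obtain ⟨w, hw⟩ : ∃ w, u = 4 * i + 4 + w := ⟨u - (4 * i + 4), by omega⟩
    have hw' : (u : ℚ) = 4 * i + 4 + w := by rw [hw]; push_cast; ring
    have p1 : (4 * (J + 1) * (v + 1) : ℚ) ≤ M ^ 2 + 4 * M := by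
      rw [hMv, ← sub_nonneg, ht', hs']
      ring_nf
      positivity
    have p2 : (((M : ℚ) ^ 2 + 4 * M) * (M + u + 5) : ℚ) ≤ 4 * u * (u + 1) * (u + 2) := by
      rw [hMu, ← sub_nonneg, hw']
      ring_nf
      positivity
    have p3 : (0 : ℚ) ≤ u * (u + 1) * (u + 2) - (J + 1) * (v + 1) * (M + u + 5) := by
      have := mul_le_mul_of_nonneg_right p1 (show (0 : ℚ) ≤ M + u + 5 by positivity)
      clear * - this p2
      linarith
    have key : (((M + 3).choose (i + 1) + (M + 2).choose (i + 1)) * M.choose J : ℚ) ≤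
        M.choose (i + 1) * (M + 2).choose (J + 1) := by
      rw [a2, a3, a4, b2, ← sub_nonneg]
      have : (M.choose i * u / (i + 1) * (M.choose J * (J + v + 1) * (J + v + 2) /
            ((v + 1) * (J + 1))) - (M.choose i * (i + u + 1) * (i + u + 2) * (i + u + 3) /
            ((u + 1) * (u + 2) * (i + 1)) + M.choose i * (i + u + 1) * (i + u + 2) /
            ((u + 1) * (i + 1))) * M.choose J : ℚ) =
          M.choose i * M.choose J * (M + 1) * (M + 2) *
            (u * (u + 1) * (u + 2) - (J + 1) * (v + 1) * (M + u + 5)) /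
            ((i + 1) * (v + 1) * (J + 1) * (u + 1) * (u + 2)) := by
        rw [← hMu, ← hMv]
        field_simp
        ring
      rw [this]
      positivity
    have key' : ((M + 3).choose (i + 1) + (M + 2).choose (i + 1)) * M.choose J ≤
        M.choose (i + 1) * (M + 2).choose (J + 1) := by exact_mod_cast key
    rw [hsplit] at key' ⊢
    clear * - key'
    linarith
  · refine le_max_of_le_right ?_
    obtain ⟨w, hw⟩ : ∃ w, 2 * s + t + w = 3 * i + 1 := ⟨3 * i + 1 - 2 * s - t, by omega⟩
    have hi : (3 * i : ℚ) = 2 * s + t + w - 1 := by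
      rw [eq_sub_iff_add_eq]
      exact_mod_cast hw.symm
    have p1 : (0 : ℚ) ≤ ((M + 2) * (M + 3) + (i + 1) * (u + 2)) * (M + 1) * (v + 1) -
        (M + 2) * (u + 1) * (u + 2) * (i + 1) - (M + 2) * (M + u + 5) * (J + 1) * (v + 1) := by
      exact edge_point_poly_nonneg s t w hi (by rw [hMu, hu'']; ring) hu'' ht' hs'
    have key : (M.choose i * (M + 2).choose (J + 1) + ((M + 3).choose (i + 1) +
        (M + 2).choose (i + 1)) * M.choose J : ℚ) ≤
        ((M + 3).choose (i + 1) + (M + 1).choose i) * (M + 1).choose (J + 1) := by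
      rw [a1, a2, a3, b2, b3, ← sub_nonneg]
      rw [← hMu, ← hMv]
      rw [edge_point_identity _ _ _ (by positivity) (by positivity) (by positivity) (by positivity)]
      positivity
    have key' : M.choose i * (M + 2).choose (J + 1) + ((M + 3).choose (i + 1) +
        (M + 2).choose (i + 1)) * M.choose J ≤
        ((M + 3).choose (i + 1) + (M + 1).choose i) * (M + 1).choose (J + 1) := by
      exact_mod_cast key
    rw [hsplit] at key'
    clear * - key'
    linarith

/-! ### The numerical bound when one family is larger than a star -/

/-- Along the chord `a * R + b * σ ≤ const` the product decreases strictly when the chord is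
steep. -/
lemma mul_lt_of_chord_steep {K a Y E σ R : ℕ} (ha : 2 ≤ a) (hR : 0 < R)
    (h : σ * Y + a * R ≤ σ * E + R) (hs : σ * E ≤ K * R) : (K + a) * Y < (K + 1) * E := by
  obtain ⟨t, rfl⟩ : ∃ t, a = t + 2 := ⟨a - 2, by omega⟩
  refine Nat.lt_of_mul_lt_mul_left (a := σ) ?_
  have h1 : σ * Y + (t + 1) * R ≤ σ * E := by linarith
  have h2 := Nat.mul_le_mul_left (K + (t + 2)) h1
  have h3 := Nat.mul_le_mul_left (t + 1) hs
  have h4 : 0 < (t + 1) * (t + 2) * R := by positivity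
  nlinarith

/-- Along a chord starting at `(X, Y₀)` the product decreases strictly when the chord is steep. -/
lemma mul_lt_of_chord {X a Y Y₀ x C : ℕ} (ha : 0 < a) (hC : 0 < C)
    (h : x * Y + a * C ≤ x * Y₀) (hs : Y₀ * x ≤ X * C) : (X + a) * Y < X * Y₀ := by
  refine Nat.lt_of_mul_lt_mul_left (a := x) ?_
  have h2 := Nat.mul_le_mul_left (X + a) h
  have h3 := Nat.mul_le_mul_left a hs
  have h4 : 0 < a * a * C := by positivity
  nlinarith

/-- On the last edge of the boundary the product stays below the interpolation between the values
at its end points. -/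
lemma mul_lt_of_last_edge {X a Q b d y mx : ℕ} (had : a < d) (hy : 0 < y)
    (h : a * y + b * d ≤ d * y) (h1 : (X + d) * Q ≤ mx) (h2 : X * (Q + y) + d * y ≤ mx) :
    (X + a) * (Q + b) < mx := by
  obtain ⟨r, rfl⟩ : ∃ r, d = a + r := ⟨d - a, by omega⟩
  have hr : 0 < r := by omega
  refine Nat.lt_of_mul_lt_mul_left (a := a + r) ?_
  have h3 : (a + r) * (Q + b) ≤ (a + r) * Q + y * r := by nlinarith
  have h4 := Nat.mul_le_mul_left (X + a) h3
  have h5 := Nat.mul_le_mul_left a h1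
  have h6 := Nat.mul_le_mul_left r h2
  have h7 : 0 < y * r * r := by positivity
  nlinarith

/-- The product of the sizes of a star together with `a` further `k`-sets, and of the family of `b`
sets through the centre. -/
theorem Feasible.mul_lt_max_or {N i j a b : ℕ} (h : Feasible (N + 1) (i + 2) (j + 1) a b)
    (ha : 0 < a) (hN : (i < j ∧ 2 * j + 2 ≤ N) ∨ (i = j ∧ 2 * j + 3 ≤ N)) :
    ((N + 1).choose (i + 1) + a) * b <
        max (((N + 1).choose (i + 1) + N.choose (i + 1)) * N.choose j)
          (((N + 1).choose (i + 1) + 1) *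
            ((N + 1).choose (j + 1) - (N - i - 1).choose (j + 1))) ∨
      (a = N.choose (i + 1) ∧ b = N.choose j) ∨
      (a = 1 ∧ b = (N + 1).choose (j + 1) - (N - i - 1).choose (j + 1)) := by
  have hQ : 0 < N.choose j := Nat.choose_pos (by omega)
  have hNk := Nat.choose_succ_succ' N i
  have hNl := Nat.choose_succ_succ' N j
  have hDN : (N - i - 1).choose (j + 1) ≤ N.choose (j + 1) := Nat.choose_le_choose _ (by omega)
  rcases lt_or_ge a (N.choose (i + 1)) with haN | haN
  swap
  · obtain ⟨a', rfl⟩ : ∃ a', a = N.choose (i + 1) + a' := ⟨_, (Nat.add_sub_of_le haN).symm⟩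
    have h' := h.peel_left (by omega)
    rcases Nat.eq_zero_or_pos a' with rfl | ha'
    · rcases h'.right_le.eq_or_lt with hb | hb
      · right; left; exact ⟨rfl, hb⟩
      · left
        refine lt_max_of_lt_left ?_
        exact Nat.mul_lt_mul_of_pos_left hb (by omega)
    · left
      refine lt_max_of_lt_left ?_
      have := h'.add_mul_lt (K := (N + 1).choose (i + 1) + N.choose (i + 1)) ha'
        (by omega) (by omega) (by omega)
      rwa [← add_assoc]
  rcases le_or_gt b (N.choose j) with hb | hb
  · left
    refine lt_max_of_lt_left ?_
    calc _ ≤ ((N + 1).choose (i + 1) + a) * N.choose j := Nat.mul_le_mul_left _ hb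
      _ < _ := Nat.mul_lt_mul_of_pos_right (by omega) hQ
  obtain ⟨b₁, rfl⟩ : ∃ b₁, b = N.choose j + b₁ := ⟨_, (Nat.add_sub_of_le hb.le).symm⟩
  have hb₁ : 0 < b₁ := by omega
  have h1 : Feasible N (i + 1) (j + 1) a b₁ := h.peel_right (by omega)
  rcases Nat.lt_or_ge 1 a with ha2 | ha2
  swap
  · obtain rfl : a = 1 := by omega
    have h2 := h1.add_choose_le one_pos
    rw [← Nat.sub_sub] at h2
    rcases h2.eq_or_lt with h3 | h3
    · right; right; exact ⟨rfl, by omega⟩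
    · left
      refine lt_max_of_lt_right ?_
      exact Nat.mul_lt_mul_of_pos_left (by omega) (by omega)
  left
  rcases hN with ⟨hij, hN⟩ | ⟨rfl, hN⟩
  swap
  · refine lt_max_of_lt_right ?_
    have hm := h1.weighted_sum_le le_rfl (by omega) ha hb₁
    rw [← Nat.sub_sub] at hm
    have hpos : 0 < N.choose (i + 1) := Nat.choose_pos (by omega)
    refine mul_lt_of_chord_steep (σ := 1) (R := 1) ha2 one_pos ?_ (by omega)
    have : a + b₁ + (N - i - 1).choose (i + 1) ≤ N.choose (i + 1) + 1 := by
      refine Nat.le_of_mul_le_mul_left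
        (?_ : N.choose (i + 1) * _ ≤ N.choose (i + 1) * _) hpos
      linarith
    omega
  obtain ⟨J, rfl⟩ : ∃ J, j = J + 1 := ⟨j - 1, by omega⟩
  obtain ⟨M, rfl⟩ : ∃ M, N = M + 2 := ⟨N - 2, by omega⟩
  rw [show M + 2 - i - 1 = M + 1 - i by omega] at *
  have e1 := Nat.choose_succ_succ' (M + 1) i
  have e2 := Nat.choose_succ_succ' (M + 1) (J + 1)
  have e3 := Nat.choose_succ_succ' M i
  have e4 := Nat.choose_succ_succ' M J
  have hij' : i ≤ J := by omega
  have hM : 2 * J + 2 ≤ M := by omega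
  simp only [add_assoc, Nat.reduceAdd] at *
  have hcorner : ((M + 3).choose (i + 1) + (M + 1).choose i) *
      ((M + 2).choose (J + 1) + (M + 1).choose (J + 1)) ≤
      ((M + 3).choose (i + 1) + 1) * ((M + 3).choose (J + 2) - (M + 1 - i).choose (J + 2)) := by
    rcases Nat.eq_zero_or_pos i with rfl | hi
    · refine Nat.mul_le_mul (by simp) ?_
      simp only [Nat.sub_zero]
      omega
    · exact (add_mul_add_lt hi hij' hM rfl).le
  rcases le_or_gt a ((M + 1).choose i) with haσ | haσ
  · refine lt_max_of_lt_right ?_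
    have hi : 1 ≤ i := by
      by_contra hi
      obtain rfl : i = 0 := by omega
      simp at haσ
      omega
    rcases le_or_gt b₁ ((M + 1).choose (J + 1)) with hbσ | hbσ
    · refine lt_of_le_of_lt ?_ (add_mul_add_lt hi hij' hM rfl)
      exact Nat.mul_le_mul (by omega) (by omega)
    · obtain ⟨b₂, rfl⟩ : ∃ b₂, b₁ = (M + 1).choose (J + 1) + b₂ :=
        ⟨_, (Nat.add_sub_of_le hbσ.le).symm⟩
      have h2 : Feasible (M + 1) i (J + 2) a b₂ := h1.peel_right (by omega)
      have hm := h2.weighted_sum_le (by omega) (by omega) ha (by omega)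
      have hR : 0 < (M + 1).choose (J + 2) := Nat.choose_pos (by omega)
      have hs := choose_steep hij' hM
      have hD : (M + 1 - i).choose (J + 2) ≤ (M + 1).choose (J + 2) :=
        Nat.choose_le_choose _ (by omega)
      refine mul_lt_of_chord_steep ha2 hR ?_
        ((Nat.mul_le_mul_left _ (Nat.sub_le _ _)).trans ((mul_comm _ _).trans_le hs))
      rw [show (M + 3).choose (J + 2) - (M + 1 - i).choose (J + 2) = (M + 2).choose (J + 1) +
        (M + 1).choose (J + 1) + ((M + 1).choose (J + 2) - (M + 1 - i).choose (J + 2)) by omega]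
      obtain ⟨R', hR'⟩ := Nat.exists_eq_add_of_le hD
      rw [hR', Nat.add_sub_cancel_left]
      rw [hR'] at hm
      linarith
  obtain ⟨a', rfl⟩ : ∃ a', a = (M + 1).choose i + a' := ⟨_, (Nat.add_sub_of_le haσ.le).symm⟩
  have ha' : 0 < a' := by omega
  have h2 : Feasible (M + 1) (i + 1) (J + 1) a' b₁ := h1.peel_left (by omega)
  have hedge := edge_point_le_max hij' hM
  have hy : 0 < M.choose J := Nat.choose_pos (by omega)
  have hC : 0 < M.choose (J + 1) := Nat.choose_pos (by omega)
  rcases le_or_gt a' (M.choose i) with hax | hax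
  · rcases le_or_gt (M.choose J) b₁ with hby | hby
    · refine lt_max_of_lt_right (lt_of_lt_of_le ?_ hcorner)
      obtain ⟨b', rfl⟩ : ∃ b', b₁ = M.choose J + b' := ⟨_, (Nat.add_sub_of_le hby).symm⟩
      have h3 : Feasible M i (J + 1) a' b' := h2.peel_right (by omega)
      have hm := h3.weighted_sum_le_mul (by omega)
      rw [← add_assoc]
      refine mul_lt_of_chord ha' hC ?_ (choose_add_mul_choose_le hij' hM)
      rw [e4]
      linarith
    · refine lt_of_lt_of_le ?_ ((le_trans (Nat.le_add_right _ _) hedge).trans ?_)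
      · refine lt_of_le_of_lt (b := ((M + 3).choose (i + 1) + (M + 1).choose i + M.choose i) *
          ((M + 2).choose (J + 1) + b₁)) (Nat.mul_le_mul_right _ (by omega)) ?_
        exact Nat.mul_lt_mul_of_pos_left (by omega) (by omega)
      · exact max_le_max le_rfl hcorner
  · obtain ⟨a'', rfl⟩ : ∃ a'', a' = M.choose i + a'' := ⟨_, (Nat.add_sub_of_le hax.le).symm⟩
    have h3 : Feasible M (i + 1) J a'' b₁ := h2.peel_left (by omega)
    have hm := h3.weighted_sum_le_mul (by omega)
    have := mul_lt_of_last_edge (X := (M + 3).choose (i + 1) + (M + 1).choose i + M.choose i)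
      (Q := (M + 2).choose (J + 1)) (d := M.choose (i + 1)) (a := a'') (by omega) hy hm
      (le_max_of_le_left (by rw [e1, e3]; simp only [add_assoc]; exact le_rfl)) hedge
    refine lt_of_lt_of_le ?_ (max_le_max le_rfl hcorner)
    simpa only [add_assoc] using this

lemma choose_mul_choose_succ_lt {N i j : ℕ} (hij : i < j) (hN : 2 * j + 2 ≤ N) :
    (N.choose i + 1) * N.choose (j + 1) < N.choose (i + 1) * N.choose j + N.choose (i + 1) := by
  have h1 := Nat.choose_succ_right_eq N i
  have h2 := Nat.choose_succ_right_eq N j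
  obtain ⟨s, rfl⟩ : ∃ s, j = i + 1 + s := ⟨j - (i + 1), by omega⟩
  obtain ⟨v, rfl⟩ : ∃ v, N = i + 1 + s + v := ⟨N - (i + 1 + s), by omega⟩
  rw [show i + 1 + s + v - i = 1 + s + v by omega] at h1
  rw [show i + 1 + s + v - (i + 1 + s) = v by omega] at h2
  have hP : i + 1 ≤ (i + 1 + s + v).choose i := by
    rcases Nat.eq_zero_or_pos i with rfl | hi
    · simp
    · have := le_choose hi (show i < i + 1 + s + v by omega)
      omega
  have hQ : 0 < (i + 1 + s + v).choose (i + 1 + s) := Nat.choose_pos (by omega)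
  generalize (i + 1 + s + v).choose i = P at *
  generalize (i + 1 + s + v).choose (i + 1) = N₁ at *
  generalize (i + 1 + s + v).choose (i + 1 + s) = Q at *
  generalize (i + 1 + s + v).choose (i + 1 + s + 1) = N₂ at *
  have hN₁ : 0 < N₁ := by
    rcases Nat.eq_zero_or_pos N₁ with rfl | h
    · have : 0 < P * (1 + s + v) := Nat.mul_pos (by omega) (by omega)
      omega
    · exact h
  refine Nat.lt_of_mul_lt_mul_left (a := (i + 1) * (i + 1 + s + 1)) ?_
  have h3 : (P + 1) * v * (i + 1) ≤ P * (1 + s + v) * (i + 1 + s + 1) := by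
    have h4 := Nat.mul_le_mul_right v hP
    have h5 : 0 ≤ P * (1 + s) * (i + 1 + s + 1) := by positivity
    have h6 : 0 ≤ P * v * s := by positivity
    nlinarith
  have h4 := Nat.mul_le_mul_left Q h3
  have h5 : 0 < (i + 1) * (i + 1 + s + 1) * N₁ := by positivity
  have h6 : (i + 1) * (i + 1 + s + 1) * ((P + 1) * N₂) = Q * ((P + 1) * v * (i + 1)) := by
    calc _ = (i + 1) * (P + 1) * (N₂ * (i + 1 + s + 1)) := by ring
      _ = _ := by rw [h2]; ring
  have h7 : (i + 1) * (i + 1 + s + 1) * (N₁ * Q) = Q * (P * (1 + s + v) * (i + 1 + s + 1)) := by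
    calc _ = (N₁ * (i + 1)) * ((i + 1 + s + 1) * Q) := by ring
      _ = _ := by rw [h1]; ring
  rw [mul_add _ (N₁ * Q), h6, h7]
  omega

lemma choose_le_choose_of_le_half {n i j : ℕ} (hij : i ≤ j) (hj : 2 * j ≤ n) :
    n.choose i ≤ n.choose j := by
  induction j, hij using Nat.le_induction with
  | base => exact le_rfl
  | succ j hij ih =>
    exact (ih (by omega)).trans (Nat.choose_le_succ_of_lt_half_left (by omega))

/-- If the family of `l`-sets, `l > k`, is larger than a star, the product is never extremal. -/
theorem Feasible.mul_lt_max_of_right {N i j a b : ℕ}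
    (h : Feasible (N + 2) (i + 2) (j + 2) a ((N + 1).choose (j + 1) + b))
    (ha : 0 < a) (hb : 0 < b) (hij : i < j) (hN : 2 * j + 2 ≤ N) :
    a * ((N + 1).choose (j + 1) + b) <
        max (((N + 1).choose (i + 1) + N.choose (i + 1)) * N.choose j)
          (((N + 1).choose (i + 1) + 1) *
            ((N + 1).choose (j + 1) - (N - i - 1).choose (j + 1))) := by
  have h1 : Feasible (N + 1) (i + 1) (j + 2) a b := h.peel_right (by omega)
  have hlt := choose_mul_choose_succ_lt hij hN
  have hNk := Nat.choose_succ_succ' N i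
  have hNl := Nat.choose_succ_succ' N j
  have hQ : 0 < N.choose j := Nat.choose_pos (by omega)
  have hP : 0 < N.choose i := Nat.choose_pos (by omega)
  have hN₁ : 0 < N.choose (i + 1) := Nat.choose_pos (by omega)
  have hN₂ : 0 < N.choose (j + 1) := Nat.choose_pos (by omega)
  have hDN : (N - i - 1).choose (j + 1) ≤ N.choose (j + 1) := Nat.choose_le_choose _ (by omega)
  have hN₁₂ : N.choose (i + 1) ≤ N.choose (j + 1) := 
    choose_le_choose_of_le_half (by omega) (by omega)
  rcases le_or_gt a (N.choose i) with haP | haP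
  · refine lt_max_of_lt_left ?_
    have hle : a * ((N + 1).choose (j + 1) + b) ≤
        N.choose i * ((N + 1).choose (j + 1) + N.choose (j + 1)) := by
      rcases le_or_gt b (N.choose (j + 1)) with hb2 | hb2
      · exact Nat.mul_le_mul haP (by omega)
      · obtain ⟨b', rfl⟩ : ∃ b', b = N.choose (j + 1) + b' :=
          ⟨_, (Nat.add_sub_of_le hb2.le).symm⟩
        have h2 : Feasible N i (j + 2) a b' := h1.peel_right (by omega)
        have := h2.symm.add_mul_lt (K := (N + 1).choose (j + 1) + N.choose (j + 1)) (by omega)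
          (by omega) (by omega) (by omega)
        rw [← add_assoc]
        linarith
    rw [hNk, hNl] at *
    nlinarith
  · refine lt_max_of_lt_right ?_
    obtain ⟨a₁, rfl⟩ : ∃ a₁, a = N.choose i + a₁ := ⟨_, (Nat.add_sub_of_le haP.le).symm⟩
    have h2 : Feasible N (i + 1) (j + 1) a₁ b := h1.peel_left (by omega)
    have hm := h2.weighted_sum_le (by omega) (by omega) (by omega) hb
    rw [← Nat.sub_sub] at hm
    have hle := h2.left_le
    obtain ⟨E, hE⟩ := Nat.exists_eq_add_of_le hDN
    obtain ⟨c, hc⟩ := Nat.exists_eq_add_of_le hle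
    rw [show (N + 1).choose (j + 1) - (N - i - 1).choose (j + 1) = N.choose j + E by omega, hNk,
      hNl]
    generalize (N - i - 1).choose (j + 1) = D at *
    generalize N.choose (i + 1) = N₁ at *
    generalize N.choose (j + 1) = N₂ at *
    generalize N.choose i = P at *
    generalize N.choose j = Q at *
    subst hc
    -- `N₁ * (N₂ + b)` is at most `N₁ * E + (c + 1) * N₂`
    have h3 : (a₁ + c) * (Q + N₂ + b) ≤ (a₁ + c) * (Q + E) + (c + 1) * N₂ := by nlinarith
    have h4 : (P + a₁) * N₂ < (a₁ + c) * (Q + E) := by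
      have h5 : a₁ * N₂ + (a₁ + c) ≤ (a₁ + c) * E + N₂ := by nlinarith
      nlinarith
    refine Nat.lt_of_mul_lt_mul_left (a := a₁ + c) ?_
    have h6 := Nat.mul_le_mul_left (P + a₁) h3
    have h7 := Nat.mul_lt_mul_of_pos_left h4 (show 0 < c + 1 by omega)
    nlinarith

/-! ### Links and degrees -/

section Links

lemma CrossIntersecting.symm {n : ℕ} {𝒜 ℬ : Finset (Finset (Fin n))}
    (h : CrossIntersecting 𝒜 ℬ) : CrossIntersecting ℬ 𝒜 := fun B hB A hA => by
  rw [inter_comm]; exact h A hA B hB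

lemma CrossIntersecting.feasible {n k l : ℕ} {𝒜 ℬ : Finset (Finset (Fin n))}
    (h : CrossIntersecting 𝒜 ℬ) (h𝒜 : 𝒜 ⊆ uniform n k) (hℬ : ℬ ⊆ uniform n l) :
    Feasible n k l #𝒜 #ℬ := ⟨𝒜, ℬ, h𝒜, hℬ, h, le_rfl, le_rfl⟩

variable {α : Type*} [DecidableEq α] {S : Finset α} {n k l : ℕ} {𝒜 ℬ : Finset (Finset α)}

lemma memberSubfamily_subset (h𝒜 : 𝒜 ⊆ powersetCard (k + 1) S) (x : α) :
    𝒜.memberSubfamily x ⊆ powersetCard k (S.erase x) := by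
  intro A hA
  rw [mem_memberSubfamily] at hA
  obtain ⟨h1, h2⟩ := mem_powersetCard.1 (h𝒜 hA.1)
  rw [card_insert_of_notMem hA.2] at h2
  exact mem_powersetCard.2 ⟨subset_erase.2 ⟨(subset_insert _ _).trans h1, hA.2⟩, by omega⟩

lemma nonMemberSubfamily_subset (h𝒜 : 𝒜 ⊆ powersetCard k S) (x : α) :
    𝒜.nonMemberSubfamily x ⊆ powersetCard k (S.erase x) := by
  intro A hA
  rw [mem_nonMemberSubfamily] at hA
  obtain ⟨h1, h2⟩ := mem_powersetCard.1 (h𝒜 hA.1)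
  exact mem_powersetCard.2 ⟨subset_erase.2 ⟨h1, hA.2⟩, h2⟩

lemma feasible_link (h : ∀ A ∈ 𝒜, ∀ B ∈ ℬ, (A ∩ B).Nonempty)
    (h𝒜 : 𝒜 ⊆ powersetCard (k + 1) S) (hℬ : ℬ ⊆ powersetCard l S) {x : α} (hx : x ∈ S)
    (hS : #S = n + 1) : Feasible n k l #(𝒜.memberSubfamily x) #(ℬ.nonMemberSubfamily x) := by
  have := feasible_card (memberSubfamily_subset h𝒜 x) (nonMemberSubfamily_subset hℬ x) ?_
  · rwa [card_erase_of_mem hx, hS, Nat.add_sub_cancel] at this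
  · intro A hA B hB
    rw [mem_memberSubfamily] at hA
    rw [mem_nonMemberSubfamily] at hB
    have := h _ hA.1 _ hB.1
    rwa [insert_inter_of_notMem hB.2] at this

lemma CrossIntersecting.feasible_link {𝒜 ℬ : Finset (Finset (Fin (n + 1)))}
    (h : CrossIntersecting 𝒜 ℬ)
    (h𝒜 : 𝒜 ⊆ uniform (n + 1) (k + 1)) (hℬ : ℬ ⊆ uniform (n + 1) l) (x : Fin (n + 1)) :
    Feasible n k l #(𝒜.memberSubfamily x) #(ℬ.nonMemberSubfamily x) :=
  CrossInt.feasible_link h h𝒜 hℬ (mem_univ x) (by simp)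

lemma card_memberSubfamily (x : α) :
    #(𝒜.memberSubfamily x) = #(𝒜.filter fun A => x ∈ A) := by
  rw [memberSubfamily, card_image_of_injOn]
  exact (erase_injOn' x).mono (by intro A; simp)

lemma sum_card_memberSubfamily (h𝒜 : 𝒜 ⊆ powersetCard k S) :
    ∑ x ∈ S, #(𝒜.memberSubfamily x) = k * #𝒜 := by
  simp only [card_memberSubfamily, card_filter]
  rw [sum_comm, mul_comm, ← smul_eq_mul, ← sum_const]
  refine sum_congr rfl fun A hA => ?_
  obtain ⟨h1, h2⟩ := mem_powersetCard.1 (h𝒜 hA)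
  rw [← card_filter, ← h2, filter_mem_eq_inter, inter_eq_right.2 h1]

lemma card_le_sum_of_inter_nonempty (T : Finset α)
    (h : ∀ A ∈ 𝒜, (T ∩ A).Nonempty) : #𝒜 ≤ ∑ x ∈ T, #(𝒜.memberSubfamily x) := by
  simp only [card_memberSubfamily]
  refine (card_le_card fun A hA => ?_).trans card_biUnion_le
  obtain ⟨x, hx⟩ := h A hA
  rw [mem_inter] at hx
  exact mem_biUnion.2 ⟨x, hx.1, mem_filter.2 ⟨hA, hx.2⟩⟩

end Links

/-! ### No family larger than a star: a point of large degree -/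

lemma mul_lt_of_scaled {A B T c p r : ℤ} (hT : 0 < T) (hc : 0 ≤ c) (hAB : A ≤ B) (hp : 0 ≤ p)
    (hr : 0 ≤ r) (hpA : p ≤ A) (hrB : r ≤ B) (hsum : 2 * (T * (c + 1)) ≤ p + r)
    (hA : T * (c + 4) ≤ A) :
    (A - p) * (B - r) < (A + T) * (B - T * (c + 2)) := by
  have hTc : 0 ≤ T * c := by positivity
  have hA0 : 0 < A := by nlinarith
  have hR : A * B - T * (c + 2) * A + T * (B - T * (c + 2)) =
    (A + T) * (B - T * (c + 2)) := by ring
  rcases le_or_gt (2 * (T * (c + 1))) p with h1 | h1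
  · have h2 : (A - p) * (B - r) ≤ (A - 2 * (T * (c + 1))) * B :=
      mul_le_mul (by linarith) (by linarith) (by linarith) (by linarith)
    have h3 : T * (c + 2) * A ≤ 2 * (T * (c + 1)) * B :=
      mul_le_mul (by linarith) hAB hA0.le (by linarith)
    have h4 : 0 < T * (B - T * (c + 2)) := mul_pos hT (by linarith)
    linarith
  · obtain ⟨r₀, hr₀⟩ : ∃ r₀, r₀ = 2 * (T * (c + 1)) - p := ⟨_, rfl⟩
    have h2 : (A - p) * (B - r) ≤ (A - p) * (B - r₀) :=
      mul_le_mul_of_nonneg_left (by linarith) (by linarith)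
    have h3 : p * A ≤ p * B := mul_le_mul_of_nonneg_left hAB hp
    have h4 : p * r₀ ≤ (T * (c + 1)) ^ 2 := by
      have : T * (c + 1) = (p + r₀) / 2 := by omega
      nlinarith [sq_nonneg (p - r₀)]
    have h5 : T * (c + 1) * (T * (c + 4)) ≤ T * (c + 1) * A :=
      mul_le_mul_of_nonneg_left hA (by linarith)
    have h6 : (p + r₀) * A = 2 * (T * (c + 1)) * A := by rw [hr₀]; ring
    have h7 : 0 < T * T := mul_pos hT hT
    have h8 : 0 ≤ T * T * c := by positivity
    have h9 : T * A ≤ T * B := mul_le_mul_of_nonneg_left hAB hT.le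
    nlinarith

/-- Used with the sum of the two trade-offs for the links of a point whose degree is large in both
families. -/
lemma mul_lt_of_double_trade_off {Nk Nl N₁ N₂ D D' a b : ℕ} (ha : a ≤ Nk) (hb : b ≤ Nl) (hN₂ : 0 < N₂)
    (hN₁ : 0 < N₁) (hDD : N₁ * D = N₂ * D') (hD' : 2 ≤ D') (hDk : D' + 2 ≤ Nk) (hDl : D < Nl)
    (hle : Nk * N₂ ≤ Nl * N₁)
    (h : a * N₂ + b * N₁ + 2 * (N₂ * D') ≤ Nk * N₂ + Nl * N₁ + 2 * N₂) :
    a * b < (Nk + 1) * (Nl - D) := by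
  obtain ⟨c, rfl⟩ : ∃ c, D' = c + 2 := ⟨D' - 2, by omega⟩
  obtain ⟨p, hp⟩ := Nat.exists_eq_add_of_le ha
  obtain ⟨r, hr⟩ := Nat.exists_eq_add_of_le hb
  obtain ⟨E, rfl⟩ := Nat.exists_eq_add_of_lt hDl
  rw [show D + E + 1 - D = E + 1 by omega]
  refine Nat.lt_of_mul_lt_mul_left (a := N₂ * N₁) ?_
  have hsum : 2 * (N₂ * (c + 1)) ≤ p * N₂ + r * N₁ := by subst hp; nlinarith
  zify at *
  -- Scale so that the constraint has slope `-1`.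
  have e1 : (N₂ * N₁ * (a * b) : ℤ) = (Nk * N₂ - p * N₂) * ((D + E + 1) * N₁ - r * N₁) := by
    rw [show (a : ℤ) = Nk - p by linarith, show (b : ℤ) = D + E + 1 - r by linarith]; ring
  have e2 : (N₂ * N₁ * ((Nk + 1) * (E + 1)) : ℤ) =
      (Nk * N₂ + N₂) * ((D + E + 1) * N₁ - N₂ * (c + 2)) := by
    rw [← hDD]; ring
  rw [e1, e2]
  have hA0 : (0 : ℤ) ≤ (Nk - p) * N₂ := mul_nonneg (by linarith) (by linarith)
  have hB0 : (0 : ℤ) ≤ ((D + E + 1) - r) * N₁ := mul_nonneg (by linarith) (by linarith)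
  have hp0 : (0 : ℤ) ≤ p * N₂ := by positivity
  have hr0 : (0 : ℤ) ≤ r * N₁ := by positivity
  have hT : (N₂ * (c + 4) : ℤ) ≤ Nk * N₂ := by nlinarith
  refine mul_lt_of_scaled (by exact_mod_cast hN₂) (by positivity) (by linarith) hp0 hr0
    (by linarith) (by linarith) (by linarith) hT

/-- Either the product is small, or all degrees of both families are small. -/
theorem mul_lt_or_degree_le {N i j : ℕ} {𝒜 ℬ : Finset (Finset (Fin (N + 2)))}
    (h𝒜 : 𝒜 ⊆ uniform (N + 2) (i + 2)) (hℬ : ℬ ⊆ uniform (N + 2) (j + 2))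
    (h : CrossIntersecting 𝒜 ℬ) (hx : ∀ x, ∃ F ∈ 𝒜 ∪ ℬ, x ∉ F)
    (hij : i ≤ j) (hN : 2 * j + 2 ≤ N) (hN' : i + j + 3 ≤ N)
    (ha : #𝒜 ≤ (N + 1).choose (i + 1)) (hb : #ℬ ≤ (N + 1).choose (j + 1)) :
    #𝒜 * #ℬ < ((N + 1).choose (i + 1) + 1) *
        ((N + 1).choose (j + 1) - (N - i - 1).choose (j + 1)) ∨
      (𝒜.Nonempty ∧ ℬ.Nonempty ∧
        ∀ x, #(𝒜.memberSubfamily x) ≤ N.choose i ∧ #(ℬ.memberSubfamily x) ≤ N.choose j) := by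
  have hNk := Nat.choose_succ_succ' N i
  have hNl := Nat.choose_succ_succ' N j
  have hP : 0 < N.choose i := Nat.choose_pos (by omega)
  have hQ : 0 < N.choose j := Nat.choose_pos (by omega)
  have hN₁ : 0 < N.choose (i + 1) := Nat.choose_pos (by omega)
  have hN₂ : 0 < N.choose (j + 1) := Nat.choose_pos (by omega)
  have hD : (N - i - 1).choose (j + 1) ≤ N.choose (j + 1) := Nat.choose_le_choose _ (by omega)
  have hDD : N.choose (i + 1) * (N - i - 1).choose (j + 1) =
      N.choose (j + 1) * (N - j - 1).choose (i + 1) := by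
    have := choose_mul_choose_sub N (i + 1) (j + 1)
    rwa [← Nat.sub_sub, ← Nat.sub_sub] at this
  have hD'2 : 2 ≤ (N - j - 1).choose (i + 1) :=
    le_trans (by omega) (le_choose (by omega) (by omega))
  have hD'k : (N - j - 1).choose (i + 1) + 2 ≤ (N + 1).choose (i + 1) := by
    obtain ⟨m, rfl⟩ : ∃ m, N = m + 1 := ⟨N - 1, by omega⟩
    have h1 := Nat.choose_succ_succ' m i
    have h2 : (m + 1 - j - 1).choose (i + 1) ≤ m.choose (i + 1) :=
      Nat.choose_le_choose _ (by omega)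
    have h3 : 0 < m.choose i := Nat.choose_pos (by omega)
    omega
  have hstar : N.choose i * N.choose (j + 1) ≤ N.choose j * N.choose (i + 1) := by
    have h1 := Nat.choose_succ_right_eq N i
    have h2 := Nat.choose_succ_right_eq N j
    refine Nat.le_of_mul_le_mul_left
      (?_ : ((i + 1) * (j + 1)) * _ ≤ ((i + 1) * (j + 1)) * _) (by positivity)
    have h3 : (i + 1) * (N - j) ≤ (j + 1) * (N - i) :=
      Nat.mul_le_mul (by omega) (by omega)
    calc (i + 1) * (j + 1) * (N.choose i * N.choose (j + 1))
        = (N.choose i * (i + 1)) * (N.choose (j + 1) * (j + 1)) := by ring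
      _ = N.choose i * N.choose j * ((i + 1) * (N - j)) := by rw [h2]; ring
      _ ≤ N.choose i * N.choose j * ((j + 1) * (N - i)) := Nat.mul_le_mul_left _ h3
      _ = (N.choose j * (j + 1)) * (N.choose i * (N - i)) := by ring
      _ = _ := by rw [← h1]; ring
  have hle : (N + 1).choose (i + 1) * N.choose (j + 1) ≤
      (N + 1).choose (j + 1) * N.choose (i + 1) := by
    rw [hNk, hNl]; linarith
  -- A bound on one of the two cardinalities is enough.
  have small_right : #ℬ + (N - i - 1).choose (j + 1) ≤ (N + 1).choose (j + 1) →
      #𝒜 * #ℬ < ((N + 1).choose (i + 1) + 1) *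
        ((N + 1).choose (j + 1) - (N - i - 1).choose (j + 1)) := by
    intro hb'
    calc #𝒜 * #ℬ ≤ (N + 1).choose (i + 1) *
          ((N + 1).choose (j + 1) - (N - i - 1).choose (j + 1)) :=
          Nat.mul_le_mul ha (by omega)
      _ < _ := Nat.mul_lt_mul_of_pos_right (Nat.lt_succ_self _) (by omega)
  have small_left : #𝒜 + (N - j - 1).choose (i + 1) ≤ (N + 1).choose (i + 1) →
      #𝒜 * #ℬ < ((N + 1).choose (i + 1) + 1) *
        ((N + 1).choose (j + 1) - (N - i - 1).choose (j + 1)) := by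
    intro ha'
    obtain ⟨E, hE⟩ := Nat.exists_eq_add_of_lt
      (show (N - i - 1).choose (j + 1) < (N + 1).choose (j + 1) by omega)
    have h1 : #𝒜 * #ℬ ≤ ((N + 1).choose (i + 1) - (N - j - 1).choose (i + 1)) *
        (N + 1).choose (j + 1) := Nat.mul_le_mul (by omega) hb
    refine h1.trans_lt ?_
    have h2 : (N + 1).choose (i + 1) * (N - i - 1).choose (j + 1) ≤
        (N + 1).choose (j + 1) * (N - j - 1).choose (i + 1) := by
      refine Nat.le_of_mul_le_mul_left (?_ : N.choose (i + 1) * _ ≤ N.choose (i + 1) * _) hN₁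
      calc _ = (N + 1).choose (i + 1) *
            (N.choose (i + 1) * (N - i - 1).choose (j + 1)) := by ring
        _ = (N + 1).choose (i + 1) * N.choose (j + 1) * (N - j - 1).choose (i + 1) := by
          rw [hDD]; ring
        _ ≤ (N + 1).choose (j + 1) * N.choose (i + 1) * (N - j - 1).choose (i + 1) :=
          Nat.mul_le_mul_right _ hle
        _ = _ := by ring
    obtain ⟨e, he⟩ := Nat.exists_eq_add_of_le hD'k
    rw [show (N + 1).choose (i + 1) - (N - j - 1).choose (i + 1) = 2 + e by omega,
      show (N + 1).choose (j + 1) - (N - i - 1).choose (j + 1) = E + 1 by omega]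
    rw [hE] at h2 ⊢
    rw [he] at h2 ⊢
    nlinarith
  rcases 𝒜.eq_empty_or_nonempty with rfl | hA
  · left
    rw [card_empty, zero_mul]
    exact Nat.mul_pos (by omega) (by omega)
  rcases ℬ.eq_empty_or_nonempty with rfl | hB
  · left
    rw [card_empty, mul_zero]
    exact Nat.mul_pos (by omega) (by omega)
  by_cases hbad : ∀ x, #(𝒜.memberSubfamily x) ≤ N.choose i ∧ #(ℬ.memberSubfamily x) ≤ N.choose j
  · exact Or.inr ⟨hA, hB, hbad⟩
  left
  push Not at hbad
  obtain ⟨x, hx'⟩ := hbad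
  have hca := 𝒜.card_memberSubfamily_add_card_nonMemberSubfamily x
  have hcb := ℬ.card_memberSubfamily_add_card_nonMemberSubfamily x
  have f1 : Feasible (N + 1) (i + 1) (j + 2) _ _ := h.feasible_link h𝒜 hℬ x
  have f2 : Feasible (N + 1) (i + 2) (j + 1) _ _ := (h.symm.feasible_link hℬ h𝒜 x).symm
  rcases Nat.eq_zero_or_pos #(ℬ.nonMemberSubfamily x) with hb0 | hb0
  · refine small_right ?_
    have : 0 < #(𝒜.nonMemberSubfamily x) := by
      obtain ⟨F, hF, hxF⟩ := hx x
      rw [card_eq_zero, nonMemberSubfamily, filter_eq_empty_iff] at hb0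
      rcases mem_union.1 hF with hF | hF
      · exact card_pos.2 ⟨F, mem_nonMemberSubfamily.2 ⟨hF, hxF⟩⟩
      · exact absurd hxF (hb0 hF)
    have := f2.add_choose_le this
    rw [show N + 1 - (i + 2) = N - i - 1 by omega] at this
    omega
  rcases Nat.eq_zero_or_pos #(𝒜.nonMemberSubfamily x) with ha0 | ha0
  · refine small_left ?_
    have := f1.choose_add_le hb0
    rw [show N + 1 - (j + 2) = N - j - 1 by omega] at this
    omega
  rcases le_or_gt #(𝒜.memberSubfamily x) (N.choose i) with h1 | h1
  · refine small_left ?_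
    obtain ⟨β, hβ⟩ := Nat.exists_eq_add_of_lt (hx' h1)
    rw [hβ, add_assoc (N.choose j)] at f2
    have := (f2.peel_right (by omega)).choose_add_le (by omega)
    rw [← Nat.sub_sub] at this
    omega
  obtain ⟨α, hα⟩ := Nat.exists_eq_add_of_lt h1
  rw [hα, add_assoc] at f1
  have g1 : Feasible N (i + 1) (j + 1) (α + 1) _ := f1.peel_left (by omega)
  rcases le_or_gt #(ℬ.memberSubfamily x) (N.choose j) with h2 | h2
  · refine small_right ?_
    have := g1.add_choose_le (by omega)
    rw [← Nat.sub_sub] at this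
    omega
  obtain ⟨β, hβ⟩ := Nat.exists_eq_add_of_lt h2
  rw [hβ, add_assoc (N.choose j)] at f2
  have g2 : Feasible N (i + 1) (j + 1) _ (β + 1) := f2.peel_right (by omega)
  have w1 := g1.weighted_sum_le (by omega) (by omega) (by omega) hb0
  have w2 := g2.weighted_sum_le (by omega) (by omega) ha0 (by omega)
  rw [← Nat.sub_sub, hDD] at w1 w2
  refine mul_lt_of_double_trade_off ha hb hN₂ hN₁ hDD hD'2 hD'k (by omega) hle ?_
  rw [← hca, ← hcb, hα, hβ, hNk, hNl]
  linarith

/-! ### Shifting -/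

section Shift

variable {n : ℕ} {𝒜 ℬ : Finset (Finset (Fin n))} {x y : Fin n} {A B F : Finset (Fin n)}

/-- The shift of a set: `x` replaces `y`, when possible. -/
abbrev shift (x y : Fin n) (F : Finset (Fin n)) : Finset (Fin n) := UV.compress {x} {y} F

/-- The shift of a family: `x` replaces `y` in each member for which the result is new. -/
abbrev shiftFamily (x y : Fin n) (ℱ : Finset (Finset (Fin n))) : Finset (Finset (Fin n)) :=
  UV.compression {x} {y} ℱ

lemma shift_of_mem (hx : x ∉ F) (hy : y ∈ F) : shift x y F = (insert x F) \ {y} := by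
  rw [shift, UV.compress, if_pos ⟨by simpa using hx, by simpa using hy⟩, sup_eq_union, union_comm]
  rfl

lemma shift_of_not (h : ¬ (x ∉ F ∧ y ∈ F)) : shift x y F = F := by
  rw [shift, UV.compress, if_neg (by simpa using h)]

lemma mem_of_mem_shift {z : Fin n} (hz : z ∈ shift x y F) (hzx : z ≠ x) : z ∈ F := by
  by_cases h : x ∉ F ∧ y ∈ F
  · rw [shift_of_mem h.1 h.2] at hz
    simp [hzx] at hz
    exact hz.1
  · rwa [shift_of_not h] at hz

lemma mem_or_mem_of_mem_shift (hx : x ∈ shift x y F) : x ∈ F ∨ y ∈ F := by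
  by_cases h : x ∉ F ∧ y ∈ F
  · exact Or.inr h.2
  · rw [shift_of_not h] at hx
    exact Or.inl hx

lemma shift_inter_nonempty (hxy : x ≠ y) (h1 : (A ∩ B).Nonempty) (h2 : (A ∩ shift x y B).Nonempty) :
    (shift x y A ∩ B).Nonempty := by
  by_cases hA : x ∉ A ∧ y ∈ A
  swap
  · rwa [shift_of_not hA]
  rw [shift_of_mem hA.1 hA.2]
  by_cases hxB : x ∈ B
  · exact ⟨x, by simp [hxB, hxy]⟩
  by_cases hyB : y ∈ B
  · rw [shift_of_mem hxB hyB] at h2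
    obtain ⟨z, hz⟩ := h2
    simp only [mem_inter, mem_sdiff, mem_insert, mem_singleton] at hz
    have hzx : z ≠ x := fun h => hA.1 (h ▸ hz.1)
    exact ⟨z, by simp [hz.1, hz.2.2, hz.2.1.resolve_left hzx]⟩
  · obtain ⟨z, hz⟩ := h1
    rw [mem_inter] at hz
    have hzy : z ≠ y := fun h => hyB (h ▸ hz.2)
    exact ⟨z, by simp [hz.1, hz.2, hzy]⟩

lemma CrossIntersecting.shiftFamily (h : CrossIntersecting 𝒜 ℬ) (hxy : x ≠ y) :
    CrossIntersecting (shiftFamily x y 𝒜) (CrossInt.shiftFamily x y ℬ) := by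
  have hnew : ∀ F, ∀ ℱ : Finset (Finset (Fin n)), F ∉ ℱ → (∃ b ∈ ℱ, UV.compress {x} {y} b = F) →
      x ∈ F := by
    rintro F ℱ hF ⟨b, hb, rfl⟩
    by_cases h : x ∉ b ∧ y ∈ b
    · rw [← shift, shift_of_mem h.1 h.2]; simp [hxy]
    · rw [← shift, shift_of_not h] at hF
      exact absurd hb hF
  intro A hA B hB
  rw [UV.mem_compression] at hA hB
  rcases hA with ⟨hA, hA'⟩ | ⟨hA, hA'⟩ <;> rcases hB with ⟨hB, hB'⟩ | ⟨hB, hB'⟩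
  · exact h A hA B hB
  · obtain ⟨b, hb, rfl⟩ := hB'
    rw [inter_comm]
    refine shift_inter_nonempty hxy ?_ ?_
    · rw [inter_comm]; exact h A hA b hb
    · rw [inter_comm]; exact h _ hA' b hb
  · obtain ⟨a, ha, rfl⟩ := hA'
    exact shift_inter_nonempty hxy (h a ha B hB) (h a ha _ hB')
  · exact ⟨x, mem_inter.2 ⟨hnew A 𝒜 hA hA', hnew B ℬ hB hB'⟩⟩

lemma shiftFamily_subset_uniform {k : ℕ} (h : 𝒜 ⊆ uniform n k) :
    shiftFamily x y 𝒜 ⊆ uniform n k := by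
  have hs : (𝒜 : Set (Finset (Fin n))).Sized k := fun A hA => (mem_powersetCard.1 (h hA)).2
  have := hs.uvCompression (u := {x}) (v := {y}) rfl
  exact fun A hA => mem_powersetCard.2 ⟨subset_univ _, this hA⟩

/-- The sum of all elements of all members, which shifting towards smaller elements decreases. -/
def weight (ℱ : Finset (Finset (Fin n))) : ℕ := ∑ F ∈ ℱ, ∑ z ∈ F, (z : ℕ)

lemma sum_shift_lt (hxy : x < y) (h : shift x y F ≠ F) :
    ∑ z ∈ shift x y F, (z : ℕ) < ∑ z ∈ F, (z : ℕ) := by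
  by_cases hF : x ∉ F ∧ y ∈ F
  · rw [shift_of_mem hF.1 hF.2]
    have h1 := sum_sdiff (f := fun z : Fin n => (z : ℕ))
      (show {y} ⊆ insert x F by simp [hF.2])
    rw [sum_insert hF.1, sum_singleton] at h1
    have : (x : ℕ) < y := hxy
    omega
  · exact absurd (shift_of_not hF) h

lemma weight_shiftFamily_lt (hxy : x < y) (h : shiftFamily x y 𝒜 ≠ 𝒜) :
    weight (shiftFamily x y 𝒜) < weight 𝒜 := by
  rw [shiftFamily, UV.compression] at h ⊢
  have q : ∀ Q ∈ {A ∈ 𝒜 | UV.compress {x} {y} A ∉ 𝒜}, UV.compress {x} {y} Q ≠ Q := by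
    intro Q hQ hQ'
    rw [mem_filter, hQ'] at hQ
    exact hQ.2 hQ.1
  have uA : {A ∈ 𝒜 | UV.compress {x} {y} A ∈ 𝒜} ∪ {A ∈ 𝒜 | UV.compress {x} {y} A ∉ 𝒜} = 𝒜 :=
    filter_union_filter_not_eq _ _
  have ne₂ : {A ∈ 𝒜 | UV.compress {x} {y} A ∉ 𝒜}.Nonempty := by
    contrapose! h
    rw [filter_image, h, image_empty, union_empty]
    rwa [h, union_empty] at uA
  rw [weight, weight, sum_union UV.compress_disjoint]
  conv_rhs => rw [← uA]
  rw [sum_union (disjoint_filter_filter_not _ _ _), add_lt_add_iff_left, filter_image,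
    sum_image UV.compress_injOn]
  exact sum_lt_sum_of_nonempty ne₂ fun A hA => sum_shift_lt hxy (q _ hA)

lemma weight_shiftFamily_le (hxy : x < y) : weight (shiftFamily x y 𝒜) ≤ weight 𝒜 := by
  by_cases h : shiftFamily x y 𝒜 = 𝒜
  · rw [h]
  · exact (weight_shiftFamily_lt hxy h).le

/-- If shifting creates an element common to all members, then all members meet `{x, y}`. -/
lemma inter_pair_nonempty_of_shift (h : ∀ z, ∃ F ∈ 𝒜 ∪ ℬ, z ∉ F)
    (hz : ¬ ∀ z, ∃ F ∈ shiftFamily x y 𝒜 ∪ shiftFamily x y ℬ, z ∉ F) :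
    ∀ F ∈ 𝒜 ∪ ℬ, (({x, y} : Finset (Fin n)) ∩ F).Nonempty := by
  push Not at hz
  obtain ⟨z, hz⟩ := hz
  have key : ∀ F ∈ 𝒜 ∪ ℬ, z ∈ shift x y F := by
    intro F hF
    refine hz _ ?_
    rcases mem_union.1 hF with hF | hF
    · exact mem_union_left _ (UV.compress_mem_compression hF)
    · exact mem_union_right _ (UV.compress_mem_compression hF)
  have hzx : z = x := by
    by_contra hne
    obtain ⟨F, hF, hzF⟩ := h z
    exact hzF (mem_of_mem_shift (key F hF) hne)
  subst hzx
  intro F hF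
  rcases mem_or_mem_of_mem_shift (key F hF) with h | h
  · exact ⟨z, by simp [h]⟩
  · exact ⟨y, by simp [h]⟩

end Shift

/-! ### Shifted cross-intersecting families as lattice walks -/

section Walk

variable {n : ℕ} {𝒜 ℬ : Finset (Finset (Fin n))} {A B : Finset (Fin n)}

/-- The number of elements of `A` among the first `s` points. -/
abbrev initCount (A : Finset (Fin n)) (s : ℕ) : ℕ := #(A.filter fun z : Fin n => (z : ℕ) < s)

lemma initCount_add_card (A : Finset (Fin n)) (s y : Fin n) (h : s ≤ y) :
    initCount A s + #(A ∩ Icc s y) = initCount A (y + 1) := by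
  rw [← card_union_of_disjoint]
  · congr 1
    ext z
    simp only [mem_union, mem_filter, mem_inter, mem_Icc, Fin.le_def] at *
    constructor
    · rintro (⟨h1, h2⟩ | ⟨h1, h2, h3⟩)
      · exact ⟨h1, by omega⟩
      · exact ⟨h1, by omega⟩
    · rintro ⟨h1, h2⟩
      rcases lt_or_ge (z : ℕ) s with h3 | h3
      · exact Or.inl ⟨h1, h3⟩
      · exact Or.inr ⟨h1, h3, by omega⟩
  · rw [disjoint_left]
    intro z hz hz'
    simp only [mem_filter, mem_inter, mem_Icc, Fin.le_def] at *
    omega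

lemma initCount_add_initCount_ge {s y : Fin n} (hsy : s ≤ y) (hy : y ∈ A ∩ B)
    (h : Icc s y ⊆ A ∪ B) :
    initCount A s + initCount B s + (y + 2) ≤ initCount A (y + 1) + initCount B (y + 1) + s := by
  have h1 := initCount_add_card A s y hsy
  have h2 := initCount_add_card B s y hsy
  have h3 := card_union_add_card_inter (A ∩ Icc s y) (B ∩ Icc s y)
  rw [← union_inter_distrib_right, inter_eq_right.2 h, Fin.card_Icc] at h3
  have h4 : 0 < #(A ∩ Icc s y ∩ (B ∩ Icc s y)) := by
    rw [mem_inter] at hy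
    exact card_pos.2 ⟨y, by simp [hy.1, hy.2, hsy]⟩
  have : (s : ℕ) ≤ y := hsy
  omega

/-- For shifted families, two members already intersect "more than they have to" in some initial
segment: otherwise one could shift away the smallest common element. -/
lemma exists_lt_initCount_add (h : CrossIntersecting 𝒜 ℬ)
    (hs : ∀ x y : Fin n, x < y → shiftFamily x y 𝒜 = 𝒜) (hA : A ∈ 𝒜) (hB : B ∈ ℬ) :
    ∃ s, s < initCount A s + initCount B s := by
  induction hm : #(A ∩ B) using Nat.strong_induction_on generalizing A with
  | _ m ih =>
  by_contra! hcon
  have hne := h A hA B hB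
  obtain ⟨y, hy⟩ : ∃ y, y = (A ∩ B).min' hne := ⟨_, rfl⟩
  have hyAB : y ∈ A ∩ B := hy ▸ min'_mem _ _
  have hyA := (mem_inter.1 hyAB).1
  let S : Finset (Fin n) := univ.filter fun x => x < y ∧ x ∉ A ∪ B
  have hS : S.Nonempty := by
    by_contra hS
    rw [not_nonempty_iff_eq_empty, filter_eq_empty_iff] at hS
    have hpos : 0 < n := by have := y.2; omega
    have := initCount_add_initCount_ge (s := ⟨0, hpos⟩) (Nat.zero_le _ : (0 : ℕ) ≤ y) hyAB ?_
    · have h2 := hcon (y + 1)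
      simp at this
      omega
    · intro z hz
      rw [mem_Icc] at hz
      rcases hz.2.eq_or_lt with rfl | h3
      · exact mem_union_left _ hyA
      · by_contra h4
        exact hS (mem_univ z) ⟨h3, h4⟩
  obtain ⟨x, hx⟩ : ∃ x, x = S.max' hS := ⟨_, rfl⟩
  have hxS : x ∈ S := hx ▸ max'_mem _ _
  have hxy : x < y ∧ x ∉ A ∪ B := (mem_filter.1 hxS).2
  have hxA : x ∉ A := fun h => hxy.2 (mem_union_left _ h)
  have hxB : x ∉ B := fun h => hxy.2 (mem_union_right _ h)
  have hA' : insert x A \ {y} ∈ 𝒜 := by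
    have := UV.compress_mem_compression (u := {x}) (v := {y}) hA
    rw [show UV.compression {x} {y} 𝒜 = 𝒜 from hs x y hxy.1] at this
    rwa [← shift_of_mem hxA hyA]
  have hlt : #((insert x A \ {y}) ∩ B) < m := by
    rw [← hm]
    refine card_lt_card ⟨fun z hz => ?_, fun hsub => ?_⟩
    · simp only [mem_inter, mem_sdiff, mem_insert, mem_singleton] at hz ⊢
      refine ⟨hz.1.1.resolve_left fun hzx => hxB (hzx ▸ hz.2), hz.2⟩
    · have := hsub hyAB
      simp at this
  obtain ⟨s, hs'⟩ := ih _ hlt hA' rfl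
  have hle : initCount (insert x A \ {y}) s ≤ initCount A s + 1 := by
    refine (card_le_card (t := insert x (A.filter fun z : Fin n => (z : ℕ) < s)) ?_).trans
      (card_insert_le _ _)
    intro z hz
    simp only [mem_filter, mem_sdiff, mem_insert] at hz ⊢
    tauto
  have hs1 := hcon s
  rcases le_or_gt s x with h1 | h1
  · have : initCount (insert x A \ {y}) s ≤ initCount A s := by
      refine card_le_card fun z hz => ?_
      simp only [mem_filter, mem_sdiff, mem_insert] at hz ⊢
      exact ⟨hz.1.1.resolve_left fun h => by subst h; omega, hz.2⟩
    omega
  rcases lt_or_ge (y : ℕ) s with h2 | h2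
  · have : initCount (insert x A \ {y}) s ≤ initCount A s := by
      have e : (insert x A \ {y}).filter (fun z : Fin n => (z : ℕ) < s) ⊆
          insert x ((A.filter fun z : Fin n => (z : ℕ) < s).erase y) := by
        intro z hz
        simp only [mem_filter, mem_sdiff, mem_insert, mem_erase, mem_singleton] at hz ⊢
        tauto
      refine (card_le_card e).trans ((card_insert_le _ _).trans ?_)
      have hyf : y ∈ A.filter fun z : Fin n => (z : ℕ) < s := mem_filter.2 ⟨hyA, h2⟩
      rw [card_erase_add_one hyf]
    omega
  · have hsn : s < n := lt_of_le_of_lt h2 y.2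
    have := initCount_add_initCount_ge (A := A) (B := B) (s := ⟨s, hsn⟩) (y := y) h2 hyAB ?_
    · have h3 := hcon (y + 1)
      simp only at this
      omega
    · intro z hz
      rw [mem_Icc] at hz
      rcases hz.2.eq_or_lt with rfl | h3
      · exact mem_union_left _ hyA
      · by_contra h4
        have h5 : z ≤ x := hx ▸ le_max' _ _ (mem_filter.2 ⟨mem_univ z, h3, h4⟩)
        have h6 : s ≤ (z : ℕ) := hz.1
        have h7 : (z : ℕ) ≤ x := h5
        omega

open Classical in
/-- Reading a set as a lattice walk which goes up at its elements and down elsewhere, this is the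
reflection principle: on `m` points, at most `m.choose d` sets of size `u + d` reach height `u`. -/
lemma card_reach_le (m u d t : ℕ) :
    #((powersetCard (u + d) (Ico t (t + m))).filter fun A =>
      ∃ s, s + u ≤ 2 * #(A.filter fun z => z < t + s)) ≤ m.choose d := by
  induction m generalizing u d t with
  | zero =>
    rcases Nat.eq_zero_or_pos (u + d) with h | h
    · obtain rfl : d = 0 := by omega
      obtain rfl : u = 0 := by omega
      exact (card_filter_le _ _).trans (by simp)
    · obtain ⟨r, hr⟩ : ∃ r, u + d = r + 1 := ⟨u + d - 1, by omega⟩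
      refine (card_filter_le _ _).trans ?_
      rw [card_powersetCard, hr]
      simp
  | succ m ih =>
    rcases Nat.eq_zero_or_pos u with rfl | hu
    · refine (card_filter_le _ _).trans ?_
      rw [card_powersetCard, Nat.card_Ico, zero_add, Nat.add_sub_cancel_left]
    obtain ⟨u, rfl⟩ : ∃ v, u = v + 1 := ⟨u - 1, by omega⟩
    have hI : Ico t (t + (m + 1)) = insert t (Ico (t + 1) (t + 1 + m)) := by
      ext z; simp only [mem_Ico, mem_insert]; omega
    have htI : t ∉ Ico (t + 1) (t + 1 + m) := by simp
    rw [hI, show u + 1 + d = u + d + 1 by ring, powersetCard_succ_insert htI, Nat.succ_eq_add_one,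
      filter_union]
    refine (card_union_le _ _).trans ?_
    have h1 : #((powersetCard (u + d + 1) (Ico (t + 1) (t + 1 + m))).filter fun A =>
        ∃ s, s + (u + 1) ≤ 2 * #(A.filter fun z => z < t + s)) ≤
        if d = 0 then 0 else m.choose (d - 1) := by
      have hshift : ∀ A ∈ powersetCard (u + d + 1) (Ico (t + 1) (t + 1 + m)), ∀ s,
          s + (u + 1) ≤ 2 * #(A.filter fun z => z < t + s) → 1 ≤ s := by
        intro A hA s hs
        by_contra h0
        obtain rfl : s = 0 := by omega
        have : A.filter (fun z => z < t + 0) = ∅ := by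
          rw [filter_eq_empty_iff]
          intro z hz
          have := mem_Ico.1 ((mem_powersetCard.1 hA).1 hz)
          omega
        rw [this] at hs
        simp at hs
      split_ifs with hd
      · subst hd
        rw [Nat.le_zero, card_eq_zero, filter_eq_empty_iff]
        rintro A hA ⟨s, hs⟩
        have h2 := hshift A hA s hs
        have h3 : #(A.filter fun z => z < t + s) ≤ u + 1 :=
          (card_filter_le _ _).trans (mem_powersetCard.1 hA).2.le
        have h4 : #(A.filter fun z => z < t + s) ≤ s - 1 := by
          refine (card_le_card (t := Ico (t + 1) (t + s)) fun z hz => ?_).trans (by simp; omega)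
          rw [mem_filter] at hz
          have := mem_Ico.1 ((mem_powersetCard.1 hA).1 hz.1)
          exact mem_Ico.2 ⟨this.1, hz.2⟩
        omega
      · refine le_trans (card_le_card ?_) (ih (u + 2) (d - 1) (t + 1))
        intro A hA
        rw [mem_filter] at hA
        obtain ⟨hA, s, hs⟩ := hA
        have h2 := hshift A hA s hs
        rw [mem_filter, show u + 2 + (d - 1) = u + d + 1 by omega]
        refine ⟨hA, s - 1, ?_⟩
        rw [show t + 1 + (s - 1) = t + s by omega]
        omega
    have h2 : #(((powersetCard (u + d) (Ico (t + 1) (t + 1 + m))).image (insert t)).filter fun A =>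
        ∃ s, s + (u + 1) ≤ 2 * #(A.filter fun z => z < t + s)) ≤ m.choose d := by
      rw [filter_image]
      refine card_image_le.trans (le_trans (card_le_card ?_) (ih u d (t + 1)))
      intro A hA
      rw [mem_filter] at hA
      obtain ⟨hA, s, hs⟩ := hA
      have htA : t ∉ A := fun h => htI ((mem_powersetCard.1 hA).1 h)
      refine mem_filter.2 ⟨hA, ?_⟩
      rcases Nat.eq_zero_or_pos s with rfl | hs0
      · exfalso
        have : (insert t A).filter (fun z => z < t + 0) = ∅ := by
          rw [filter_eq_empty_iff]
          intro z hz
          rcases mem_insert.1 hz with rfl | hz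
          · omega
          · have := mem_Ico.1 ((mem_powersetCard.1 hA).1 hz)
            omega
        rw [this] at hs
        simp at hs
      · refine ⟨s - 1, ?_⟩
        rw [filter_insert, if_pos (by omega), card_insert_of_notMem (by simp [htA])] at hs
        rw [show t + 1 + (s - 1) = t + s by omega]
        omega
    rcases Nat.eq_zero_or_pos d with rfl | hd
    · rw [if_pos rfl] at h1
      rw [Nat.choose_zero_right] at h2 ⊢
      exact Nat.add_le_add h1 h2
    · obtain ⟨d, rfl⟩ : ∃ e, d = e + 1 := ⟨d - 1, by omega⟩
      rw [Nat.choose_succ_succ']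
      rw [if_neg (by omega), Nat.add_sub_cancel] at h1
      exact Nat.add_le_add h1 h2

/-- The members of a family of walks reaching height `w ≥ 1` which start with a step down. -/
lemma card_nonMemberSubfamily_zero_le {n w d : ℕ} {𝒜 : Finset (Finset (Fin (n + 1)))}
    (h𝒜 : 𝒜 ⊆ uniform (n + 1) (w + 1 + d)) (hw : 0 < w)
    (h : ∀ A ∈ 𝒜, ∃ s, s + w ≤ 2 * initCount A s) : #(𝒜.nonMemberSubfamily 0) ≤ n.choose d := by
  refine le_trans ?_ (card_reach_le n (w + 1) d 1)
  rw [← card_map (mapEmbedding Fin.valEmbedding).toEmbedding]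
  refine card_le_card fun T hT => ?_
  obtain ⟨A, hA, rfl⟩ := mem_map.1 hT
  rw [mem_nonMemberSubfamily] at hA
  obtain ⟨s, hs⟩ := h A hA.1
  have hcount : ∀ r, #((A.map Fin.valEmbedding).filter fun z => z < r) = initCount A r := by
    intro r
    rw [filter_map, card_map]
    rfl
  simp only [RelEmbedding.coe_toEmbedding, mapEmbedding_apply, mem_filter, mem_powersetCard,
    card_map, hcount]
  refine ⟨⟨fun z hz => ?_, (mem_powersetCard.1 (h𝒜 hA.1)).2⟩, s - 1, ?_⟩
  · obtain ⟨v, hv, rfl⟩ := mem_map.1 hz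
    have h1 : v ≠ 0 := fun h => hA.2 (h ▸ hv)
    have h2 : (v : ℕ) ≠ 0 := fun h => h1 (Fin.ext h)
    rw [mem_Ico]
    have := v.2
    simp only [Fin.valEmbedding_apply]
    omega
  · rcases Nat.eq_zero_or_pos s with rfl | hs0
    · have : initCount A 0 = 0 := by simp
      omega
    · rw [show 1 + (s - 1) = s by omega]
      omega

end Walk

/-! ### No family larger than a star: all degrees small -/

lemma choose_sub_le_mul_pow {m t : ℕ} (r : ℕ) (ht : t ≤ m) (hm : 0 < m) :
    ((m - r).choose t : ℚ) ≤ m.choose t * (1 - t / m) ^ r := by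
  have hq : (0 : ℚ) ≤ 1 - t / m := by
    rw [sub_nonneg, div_le_one (by exact_mod_cast hm)]
    exact_mod_cast ht
  induction r with
  | zero => simp
  | succ r ih =>
    rcases lt_or_ge r m with hr | hr
    · obtain ⟨e, he⟩ : ∃ e, m - r = e + 1 := ⟨m - r - 1, by omega⟩
      rw [show m - (r + 1) = e by omega]
      rw [he] at ih
      have h1 : (e.choose t : ℚ) ≤ (e + 1).choose t * (1 - t / m) := by
        rcases lt_or_ge (e + 1) t with h2 | h2
        · rw [Nat.choose_eq_zero_of_lt h2, Nat.choose_eq_zero_of_lt (by omega)]; simp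
        have h3 := Nat.choose_mul_succ_eq e t
        have h4 : (e.choose t : ℚ) = (e + 1).choose t * (1 - t / (e + 1)) := by
          have : (e.choose t : ℚ) * (e + 1) = (e + 1).choose t * ((e + 1) - t) := by
            rw [show ((e : ℚ) + 1 - t) = ((e + 1 - t : ℕ) : ℚ) by
              rw [Nat.cast_sub h2]; push_cast; ring]
            exact_mod_cast h3
          field_simp
          linarith
        rw [h4]
        have h5 : ((e : ℚ) + 1) ≤ m := by exact_mod_cast (show e + 1 ≤ m by omega)
        gcongr
      rw [pow_succ, ← mul_assoc]
      exact h1.trans (mul_le_mul_of_nonneg_right ih hq)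
    · rw [show m - (r + 1) = m - r by omega, Nat.sub_eq_zero_of_le hr]
      rcases Nat.eq_zero_or_pos t with rfl | ht0
      · simp
      · rw [Nat.choose_eq_zero_of_lt ht0]
        simp only [Nat.cast_zero]
        positivity

/-- It suffices to bound the product by that of two stars, times the probability that one of `i + 2`
independent trials with success probability `(j + 1) / (N + 1)` succeeds. The second extremal
product involves trials without replacement, for which success is likelier. -/
lemma mul_lt_of_density {N i j a b : ℕ} (hj : j < N)
    (h : (a * b : ℚ) ≤ (N + 1).choose (i + 1) * (N + 1).choose (j + 1) *
      (1 - (1 - (j + 1) / (N + 1)) ^ (i + 2))) :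
    a * b < ((N + 1).choose (i + 1) + 1) *
        ((N + 1).choose (j + 1) - (N - i - 1).choose (j + 1)) := by
  have hQ : 0 < N.choose j := Nat.choose_pos (by omega)
  have hNl := Nat.choose_succ_succ' N j
  have hD : (N - i - 1).choose (j + 1) ≤ N.choose (j + 1) := Nat.choose_le_choose _ (by omega)
  have h1 := choose_sub_le_mul_pow (m := N + 1) (t := j + 1) (i + 2) (by omega) (by omega)
  rw [show N + 1 - (i + 2) = N - i - 1 by omega] at h1
  push_cast at h1
  have h2 : (a * b : ℚ) ≤ (N + 1).choose (i + 1) *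
      (((N + 1).choose (j + 1) - (N - i - 1).choose (j + 1) : ℕ) : ℚ) := by
    rw [Nat.cast_sub (by omega)]
    refine h.trans ?_
    rw [mul_assoc]
    refine mul_le_mul_of_nonneg_left ?_ (by positivity)
    linarith
  have h3 : a * b ≤ (N + 1).choose (i + 1) *
      ((N + 1).choose (j + 1) - (N - i - 1).choose (j + 1)) := by exact_mod_cast h2
  refine h3.trans_lt (Nat.mul_lt_mul_of_pos_right (Nat.lt_succ_self _) (by omega))

lemma star_degree_ratio (N i : ℕ) :
    (N.choose i : ℚ) = (N + 1).choose (i + 1) * ((i + 1) / (N + 1)) := by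
  have : ((N + 1) * N.choose i : ℚ) = (i + 1) * (N + 1).choose (i + 1) := by
    exact_mod_cast choose_pred_mul (n := N) (k := i)
  field_simp
  linarith

lemma mul_lt_of_pairs {N j a b : ℕ} (hj : j + 1 ≤ N) (ha : 2 * a ≤ N + 2)
    (hb : b ≤ 2 * N.choose j) :
    a * b < ((N + 1).choose (0 + 1) + 1) *
        ((N + 1).choose (j + 1) - (N - 0 - 1).choose (j + 1)) := by
  refine mul_lt_of_density (by omega) ?_
  have h1 : (a * b : ℚ) ≤ (N + 2) * N.choose j := by
    have : 2 * (a * b) ≤ 2 * ((N + 2) * N.choose j) := by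
      calc 2 * (a * b) = 2 * a * b := by ring
        _ ≤ (N + 2) * (2 * N.choose j) := Nat.mul_le_mul ha hb
        _ = _ := by ring
    exact_mod_cast (show a * b ≤ (N + 2) * N.choose j by omega)
  refine h1.trans ?_
  rw [star_degree_ratio, zero_add, Nat.choose_one_right]
  have hj' : ((j : ℚ) + 1) ≤ N := by exact_mod_cast hj
  have h2 : (0 : ℚ) ≤ (N + 1).choose (j + 1) * ((j + 1) / (N + 1)) := by positivity
  have h3 : ((N + 1 : ℕ) * (N + 1).choose (j + 1) * (1 - (1 - (j + 1) / (N + 1)) ^ (0 + 2)) : ℚ)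
      = (2 * (N + 1) - (j + 1)) * ((N + 1).choose (j + 1) * ((j + 1) / (N + 1))) := by
    push_cast
    field_simp
    ring
  rw [h3]
  exact mul_le_mul_of_nonneg_right (by linarith) h2

lemma two_thirds_pow_le (i : ℕ) : ((2 : ℚ) / 3) ^ (i + 3) ≤ 1 / (i + 3) := by
  induction i with
  | zero => norm_num
  | succ i ih =>
    rw [show i + 1 + 3 = i + 3 + 1 by ring, pow_succ]
    refine (mul_le_mul_of_nonneg_right ih (by norm_num)).trans ?_
    push_cast
    rw [div_mul_div_comm, div_le_div_iff₀ (by positivity) (by positivity)]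
    nlinarith [show (0 : ℚ) ≤ i by positivity]

lemma mul_lt_of_dense {N i j a b : ℕ} (hi : 1 ≤ i) (hN : 2 * j + 2 ≤ N)
    (hd : N + 1 ≤ 3 * (j + 1)) (ha : (i + 2) * a ≤ (N + 2) * N.choose i)
    (hb : (j + 2) * b ≤ (N + 2) * N.choose j) :
    a * b < ((N + 1).choose (i + 1) + 1) *
        ((N + 1).choose (j + 1) - (N - i - 1).choose (j + 1)) := by
  have hP := choose_pred_mul (n := N) (k := i)
  have hQ := choose_pred_mul (n := N) (k := j)
  refine mul_lt_of_density (by omega) ?_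
  have h1 : (j + 1) * (N + 2) ^ 2 ≤ (j + 2) * (N + 1) ^ 2 := by
    obtain ⟨e, rfl⟩ := Nat.exists_eq_add_of_le hN
    nlinarith
  have h2 : (i + 2) * (a * b) ≤ (i + 1) * ((N + 1).choose (i + 1) * (N + 1).choose (j + 1)) := by
    refine Nat.le_of_mul_le_mul_left
      (?_ : ((j + 2) * (N + 1) ^ 2) * _ ≤ ((j + 2) * (N + 1) ^ 2) * _) (by positivity)
    calc ((j + 2) * (N + 1) ^ 2) * ((i + 2) * (a * b))
        = (N + 1) ^ 2 * (((i + 2) * a) * ((j + 2) * b)) := by ring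
      _ ≤ (N + 1) ^ 2 * (((N + 2) * N.choose i) * ((N + 2) * N.choose j)) :=
          Nat.mul_le_mul_left _ (Nat.mul_le_mul ha hb)
      _ = (N + 2) ^ 2 * (((N + 1) * N.choose i) * ((N + 1) * N.choose j)) := by ring
      _ = ((j + 1) * (N + 2) ^ 2) * ((i + 1) *
            ((N + 1).choose (i + 1) * (N + 1).choose (j + 1))) := by rw [hP, hQ]; ring
      _ ≤ _ := Nat.mul_le_mul_right _ h1
  have h3 : ((i + 2) * (a * b) : ℚ) ≤
      (i + 1) * ((N + 1).choose (i + 1) * (N + 1).choose (j + 1)) := by exact_mod_cast h2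
  have h4 : (1 - ((j : ℚ) + 1) / (N + 1)) ^ (i + 2) ≤ 1 / (i + 2) := by
    have h5 : (1 - ((j : ℚ) + 1) / (N + 1)) ≤ 2 / 3 := by
      have : (N + 1 : ℚ) ≤ 3 * (j + 1) := by exact_mod_cast hd
      have : (1 : ℚ) / 3 ≤ (j + 1) / (N + 1) := by
        rw [div_le_div_iff₀ (by positivity) (by positivity)]; linarith
      linarith
    have h6 : (0 : ℚ) ≤ 1 - ((j : ℚ) + 1) / (N + 1) := by
      rw [sub_nonneg, div_le_one (by positivity)]
      exact_mod_cast (show j + 1 ≤ N + 1 by omega)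
    refine (pow_le_pow_left₀ h6 h5 _).trans ?_
    obtain ⟨e, rfl⟩ : ∃ e, i = e + 1 := ⟨i - 1, by omega⟩
    have := two_thirds_pow_le e
    rw [show e + 1 + 2 = e + 3 by ring]
    refine this.trans (le_of_eq ?_)
    push_cast
    ring
  have h7 : (a * b : ℚ) ≤ (N + 1).choose (i + 1) * (N + 1).choose (j + 1) * (1 - 1 / (i + 2)) := by
    have e : (1 - 1 / (i + 2) : ℚ) = (i + 1) / (i + 2) := by field_simp; ring
    rw [e, mul_div_assoc', le_div_iff₀ (by positivity)]
    linarith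
  refine h7.trans (mul_le_mul_of_nonneg_left (by linarith) (by positivity))

lemma choose_lower_ratio {N i j : ℕ} (hij : i ≤ j) (hj : j < N) :
    ((N + 1).choose i : ℚ) ≤ (N + 1).choose (i + 1) * ((j + 1) / (N - j)) := by
  have h1 := Nat.choose_succ_right_eq (N + 1) i
  have hN : (0 : ℚ) < N - j := by
    rw [sub_pos]; exact_mod_cast hj
  have h2 : (N + 1).choose i * (N - j) ≤ (N + 1).choose (i + 1) * (j + 1) := by
    calc _ ≤ (N + 1).choose i * (N + 1 - i) := Nat.mul_le_mul_left _ (by omega)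
      _ = (N + 1).choose (i + 1) * (i + 1) := h1.symm
      _ ≤ _ := Nat.mul_le_mul_left _ (by omega)
  rw [mul_div_assoc', le_div_iff₀ hN, ← Nat.cast_sub hj.le]
  exact_mod_cast h2

lemma sparse_density_bounds {q r : ℚ} (hq0 : 0 < q) (hq3 : q ≤ 1 / 3) (hrq : r * (1 - q) = q) :
    2 * q * (2 * q) ≤ 1 - (1 - q) ^ 3 ∧ (q + r) * (q + r) ≤ 1 - (1 - q) ^ 3 ∧
      q + r ^ 2 ≤ 1 - (1 - q) ^ 3 := by
  have e3 : 1 - (1 - q) ^ 3 = q * (3 - 3 * q + q ^ 2) := by ring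
  have h1q : 0 < (1 - q) ^ 2 := by have : 0 < 1 - q := by linarith
                                   positivity
  have hqq : q * q ≤ q * (1 / 3) := mul_le_mul_of_nonneg_left hq3 hq0.le
  obtain ⟨d, hd⟩ : ∃ d, d = 1 / 3 - q := ⟨_, rfl⟩
  have hd0 : 0 ≤ d := by linarith
  rw [e3]
  refine ⟨?_, le_of_mul_le_mul_left ?_ h1q, le_of_mul_le_mul_left ?_ h1q⟩
  · have : 2 * q * (2 * q) = q * (4 * q) := by ring
    rw [this]
    exact mul_le_mul_of_nonneg_left (by nlinarith) hq0.le
  · have h1 : (1 - q) ^ 2 * ((q + r) * (q + r)) = q * (q * (2 - q) ^ 2) := by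
      have : (1 - q) * (q + r) = q * (2 - q) := by linarith
      calc _ = ((1 - q) * (q + r)) ^ 2 := by ring
        _ = _ := by rw [this]; ring
    have h2 : (1 - q) ^ 2 * (q * (3 - 3 * q + q ^ 2)) =
      q * ((1 - q) ^ 2 * (3 - 3 * q + q ^ 2)) := by ring
    rw [h1, h2]
    refine mul_le_mul_of_nonneg_left ?_ hq0.le
    obtain rfl : q = 1 / 3 - d := by linarith
    rw [← sub_nonneg]
    ring_nf
    positivity
  · have h1 : (1 - q) ^ 2 * (q + r ^ 2) = q * ((1 - q) ^ 2 + q) := by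
      calc _ = (1 - q) ^ 2 * q + (r * (1 - q)) ^ 2 := by ring
        _ = _ := by rw [hrq]; ring
    have h2 : (1 - q) ^ 2 * (q * (3 - 3 * q + q ^ 2)) =
      q * ((1 - q) ^ 2 * (3 - 3 * q + q ^ 2)) := by ring
    rw [h1, h2]
    refine mul_le_mul_of_nonneg_left ?_ hq0.le
    obtain rfl : q = 1 / 3 - d := by linarith
    rw [← sub_nonneg]
    ring_nf
    positivity

/-- The density bounds for families that are shifted, or become trivial when shifted, in the range
`3 * (j + 1) < N + 1`. -/
lemma mul_lt_of_sparse {N i j a b : ℕ} (hi : 1 ≤ i) (hij : i ≤ j)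
    (hd : 3 * (j + 1) ≤ N + 1) (ha : a ≤ (N + 1).choose (i + 1)) (hb : b ≤ (N + 1).choose (j + 1))
    (h : (a ≤ 2 * N.choose i ∧ b ≤ 2 * N.choose j) ∨
      (a ≤ N.choose i + (N + 1).choose i ∧ b ≤ N.choose j + (N + 1).choose j) ∨
      a ≤ N.choose i + (N + 1).choose (i - 1) ∨ b ≤ N.choose j + (N + 1).choose (j - 1)) :
    a * b < ((N + 1).choose (i + 1) + 1) *
        ((N + 1).choose (j + 1) - (N - i - 1).choose (j + 1)) := by
  refine mul_lt_of_density (by omega) ?_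
  obtain ⟨q, hq⟩ : ∃ q : ℚ, q = (j + 1) / (N + 1) := ⟨_, rfl⟩
  have hjN : (3 * ((j : ℚ) + 1)) ≤ N + 1 := by exact_mod_cast hd
  have hq0 : 0 < q := by rw [hq]; positivity
  have hq3 : q ≤ 1 / 3 := by
    rw [hq, div_le_div_iff₀ (by positivity) (by norm_num)]; linarith
  obtain ⟨r, hr⟩ : ∃ r : ℚ, r = (j + 1) / (N - j) := ⟨_, rfl⟩
  have hNj : (0 : ℚ) < N - j := by linarith [show (0 : ℚ) ≤ j by positivity]
  have hr0 : 0 < r := by rw [hr]; positivity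
  have hrq : r * (1 - q) = q := by
    rw [hr, hq]; field_simp; ring
  have hPi : (N.choose i : ℚ) ≤ (N + 1).choose (i + 1) * q := by
    rw [star_degree_ratio, hq]
    have : (i : ℚ) ≤ j := by exact_mod_cast hij
    gcongr
  have hQj : (N.choose j : ℚ) = (N + 1).choose (j + 1) * q := by rw [star_degree_ratio, hq]
  have r1 : ((N + 1).choose i : ℚ) ≤ (N + 1).choose (i + 1) * r := by
    rw [hr]; exact choose_lower_ratio hij (by omega)
  have r2 : ((N + 1).choose (i - 1) : ℚ) ≤ (N + 1).choose (i + 1) * r ^ 2 := by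
    obtain ⟨e, rfl⟩ : ∃ e, i = e + 1 := ⟨i - 1, by omega⟩
    have := choose_lower_ratio (N := N) (i := e) (j := j) (by omega) (by omega)
    rw [← hr] at this
    rw [pow_two, ← mul_assoc]
    exact this.trans (mul_le_mul_of_nonneg_right r1 hr0.le)
  have r3 : ((N + 1).choose j : ℚ) ≤ (N + 1).choose (j + 1) * r := by
    rw [hr]; exact choose_lower_ratio le_rfl (by omega)
  have r4 : ((N + 1).choose (j - 1) : ℚ) ≤ (N + 1).choose (j + 1) * r ^ 2 := by
    obtain ⟨e, rfl⟩ : ∃ e, j = e + 1 := ⟨j - 1, by omega⟩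
    have := choose_lower_ratio (N := N) (i := e) (j := e + 1) (by omega) (by omega)
    rw [← hr] at this
    rw [pow_two, ← mul_assoc]
    exact this.trans (mul_le_mul_of_nonneg_right r3 hr0.le)
  rw [← hq]
  have hpow : (1 - q) ^ (i + 2) ≤ (1 - q) ^ 3 :=
    pow_le_pow_of_le_one (by linarith) (by linarith) (by omega)
  have haQ : (a : ℚ) ≤ (N + 1).choose (i + 1) := by exact_mod_cast ha
  have hbQ : (b : ℚ) ≤ (N + 1).choose (j + 1) := by exact_mod_cast hb
  have hK : (0 : ℚ) ≤ (N + 1).choose (i + 1) := by positivity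
  have hL : (0 : ℚ) ≤ (N + 1).choose (j + 1) := by positivity
  generalize ((N + 1).choose (i + 1) : ℚ) = K at *
  generalize ((N + 1).choose (j + 1) : ℚ) = L at *
  have hb0 : (0 : ℚ) ≤ b := by positivity
  have finish : ∀ s t : ℚ, 0 ≤ s → a ≤ K * s → b ≤ L * t → s * t ≤ 1 - (1 - q) ^ 3 →
      (a * b : ℚ) ≤ K * L * (1 - (1 - q) ^ (i + 2)) := by
    intro s t hs h1 h2 h3
    calc (a * b : ℚ) ≤ (K * s) * (L * t) := mul_le_mul h1 h2 hb0 (by positivity)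
      _ = K * L * (s * t) := by ring
      _ ≤ _ := mul_le_mul_of_nonneg_left (by linarith) (by positivity)
  obtain ⟨i1, i2, i3⟩ := sparse_density_bounds hq0 hq3 hrq
  rcases h with ⟨h1, h2⟩ | ⟨h1, h2⟩ | h1 | h1
  · have h1' : (a : ℚ) ≤ 2 * N.choose i := by exact_mod_cast h1
    have h2' : (b : ℚ) ≤ 2 * N.choose j := by exact_mod_cast h2
    exact finish (2 * q) (2 * q) (by positivity) (by linarith) (by linarith) i1
  · have h1' : (a : ℚ) ≤ N.choose i + (N + 1).choose i := by exact_mod_cast h1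
    have h2' : (b : ℚ) ≤ N.choose j + (N + 1).choose j := by exact_mod_cast h2
    exact finish (q + r) (q + r) (by positivity) (by linarith) (by linarith) i2
  · have h1' : (a : ℚ) ≤ N.choose i + (N + 1).choose (i - 1) := by exact_mod_cast h1
    exact finish (q + r ^ 2) 1 (by positivity) (by linarith) (by linarith) (by linarith)
  · have h1' : (b : ℚ) ≤ N.choose j + (N + 1).choose (j - 1) := by exact_mod_cast h1
    exact finish 1 (q + r ^ 2) (by positivity) (by linarith) (by linarith) (by linarith)

/-- If neither family is larger than a star, the product is never extremal. -/
theorem mul_lt_of_card_le_star {N i j : ℕ} {𝒜 ℬ : Finset (Finset (Fin (N + 2)))}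
    (h𝒜 : 𝒜 ⊆ uniform (N + 2) (i + 2)) (hℬ : ℬ ⊆ uniform (N + 2) (j + 2))
    (h : CrossIntersecting 𝒜 ℬ) (hx : ∀ x, ∃ F ∈ 𝒜 ∪ ℬ, x ∉ F)
    (hij : i ≤ j) (hN : 2 * j + 2 ≤ N) (hN' : i + j + 3 ≤ N)
    (ha : #𝒜 ≤ (N + 1).choose (i + 1)) (hb : #ℬ ≤ (N + 1).choose (j + 1)) :
    #𝒜 * #ℬ < ((N + 1).choose (i + 1) + 1) *
        ((N + 1).choose (j + 1) - (N - i - 1).choose (j + 1)) := by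
  induction hw : weight 𝒜 + weight ℬ using Nat.strong_induction_on generalizing 𝒜 ℬ with
  | _ w ih =>
  rcases mul_lt_or_degree_le h𝒜 hℬ h hx hij hN hN' ha hb with hlt | ⟨⟨A, hA⟩, ⟨B, hB⟩, hdeg⟩
  · exact hlt
  have da : (i + 2) * #𝒜 ≤ (N + 2) * N.choose i := by
    rw [← sum_card_memberSubfamily h𝒜]
    refine (sum_le_card_nsmul _ _ _ fun x _ => (hdeg x).1).trans ?_
    simp
  have db : (j + 2) * #ℬ ≤ (N + 2) * N.choose j := by
    rw [← sum_card_memberSubfamily hℬ]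
    refine (sum_le_card_nsmul _ _ _ fun x _ => (hdeg x).2).trans ?_
    simp
  rcases Nat.eq_zero_or_pos i with rfl | hi
  · refine mul_lt_of_pairs (by omega) (by simpa using da) ?_
    refine (card_le_sum_of_inter_nonempty A fun B hB => h A hA B hB).trans ?_
    refine (sum_le_card_nsmul _ _ _ fun x _ => (hdeg x).2).trans ?_
    rw [(mem_powersetCard.1 (h𝒜 hA)).2, smul_eq_mul]
  rcases le_or_gt (N + 1) (3 * (j + 1)) with hd | hd
  · exact mul_lt_of_dense hi hN hd da db
  by_cases hfix : ∃ x y : Fin (N + 2), x < y ∧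
      ¬ (shiftFamily x y 𝒜 = 𝒜 ∧ shiftFamily x y ℬ = ℬ)
  · obtain ⟨x, y, hxy, hne⟩ := hfix
    by_cases hx' : ∀ z, ∃ F ∈ shiftFamily x y 𝒜 ∪ shiftFamily x y ℬ, z ∉ F
    · have hlt : weight (shiftFamily x y 𝒜) + weight (shiftFamily x y ℬ) < w := by
        have h1 := weight_shiftFamily_le (𝒜 := 𝒜) hxy
        have h2 := weight_shiftFamily_le (𝒜 := ℬ) hxy
        rw [not_and_or] at hne
        rcases hne with hne | hne
        · have := weight_shiftFamily_lt hxy hne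
          omega
        · have := weight_shiftFamily_lt hxy hne
          omega
      have := ih _ hlt (shiftFamily_subset_uniform h𝒜) (shiftFamily_subset_uniform hℬ)
        (h.shiftFamily hxy.ne) hx' (by rwa [UV.card_compression]) (by rwa [UV.card_compression]) rfl
      rwa [UV.card_compression, UV.card_compression] at this
    · have hmeet := inter_pair_nonempty_of_shift hx hx'
      refine mul_lt_of_sparse hi hij hd.le ha hb (Or.inl ⟨?_, ?_⟩)
      · refine (card_le_sum_of_inter_nonempty {x, y}
          fun F hF => hmeet F (mem_union_left _ hF)).trans ?_
        rw [sum_pair hxy.ne, two_mul]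
        exact Nat.add_le_add (hdeg x).1 (hdeg y).1
      · refine (card_le_sum_of_inter_nonempty {x, y}
          fun F hF => hmeet F (mem_union_right _ hF)).trans ?_
        rw [sum_pair hxy.ne, two_mul]
        exact Nat.add_le_add (hdeg x).2 (hdeg y).2
  push Not at hfix
  have hreach : ∀ A ∈ 𝒜, ∀ B ∈ ℬ, ∃ s, s < initCount A s + initCount B s :=
    fun A hA B hB => exists_lt_initCount_add h (fun x y hxy => (hfix x y hxy).1) hA hB
  have hca := 𝒜.card_memberSubfamily_add_card_nonMemberSubfamily 0
  have hcb := ℬ.card_memberSubfamily_add_card_nonMemberSubfamily 0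
  have hd0 := hdeg 0
  refine mul_lt_of_sparse hi hij hd.le ha hb (Or.inr ?_)
  -- The maximal heights of the walks of a member of `𝒜` and of a member of `ℬ` sum to at least `2`.
  by_cases h𝒜1 : ∀ A ∈ 𝒜, ∃ s, s + 1 ≤ 2 * initCount A s
  · by_cases hℬ1 : ∀ B ∈ ℬ, ∃ s, s + 1 ≤ 2 * initCount B s
    · left
      have h1 := card_nonMemberSubfamily_zero_le (w := 1) (d := i)
        (by rwa [show 1 + 1 + i = i + 2 by omega]) one_pos h𝒜1
      have h2 := card_nonMemberSubfamily_zero_le (w := 1) (d := j)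
        (by rwa [show 1 + 1 + j = j + 2 by omega]) one_pos hℬ1
      omega
    · right; left
      push Not at hℬ1
      obtain ⟨B', hB', hlow⟩ := hℬ1
      have h1 := card_nonMemberSubfamily_zero_le (w := 2) (d := i - 1) (𝒜 := 𝒜)
        (by rwa [show 2 + 1 + (i - 1) = i + 2 by omega]) two_pos (fun A hA => by
          obtain ⟨s, hs⟩ := hreach A hA B' hB'
          have := hlow s
          exact ⟨s, by omega⟩)
      omega
  · right; right
    push Not at h𝒜1
    obtain ⟨A', hA', hlow⟩ := h𝒜1
    have h1 := card_nonMemberSubfamily_zero_le (w := 2) (d := j - 1) (𝒜 := ℬ)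
      (by rwa [show 2 + 1 + (j - 1) = j + 2 by omega]) two_pos (fun B hB => by
        obtain ⟨s, hs⟩ := hreach A' hA' B hB
        have := hlow s
        exact ⟨s, by omega⟩)
    omega

/-! ### The extremal cardinalities -/

/-- The pairs of cardinalities that extremal pairs of families may have. -/
theorem card_mul_card_lt_or {N i j : ℕ} {𝒜 ℬ : Finset (Finset (Fin (N + 2)))}
    (h𝒜 : 𝒜 ⊆ uniform (N + 2) (i + 2)) (hℬ : ℬ ⊆ uniform (N + 2) (j + 2))
    (h : CrossIntersecting 𝒜 ℬ) (hx : ∀ x, ∃ F ∈ 𝒜 ∪ ℬ, x ∉ F)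
    (hN : (i < j ∧ 2 * j + 2 ≤ N) ∨ (i = j ∧ 2 * j + 3 ≤ N)) :
    #𝒜 * #ℬ < max (((N + 1).choose (i + 1) + N.choose (i + 1)) * N.choose j)
          (((N + 1).choose (i + 1) + 1) *
            ((N + 1).choose (j + 1) - (N - i - 1).choose (j + 1))) ∨
      (#𝒜 = (N + 1).choose (i + 1) + N.choose (i + 1) ∧ #ℬ = N.choose j) ∨
      (#𝒜 = (N + 1).choose (i + 1) + 1 ∧
        #ℬ = (N + 1).choose (j + 1) - (N - i - 1).choose (j + 1)) ∨
      (i = j ∧ #ℬ = (N + 1).choose (i + 1) + N.choose (i + 1) ∧ #𝒜 = N.choose j) ∨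
      (i = j ∧ #ℬ = (N + 1).choose (i + 1) + 1 ∧
        #𝒜 = (N + 1).choose (j + 1) - (N - i - 1).choose (j + 1)) := by
  have hf := h.feasible h𝒜 hℬ
  rcases lt_or_ge ((N + 1).choose (i + 1)) #𝒜 with ha | ha
  · obtain ⟨a, hae⟩ := Nat.exists_eq_add_of_lt ha
    rw [hae, add_assoc ((N + 1).choose (i + 1))] at hf ⊢
    rcases (hf.peel_left (by omega)).mul_lt_max_or (by omega) hN with h1 | ⟨h1, h2⟩ | ⟨h1, h2⟩
    · exact Or.inl h1
    · right; left; exact ⟨by omega, h2⟩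
    · right; right; left; exact ⟨by omega, h2⟩
  rcases lt_or_ge ((N + 1).choose (j + 1)) #ℬ with hb | hb
  · obtain ⟨b, hbe⟩ := Nat.exists_eq_add_of_lt hb
    rw [hbe, add_assoc ((N + 1).choose (j + 1))] at hf ⊢
    rcases hN with ⟨hij, hN⟩ | ⟨rfl, hN⟩
    · left
      rcases Nat.eq_zero_or_pos #𝒜 with h0 | h0
      · rw [h0, zero_mul]
        refine lt_max_of_lt_left ?_
        exact Nat.mul_pos (Nat.add_pos_left (Nat.choose_pos (by omega)) _)
          (Nat.choose_pos (by omega))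
      · exact hf.mul_lt_max_of_right h0 (by omega) hij hN
    · rcases (hf.symm.peel_left (by omega)).mul_lt_max_or (by omega) (Or.inr ⟨rfl, hN⟩) with
        h1 | ⟨h1, h2⟩ | ⟨h1, h2⟩
      · left; rw [mul_comm]; exact h1
      · right; right; right; left; exact ⟨rfl, by omega, h2⟩
      · right; right; right; right; exact ⟨rfl, by omega, h2⟩
  · left
    exact lt_max_of_lt_right
      (mul_lt_of_card_le_star h𝒜 hℬ h hx (by omega) (by omega) (by omega) ha hb)

/-! ### The structure of the extremal pairs -/

lemma exists_lt_of_card_mul_lt {α : Type*} {S : Finset α} {f : α → ℕ} {c m : ℕ}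
    (h : #S * c < m) (hm : ∑ x ∈ S, f x = m) : ∃ x ∈ S, c < f x := by
  refine exists_lt_of_sum_lt ?_
  rwa [hm, sum_const, smul_eq_mul]

/-- Two links of a pair of families of the sizes of `{A : 1 ∈ A ∨ 2 ∈ A}` and `{B : {1, 2} ⊆ B}`
compete for the same room. -/
lemma eq_zero_of_feasible_links {N i j a b : ℕ} (hj : 0 < j) (hN : i + j + 3 ≤ N)
    (h1 : Feasible N (i + 1) (j + 1) a b)
    (h2 : Feasible N (i + 2) j (N.choose (i + 1) - a) (N.choose j - b))
    (ha : (N - 1).choose i < a) : b = 0 := by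
  by_contra hb
  obtain ⟨m, rfl⟩ : ∃ m, N = m + 1 := ⟨N - 1, by omega⟩
  obtain ⟨J, rfl⟩ : ∃ J, j = J + 1 := ⟨j - 1, by omega⟩
  rw [Nat.add_sub_cancel] at ha
  have hle := h1.left_le
  obtain ⟨a', rfl⟩ : ∃ a', a = m.choose i + a' := ⟨_, (Nat.add_sub_of_le ha.le).symm⟩
  have g1 : Feasible m (i + 1) (J + 1) a' b := h1.peel_left (by omega)
  have w1 := g1.weighted_sum_lt_mul (by omega) (by omega) (by omega)
  have hb' := g1.right_le
  have e1 := Nat.choose_succ_succ' m i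
  have e2 := Nat.choose_succ_succ' m J
  rw [e1, e2, show m.choose J + m.choose (J + 1) - b = m.choose J + (m.choose (J + 1) - b) by
    omega, Nat.add_sub_add_left] at h2
  have g2 : Feasible m (i + 1) (J + 1) _ _ := (h2.peel_right (by omega))
  have w2 := g2.weighted_sum_le_mul (by omega)
  obtain ⟨c, hc⟩ := Nat.exists_eq_add_of_le g1.left_le
  obtain ⟨d, hd⟩ := Nat.exists_eq_add_of_le hb'
  rw [hc, hd, Nat.add_sub_cancel_left, Nat.add_sub_cancel_left] at w2
  rw [hc, hd] at w1
  linarith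

lemma card_star {α : Type*} [DecidableEq α] {S : Finset α} {x : α} (hx : x ∈ S) (r : ℕ) :
    #((powersetCard (r + 1) S).filter fun A => x ∈ A) = (#S - 1).choose r := by
  rw [← card_memberSubfamily, ← card_erase_of_mem hx, ← card_powersetCard]
  congr 1
  refine (memberSubfamily_subset Subset.rfl x).antisymm fun A hA => ?_
  obtain ⟨h1, h2⟩ := mem_powersetCard.1 hA
  have hxA := fun h => notMem_erase x S (h1 h)
  rw [mem_memberSubfamily, mem_powersetCard, card_insert_of_notMem hxA, h2]
  exact ⟨⟨insert_subset hx (h1.trans (erase_subset _ _)), rfl⟩, hxA⟩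

lemma card_filter_mem_inter {n r : ℕ} {x : Fin n} {T : Finset (Fin n)} (hx : x ∉ T) :
    #((uniform n (r + 1)).filter fun B => x ∈ B ∧ (B ∩ T).Nonempty) =
      (n - 1).choose r - (n - #T - 1).choose r := by
  have h1 := card_star (mem_univ x) r
  have h2 := card_star (mem_compl.2 hx) r
  rw [card_univ, Fintype.card_fin] at h1
  rw [card_compl, Fintype.card_fin] at h2
  rw [← h1, ← h2, ← card_sdiff_of_subset]
  · congr 1
    ext B
    simp only [mem_filter, mem_sdiff, mem_powersetCard, subset_univ, true_and]
    rw [← not_disjoint_iff_nonempty_inter, ← le_compl_iff_disjoint_right]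
    tauto
  · exact filter_subset_filter _ (powersetCard_mono (subset_univ _))

lemma card_filter_mem_and_mem {n r : ℕ} {x y : Fin n} (hxy : x ≠ y) :
    #((uniform n (r + 1)).filter fun B => x ∈ B ∧ y ∈ B) =
      (n - 1).choose r - (n - 2).choose r := by
  rw [← Nat.sub_sub n 1 1]
  have := card_filter_mem_inter (r := r) (show x ∉ {y} by simpa using hxy)
  rw [card_singleton] at this
  rw [← this]
  congr 1
  refine filter_congr fun B _ => ?_
  rw [← not_disjoint_iff_nonempty_inter, disjoint_singleton_right, not_not]

lemma card_filter_mem_or_mem {n k : ℕ} {x y : Fin n} (hxy : x ≠ y) :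
    #((uniform n k).filter fun A => x ∈ A ∨ y ∈ A) = n.choose k - (n - 2).choose k := by
  have h1 : #(powersetCard k ({x, y} : Finset (Fin n))ᶜ) = (n - 2).choose k := by
    rw [card_powersetCard, card_compl, card_pair hxy, Fintype.card_fin]
  have h2 : #(uniform n k) = n.choose k := by simp
  rw [← h1, ← h2, ← card_sdiff_of_subset (powersetCard_mono (subset_univ _))]
  congr 1
  ext A
  simp only [mem_filter, mem_sdiff, mem_powersetCard, subset_univ, true_and]
  rw [le_compl_iff_disjoint_right, disjoint_insert_right, disjoint_singleton_right]
  tauto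

lemma exists_disjoint_superset {n l : ℕ} {A T : Finset (Fin n)} (hT : Disjoint T A) (h1 : #T ≤ l)
    (h2 : l + #A ≤ n) : ∃ B ∈ uniform n l, T ⊆ B ∧ ¬ (A ∩ B).Nonempty := by
  obtain ⟨B, hB1, hB2, hB3⟩ := exists_subsuperset_card_eq
    (le_compl_iff_disjoint_right.2 hT : T ⊆ Aᶜ) h1 (by
      rw [card_compl, Fintype.card_fin]; omega)
  refine ⟨B, mem_powersetCard.2 ⟨subset_univ _, hB3⟩, hB1, ?_⟩
  rw [← not_disjoint_iff_nonempty_inter, not_not, disjoint_comm]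
  exact le_compl_iff_disjoint_right.1 hB2

/-- If `ℬ` consists of all sets containing `x` and `y`, each member of `𝒜` contains one of them. -/
lemma mem_or_mem_of_card {N i j : ℕ} {𝒜 ℬ : Finset (Finset (Fin (N + 2)))}
    (h𝒜 : 𝒜 ⊆ uniform (N + 2) (i + 2)) (hℬ : ℬ ⊆ uniform (N + 2) (j + 2))
    (h : CrossIntersecting 𝒜 ℬ) (hN : i + j + 2 ≤ N) {x y : Fin (N + 2)} (hxy : x ≠ y)
    (hb : #ℬ = N.choose j) (hx : ∀ B ∈ ℬ, x ∈ B ∧ y ∈ B) : ∀ A ∈ 𝒜, x ∈ A ∨ y ∈ A := by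
  have hF : ℬ = (uniform (N + 2) (j + 2)).filter fun B => x ∈ B ∧ y ∈ B := by
    refine eq_of_subset_of_card_le (fun B hB => mem_filter.2 ⟨hℬ hB, hx B hB⟩) ?_
    rw [card_filter_mem_and_mem hxy, hb]
    simp only [Nat.add_sub_cancel, Nat.reduceSubDiff, Nat.choose_succ_succ' N j]
    simp
  intro A hA
  by_contra hcon
  rw [not_or] at hcon
  obtain ⟨B, hB1, hB2, hB3⟩ := exists_disjoint_superset (l := j + 2) (A := A) (T := {x, y})
    (by simp [hcon]) (by rw [card_pair hxy]; omega)
    (by rw [(mem_powersetCard.1 (h𝒜 hA)).2]; omega)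
  refine hB3 (h A hA B ?_)
  rw [hF, mem_filter]
  exact ⟨hB1, hB2 (by simp), hB2 (by simp)⟩

/-- Pairs of the sizes of the first extremal pair. -/
theorem exists_pair_of_card {N i j : ℕ} {𝒜 ℬ : Finset (Finset (Fin (N + 2)))}
    (h𝒜 : 𝒜 ⊆ uniform (N + 2) (i + 2)) (hℬ : ℬ ⊆ uniform (N + 2) (j + 2))
    (h : CrossIntersecting 𝒜 ℬ) (hN : i + j + 3 ≤ N) (hij : i ≤ j)
    (ha : #𝒜 = (N + 1).choose (i + 1) + N.choose (i + 1)) (hb : #ℬ = N.choose j) :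
    ∃ x y, x ≠ y ∧ (∀ A ∈ 𝒜, x ∈ A ∨ y ∈ A) ∧ ∀ B ∈ ℬ, x ∈ B ∧ y ∈ B := by
  suffices ∃ x y, x ≠ y ∧ ∀ B ∈ ℬ, x ∈ B ∧ y ∈ B by
    obtain ⟨x, y, hxy, hB⟩ := this
    exact ⟨x, y, hxy, mem_or_mem_of_card h𝒜 hℬ h (by omega) hxy hb hB, hB⟩
  rcases Nat.eq_zero_or_pos j with rfl | hj
  · rw [Nat.choose_zero_right, card_eq_one] at hb
    obtain ⟨B, rfl⟩ := hb
    obtain ⟨x, y, hxy, hB⟩ := card_eq_two.1 (mem_powersetCard.1 (hℬ (mem_singleton_self B))).2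
    exact ⟨x, y, hxy, by simp [hB]⟩
  obtain ⟨m, rfl⟩ : ∃ m, N = m + 1 := ⟨N - 1, by omega⟩
  have e1 := choose_pred_mul (n := m + 1) (k := i)
  have e2 := choose_pred_mul (n := m) (k := i)
  have e3 := Nat.choose_succ_succ' (m + 1) i
  have e4 := Nat.choose_succ_succ' m i
  have hpos : 0 < m.choose (i + 1) := Nat.choose_pos (by omega)
  -- By averaging, some point has a degree that allows its link to be peeled twice.
  obtain ⟨x, -, hx⟩ := exists_lt_of_card_mul_lt (S := univ) (c := (m + 1).choose i + m.choose i)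
    (by rw [card_univ, Fintype.card_fin, ha]; nlinarith) (sum_card_memberSubfamily h𝒜)
  have hca := 𝒜.card_memberSubfamily_add_card_nonMemberSubfamily x
  have hcb := ℬ.card_memberSubfamily_add_card_nonMemberSubfamily x
  have hx0 : #(ℬ.nonMemberSubfamily x) = 0 := by
    have f1 : Feasible (m + 2) (i + 1) (j + 2) _ _ := h.feasible_link h𝒜 hℬ x
    have f2 : Feasible (m + 2) (i + 2) (j + 1) _ _ := (h.symm.feasible_link hℬ h𝒜 x).symm
    obtain ⟨a, hae⟩ : ∃ a, #(𝒜.memberSubfamily x) = (m + 1).choose i + a :=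
      Nat.exists_eq_add_of_le (by omega)
    have g1 : Feasible (m + 1) (i + 1) (j + 1) a _ := (hae ▸ f1).peel_left (by omega)
    have hle := g1.left_le
    have g2 : Feasible (m + 1) (i + 2) j ((m + 1).choose (i + 1) - a) _ :=
      (f2.mono (a' := (m + 1).choose (i + 1) + ((m + 1).choose (i + 1) - a)) (by omega)
        le_rfl).peel_left (by omega)
    refine eq_zero_of_feasible_links hj hN g1 (g2.mono le_rfl (by omega)) ?_
    rw [Nat.add_sub_cancel]
    omega
  have hstar : ∀ B ∈ ℬ, x ∈ B := by
    intro B hB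
    by_contra hxB
    rw [card_eq_zero] at hx0
    exact notMem_empty B (hx0 ▸ mem_nonMemberSubfamily.2 ⟨hB, hxB⟩)
  -- The same argument on the links avoiding and containing `x`.
  have h𝒜' := nonMemberSubfamily_subset h𝒜 x
  have hℬ' := memberSubfamily_subset hℬ x
  have hc : ∀ A ∈ 𝒜.nonMemberSubfamily x, ∀ B ∈ ℬ.memberSubfamily x, (A ∩ B).Nonempty := by
    intro A hA B hB
    rw [mem_nonMemberSubfamily] at hA
    rw [mem_memberSubfamily] at hB
    have := h A hA.1 _ hB.1
    rwa [inter_insert_of_notMem hA.2] at this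
  have hSc : #(univ.erase x) = m + 2 := by simp
  have hle := card_le_card (memberSubfamily_subset h𝒜 x)
  rw [card_powersetCard, hSc] at hle
  obtain ⟨y, hyS, hy⟩ := exists_lt_of_card_mul_lt (S := univ.erase x) (c := m.choose i)
    (by
      rw [hSc]
      have : (m + 1).choose (i + 1) ≤ #(𝒜.nonMemberSubfamily x) := by
        rw [show m + 1 + 1 = m + 2 by rfl] at ha
        omega
      have := Nat.mul_le_mul_left (i + 2) this
      nlinarith) (sum_card_memberSubfamily h𝒜')
  refine ⟨x, y, (ne_of_mem_erase hyS).symm, fun B hB => ⟨hstar B hB, ?_⟩⟩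
  have hca' := (𝒜.nonMemberSubfamily x).card_memberSubfamily_add_card_nonMemberSubfamily y
  have hcb' := (ℬ.memberSubfamily x).card_memberSubfamily_add_card_nonMemberSubfamily y
  have f1 : Feasible (m + 1) (i + 1) (j + 1) _ _ := feasible_link hc h𝒜' hℬ' hyS hSc
  have f2 : Feasible (m + 1) j (i + 2) _ _ := feasible_link
    (fun B hB A hA => by rw [inter_comm]; exact hc A hA B hB) hℬ' h𝒜' hyS hSc
  have h0 := eq_zero_of_feasible_links hj hN f1 (f2.symm.mono (by
    rw [show m + 1 + 1 = m + 2 by rfl] at ha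
    omega) (by omega)) (by rwa [Nat.add_sub_cancel])
  by_contra hyB
  rw [card_eq_zero] at h0
  have hBx : B.erase x ∈ (ℬ.memberSubfamily x).nonMemberSubfamily y := by
    rw [mem_nonMemberSubfamily, mem_memberSubfamily, insert_erase (hstar B hB)]
    exact ⟨⟨hB, notMem_erase x B⟩, fun h => hyB (mem_of_mem_erase h)⟩
  exact notMem_empty _ (h0 ▸ hBx)

/-- Pairs of the sizes of the second extremal pair. -/
theorem exists_star_of_card {N i j : ℕ} {𝒜 ℬ : Finset (Finset (Fin (N + 2)))}
    (h𝒜 : 𝒜 ⊆ uniform (N + 2) (i + 2)) (hℬ : ℬ ⊆ uniform (N + 2) (j + 2))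
    (h : CrossIntersecting 𝒜 ℬ) (hN : i + j + 3 ≤ N) (hij : i ≤ j) (hj : 2 * j + 2 ≤ N)
    (ha : #𝒜 = (N + 1).choose (i + 1) + 1)
    (hb : #ℬ = (N + 1).choose (j + 1) - (N - i - 1).choose (j + 1)) :
    ∃ x A₀, x ∉ A₀ ∧ A₀ ∈ 𝒜 ∧ (∀ A ∈ 𝒜, x ∈ A ∨ A = A₀) ∧ ∀ B ∈ ℬ, x ∈ B := by
  have hNk := Nat.choose_succ_succ' N i
  have hNl := Nat.choose_succ_succ' N j
  have hP : 0 < N.choose i := Nat.choose_pos (by omega)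
  have hQ : 0 < N.choose j := Nat.choose_pos (by omega)
  have hN₁ : 0 < N.choose (i + 1) := Nat.choose_pos (by omega)
  have hN₂ : 0 < N.choose (j + 1) := Nat.choose_pos (by omega)
  have hD : (N - i - 1).choose (j + 1) ≤ N.choose (j + 1) := Nat.choose_le_choose _ (by omega)
  have hD' : 2 ≤ (N - j - 1).choose (i + 1) :=
    le_trans (by omega) (le_choose (by omega) (by omega))
  have hDD : N.choose (i + 1) * (N - i - 1).choose (j + 1) =
      N.choose (j + 1) * (N - j - 1).choose (i + 1) := by
    have := choose_mul_choose_sub N (i + 1) (j + 1)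
    rwa [← Nat.sub_sub, ← Nat.sub_sub] at this
  obtain ⟨x, hx⟩ : ∃ x, #(ℬ.nonMemberSubfamily x) = 0 := by
    by_contra! hcon
    have hca := fun x => 𝒜.card_memberSubfamily_add_card_nonMemberSubfamily x
    have hcb := fun x => ℬ.card_memberSubfamily_add_card_nonMemberSubfamily x
    have hdeg : ∀ x, #(𝒜.memberSubfamily x) ≤ N.choose i + 1 ∧
        #(ℬ.memberSubfamily x) ≤ N.choose j ∧
        (N.choose i < #(𝒜.memberSubfamily x) → #(ℬ.memberSubfamily x) = N.choose j) := by
      intro x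
      have hca := hca x
      have hcb := hcb x
      have hb0 := Nat.pos_of_ne_zero (hcon x)
      have f1 : Feasible (N + 1) (i + 1) (j + 2) _ _ := h.feasible_link h𝒜 hℬ x
      have f2 : Feasible (N + 1) (i + 2) (j + 1) _ _ := (h.symm.feasible_link hℬ h𝒜 x).symm
      have ha1 := f1.left_le
      have hb1 : #(ℬ.memberSubfamily x) ≤ N.choose j := by
        by_contra! hlt
        obtain ⟨β, hβ⟩ := Nat.exists_eq_add_of_lt hlt
        have g2 : Feasible N (i + 1) (j + 1) _ (β + 1) :=
          (f2.mono le_rfl (by rw [hβ, add_assoc])).peel_right (by omega)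
        have d2 := g2.choose_add_le (by omega)
        rw [← Nat.sub_sub] at d2
        rcases le_or_gt #(𝒜.memberSubfamily x) (N.choose i) with h1 | h1
        · omega
        obtain ⟨α, hα⟩ := Nat.exists_eq_add_of_lt h1
        have g1 : Feasible N (i + 1) (j + 1) (α + 1) _ :=
          (f1.mono (by rw [hα, add_assoc]) le_rfl).peel_left (by omega)
        have w1 := g1.weighted_sum_le (by omega) (by omega) (by omega) hb0
        have w2 := g2.weighted_sum_le (by omega) (by omega) (by omega) (by omega)
        rw [← Nat.sub_sub] at w1 w2
        have s1 : α + 1 + #(𝒜.nonMemberSubfamily x) = N.choose (i + 1) + 1 := by omega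
        have s2 : β + 1 + #(ℬ.nonMemberSubfamily x) + (N - i - 1).choose (j + 1) =
          N.choose (j + 1) := by omega
        have m1 := congrArg (· * N.choose (j + 1)) s1
        have m2 := congrArg (· * N.choose (i + 1)) s2
        have m3 := Nat.mul_le_mul_left (N.choose (j + 1)) hD'
        linarith
      have hlarge : N.choose i < #(𝒜.memberSubfamily x) →
          #(𝒜.memberSubfamily x) ≤ N.choose i + 1 ∧ #(ℬ.memberSubfamily x) = N.choose j := by
        intro h1
        obtain ⟨α, hα⟩ := Nat.exists_eq_add_of_lt h1
        have g1 : Feasible N (i + 1) (j + 1) (α + 1) _ :=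
          (f1.mono (by rw [hα, add_assoc]) le_rfl).peel_left (by omega)
        have d1 := g1.add_choose_le (by omega)
        rw [← Nat.sub_sub] at d1
        have w1 := g1.weighted_sum_le (by omega) (by omega) (by omega) hb0
        rw [← Nat.sub_sub] at w1
        refine ⟨?_, by omega⟩
        have s2 : #(ℬ.nonMemberSubfamily x) + (N - i - 1).choose (j + 1) =
          N.choose (j + 1) := by omega
        have m2 := congrArg (· * N.choose (i + 1)) s2
        have : (α + 1) * N.choose (j + 1) ≤ 1 * N.choose (j + 1) := by linarith
        have := Nat.le_of_mul_le_mul_right this hN₂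
        omega
      exact ⟨(le_or_gt _ _).elim (fun h => h.trans (Nat.le_succ _)) fun h => (hlarge h).1, hb1,
        fun h => (hlarge h).2⟩
    have hsum := sum_card_memberSubfamily h𝒜
    rw [ha] at hsum
    have e1 := choose_pred_mul (n := N) (k := i)
    rcases Nat.eq_zero_or_pos i with rfl | hi
    · -- For `k = 2` the degree sum only just allows equality everywhere.
      have heq : ∀ x ∈ univ, #(𝒜.memberSubfamily x) = N.choose 0 + 1 := by
        refine (sum_eq_sum_iff_of_le fun x _ => (hdeg x).1).1 ?_
        rw [hsum, sum_const, card_univ, Fintype.card_fin]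
        simp
        ring
      have hsumb := sum_card_memberSubfamily hℬ
      rw [hb, sum_congr rfl fun x hx => (hdeg x).2.2 (by rw [heq x hx]; omega), sum_const,
        card_univ, Fintype.card_fin, smul_eq_mul] at hsumb
      obtain ⟨m, rfl⟩ : ∃ m, N = m + 1 := ⟨N - 1, by omega⟩
      have e2 := Nat.choose_succ_succ' m j
      have e3 := Nat.choose_mul_succ_eq m j
      rw [show (m + 1 + 1).choose (j + 1) - (m + 1 - 0 - 1).choose (j + 1) =
        (m + 1).choose j + m.choose j by
          simp only [Nat.sub_zero, Nat.add_sub_cancel]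
          omega] at hsumb
      obtain ⟨e, rfl⟩ : ∃ e, m = j + 2 + e := ⟨m - (j + 2), by omega⟩
      rw [show j + 2 + e + 1 - j = 3 + e by omega] at e3
      generalize (j + 2 + e + 1).choose j = Q at *
      generalize (j + 2 + e).choose j = σ at *
      have h1 : Q * ((j + 2 + e + 1 + 2) * (j + 2 + e + 1)) =
          Q * ((j + 2) * (j + 2 + e + 1 + (3 + e))) := by
        calc _ = ((j + 2 + e + 1 + 2) * Q) * (j + 2 + e + 1) := by ring
          _ = (j + 2) * (Q * (j + 2 + e + 1) + σ * (j + 2 + e + 1)) := by rw [hsumb]; ring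
          _ = _ := by rw [e3]; ring
      have h2 := Nat.eq_of_mul_eq_mul_left hQ h1
      nlinarith
    · have hle := sum_le_card_nsmul univ _ _ fun x _ => (hdeg x).1
      rw [hsum, card_univ, Fintype.card_fin, smul_eq_mul] at hle
      have h1 := le_choose (n := N) (k := i + 1) (by omega) (by omega)
      nlinarith
  have hstar : ∀ B ∈ ℬ, x ∈ B := by
    intro B hB
    by_contra hxB
    rw [card_eq_zero] at hx
    exact notMem_empty B (hx ▸ mem_nonMemberSubfamily.2 ⟨hB, hxB⟩)
  obtain ⟨A₀, hA₀⟩ : (𝒜.nonMemberSubfamily x).Nonempty := by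
    have h1 := 𝒜.card_memberSubfamily_add_card_nonMemberSubfamily x
    have h2 := card_le_card (memberSubfamily_subset h𝒜 x)
    rw [card_powersetCard, card_erase_of_mem (mem_univ _), card_univ, Fintype.card_fin,
      show N + 2 - 1 = N + 1 by rfl] at h2
    rw [← card_pos]
    omega
  rw [mem_nonMemberSubfamily] at hA₀
  have hk : ∀ A ∈ 𝒜, #A = i + 2 := fun A hA => (mem_powersetCard.1 (h𝒜 hA)).2
  refine ⟨x, A₀, hA₀.2, hA₀.1, fun A hA => ?_, hstar⟩
  have hF : ℬ = (uniform (N + 2) (j + 2)).filter fun B => x ∈ B ∧ (B ∩ A₀).Nonempty := by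
    refine eq_of_subset_of_card_le (fun B hB => mem_filter.2 ⟨hℬ hB, hstar B hB, ?_⟩) ?_
    · rw [inter_comm]; exact h A₀ hA₀.1 B hB
    · rw [card_filter_mem_inter hA₀.2, hb, hk A₀ hA₀.1,
        show N + 2 - (i + 2) - 1 = N - i - 1 by omega]
      rfl
  by_contra hcon
  rw [not_or] at hcon
  obtain ⟨z, hz, hzA⟩ : ∃ z ∈ A₀, z ∉ A := by
    by_contra! hsub
    exact hcon.2 (eq_of_subset_of_card_le hsub (by rw [hk A hA, hk A₀ hA₀.1])).symm
  obtain ⟨B, hB1, hB2, hB3⟩ := exists_disjoint_superset (l := j + 2) (A := A) (T := {x, z})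
    (by simp [hcon, hzA]) (card_le_two.trans (by omega)) (by rw [hk A hA]; omega)
  refine hB3 (h A hA B ?_)
  rw [hF, mem_filter]
  exact ⟨hB1, hB2 (by simp), z, mem_inter.2 ⟨hB2 (by simp), hz⟩⟩

/-! ### The two extremal pairs -/

section Extremal

variable {n k l : ℕ}

lemma has_one (hn : 2 ≤ n) {F : Finset (Fin n)} : Has F 1 ↔ (⟨0, by omega⟩ : Fin n) ∈ F := by
  constructor
  · rintro ⟨i, hi, h⟩
    rwa [show (⟨0, by omega⟩ : Fin n) = i from Fin.ext (by simp; omega)]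
  · exact fun h => ⟨_, h, rfl⟩

lemma has_two (hn : 2 ≤ n) {F : Finset (Fin n)} : Has F 2 ↔ (⟨1, by omega⟩ : Fin n) ∈ F := by
  constructor
  · rintro ⟨i, hi, h⟩
    rwa [show (⟨1, by omega⟩ : Fin n) = i from Fin.ext (by simp; omega)]
  · exact fun h => ⟨_, h, rfl⟩

lemma interval_one_two (hn : 2 ≤ n) :
    interval n 1 2 = {(⟨0, by omega⟩ : Fin n), (⟨1, by omega⟩ : Fin n)} := by
  ext x
  simp only [interval, mem_filter, mem_univ, true_and, mem_insert, mem_singleton, Fin.ext_iff]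
  omega

lemma zero_notMem_interval (hn : 2 ≤ n) : (⟨0, by omega⟩ : Fin n) ∉ interval n 2 (k + 1) := by
  simp [interval]

lemma card_interval (hk : 0 < k) (hkn : k < n) : #(interval n 2 (k + 1)) = k := by
  have : interval n 2 (k + 1) = Icc (⟨1, by omega⟩ : Fin n) ⟨k, hkn⟩ := by
    ext x
    simp only [interval, mem_filter, mem_univ, true_and, mem_Icc, Fin.le_def]
    omega
  rw [this, Fin.card_Icc]
  simp

lemma A₁_eq (hn : 2 ≤ n) : A₁ n k = (uniform n k).filter fun A =>
    (⟨0, by omega⟩ : Fin n) ∈ A ∨ (⟨1, by omega⟩ : Fin n) ∈ A := by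
  simp only [A₁, has_one hn, has_two hn]

lemma B₁_eq (hn : 2 ≤ n) : B₁ n l = (uniform n l).filter fun B =>
    (⟨0, by omega⟩ : Fin n) ∈ B ∧ (⟨1, by omega⟩ : Fin n) ∈ B := by
  simp only [B₁, interval_one_two hn, insert_subset_iff, singleton_subset_iff]

lemma mem_A₂ (hn : 2 ≤ n) {A : Finset (Fin n)} : A ∈ A₂ n k ↔
    (A ∈ uniform n k ∧ (⟨0, by omega⟩ : Fin n) ∈ A) ∨ A = interval n 2 (k + 1) := by
  simp only [A₂, mem_union, mem_filter, has_one hn, mem_singleton]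

lemma B₂_eq (hn : 2 ≤ n) : B₂ n k l = (uniform n l).filter fun B =>
    (⟨0, by omega⟩ : Fin n) ∈ B ∧ (B ∩ interval n 2 (k + 1)).Nonempty := by
  simp only [B₂, has_one hn]

lemma zero_ne_one (hn : 2 ≤ n) : (⟨0, by omega⟩ : Fin n) ≠ ⟨1, by omega⟩ := by
  simp [Fin.ext_iff]

lemma card_A₁ (hn : 2 ≤ n) : #(A₁ n k) = n.choose k - (n - 2).choose k := by
  rw [A₁_eq hn, card_filter_mem_or_mem (zero_ne_one hn)]

lemma card_B₁ (hn : 2 ≤ n) : #(B₁ n (l + 1)) = (n - 1).choose l - (n - 2).choose l := by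
  rw [B₁_eq hn, card_filter_mem_and_mem (zero_ne_one hn)]

lemma card_A₂ (hk : 0 < k) (hkn : k < n) : #(A₂ n k) = (n - 1).choose (k - 1) + 1 := by
  have hn : 2 ≤ n := by omega
  have h1 := card_star (mem_univ (⟨0, by omega⟩ : Fin n)) (k - 1)
  rw [card_univ, Fintype.card_fin, Nat.sub_add_cancel hk] at h1
  rw [A₂, card_union_of_disjoint, card_singleton, ← h1]
  · simp only [has_one hn]
  · rw [disjoint_singleton_right, mem_filter, has_one hn]
    exact fun h => zero_notMem_interval hn h.2

lemma card_B₂ (hk : 0 < k) (hkn : k < n) :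
    #(B₂ n k (l + 1)) = (n - 1).choose l - (n - k - 1).choose l := by
  have hn : 2 ≤ n := by omega
  rw [B₂_eq hn, card_filter_mem_inter (zero_notMem_interval hn), card_interval hk hkn]

lemma binom_of_eq {a : ℕ} {b : ℤ} {c : ℕ} (h : b = c) : binom a b = a.choose c := by
  rw [binom, h, if_neg (by omega), Int.toNat_natCast]

lemma card_A₁_mul_card_B₁ (hn : 2 ≤ n) (hk : 0 < k) (hl : 0 < l) :
    #(A₁ n k) * #(B₁ n l) = bound₁ n k l := by
  obtain ⟨N, rfl⟩ : ∃ N, n = N + 2 := ⟨n - 2, by omega⟩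
  obtain ⟨i, rfl⟩ : ∃ i, k = i + 1 := ⟨k - 1, by omega⟩
  obtain ⟨j, rfl⟩ : ∃ j, l = j + 1 := ⟨l - 1, by omega⟩
  rw [card_A₁ hn, card_B₁ hn, bound₁, binom_of_eq (c := i) (by push_cast; ring),
    binom_of_eq (c := i) (by push_cast; ring), Nat.add_sub_cancel,
    show N + 2 - 1 = N + 1 by rfl]
  have h1 := Nat.choose_succ_succ' (N + 1) i
  have h2 := Nat.choose_succ_succ' N i
  congr 1
  · rw [show N + 1 + 1 = N + 2 by rfl] at h1
    omega
  · rcases j with _ | j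
    · simp [binom]
    · rw [binom_of_eq (c := j) (by push_cast; ring), Nat.choose_succ_succ' N j,
        Nat.add_sub_cancel]

lemma card_A₂_mul_card_B₂ (hk : 0 < k) (hkn : k < n) (hl : 0 < l) :
    #(A₂ n k) * #(B₂ n k l) = bound₂ n k l := by
  obtain ⟨i, rfl⟩ : ∃ i, k = i + 1 := ⟨k - 1, by omega⟩
  obtain ⟨j, rfl⟩ : ∃ j, l = j + 1 := ⟨l - 1, by omega⟩
  rw [card_A₂ hk hkn, card_B₂ hk hkn, bound₂, binom_of_eq (c := i) (by push_cast; ring),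
    binom_of_eq (c := j) (by push_cast; ring), binom_of_eq (c := j) (by push_cast; ring),
    Nat.add_sub_cancel]

lemma inter_eq_empty_iff {𝒜 ℬ : Finset (Finset (Fin n))} :
    (⋂ F ∈ 𝒜 ∪ ℬ, (F : Set (Fin n))) = ∅ ↔ ∀ x, ∃ F ∈ 𝒜 ∪ ℬ, x ∉ F := by
  simp only [Set.eq_empty_iff_forall_notMem, Set.mem_iInter, mem_coe, not_forall, exists_prop]

lemma exists_mem_uniform_of_ne {x t : Fin n} (hxt : t ≠ x) (hk : 0 < k) (hkn : k < n) :
    ∃ A ∈ uniform n k, t ∈ A ∧ x ∉ A := by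
  obtain ⟨A, hA, h1, h2⟩ := exists_disjoint_superset (l := k) (A := {x}) (T := {t})
    (by simpa using hxt) (by rw [card_singleton]; omega)
    (by rw [card_singleton]; omega)
  refine ⟨A, hA, h1 (by simp), fun h => h2 ⟨x, by simp [h]⟩⟩

lemma nontrivialCross₁ (hn : 2 ≤ n) (hk : 0 < k) (hkn : k < n) :
    NontrivialCross n k l (A₁ n k) (B₁ n l) := by
  rw [A₁_eq hn, B₁_eq hn]
  refine ⟨filter_subset _ _, filter_subset _ _, ?_, inter_eq_empty_iff.2 fun x => ?_⟩
  · intro A hA B hB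
    rw [mem_filter] at hA hB
    rcases hA.2 with h | h
    · exact ⟨_, mem_inter.2 ⟨h, hB.2.1⟩⟩
    · exact ⟨_, mem_inter.2 ⟨h, hB.2.2⟩⟩
  · by_cases hx : (⟨0, by omega⟩ : Fin n) = x
    · obtain ⟨A, hA, h1, h2⟩ := exists_mem_uniform_of_ne
        (show (⟨1, by omega⟩ : Fin n) ≠ x from hx ▸ (zero_ne_one hn).symm) hk hkn
      exact ⟨A, mem_union_left _ (mem_filter.2 ⟨hA, Or.inr h1⟩), h2⟩
    · obtain ⟨A, hA, h1, h2⟩ := exists_mem_uniform_of_ne hx hk hkn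
      exact ⟨A, mem_union_left _ (mem_filter.2 ⟨hA, Or.inl h1⟩), h2⟩

lemma nontrivialCross₂ (hk : 0 < k) (hkn : k < n) :
    NontrivialCross n k l (A₂ n k) (B₂ n k l) := by
  have hn : 2 ≤ n := by omega
  refine ⟨fun A hA => ?_, filter_subset _ _, ?_, inter_eq_empty_iff.2 fun x => ?_⟩
  · rcases (mem_A₂ hn).1 hA with h | rfl
    · exact h.1
    · exact mem_powersetCard.2 ⟨subset_univ _, card_interval hk hkn⟩
  · intro A hA B hB
    rw [B₂_eq hn, mem_filter] at hB
    rcases (mem_A₂ hn).1 hA with h | rfl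
    · exact ⟨_, mem_inter.2 ⟨h.2, hB.2.1⟩⟩
    · rw [inter_comm]; exact hB.2.2
  · by_cases hx : (⟨0, by omega⟩ : Fin n) = x
    · exact ⟨_, mem_union_left _ ((mem_A₂ hn).2 (Or.inr rfl)), hx ▸ zero_notMem_interval hn⟩
    · obtain ⟨A, hA, h1, h2⟩ := exists_mem_uniform_of_ne hx hk hkn
      exact ⟨A, mem_union_left _ ((mem_A₂ hn).2 (Or.inl ⟨hA, h1⟩)), h2⟩

end Extremal

/-! ### Relabelling -/

section Relabel

variable {n k l : ℕ} {𝒜 ℬ 𝒜' ℬ' : Finset (Finset (Fin n))}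

lemma mem_relabel {σ : Equiv.Perm (Fin n)} {F : Finset (Fin n)} :
    F ∈ relabel σ 𝒜 ↔ F.image σ.symm ∈ 𝒜 := by
  rw [relabel, mem_image]
  constructor
  · rintro ⟨G, hG, rfl⟩
    rwa [image_image, σ.symm_comp_self, image_id]
  · intro h
    exact ⟨_, h, by rw [image_image, σ.self_comp_symm, image_id]⟩

lemma card_relabel (σ : Equiv.Perm (Fin n)) : #(relabel σ 𝒜) = #𝒜 :=
  card_image_of_injective _ (image_injective σ.injective)

lemma IsoPair.card_mul_card (h : IsoPair k l 𝒜 ℬ 𝒜' ℬ') : #𝒜 * #ℬ = #𝒜' * #ℬ' := by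
  obtain ⟨σ, ⟨rfl, rfl⟩ | ⟨-, rfl, rfl⟩⟩ := h
  · rw [card_relabel, card_relabel]
  · rw [card_relabel, card_relabel, mul_comm]

lemma mem_image_symm {σ : Equiv.Perm (Fin n)} {F : Finset (Fin n)} {x : Fin n} :
    x ∈ F.image σ.symm ↔ σ x ∈ F := by
  rw [mem_image]
  constructor
  · rintro ⟨y, hy, rfl⟩; simpa using hy
  · intro h; exact ⟨_, h, by simp⟩

lemma image_symm_mem_uniform {σ : Equiv.Perm (Fin n)} {F : Finset (Fin n)}
    (h : F ∈ uniform n k) : F.image σ.symm ∈ uniform n k := by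
  rw [mem_powersetCard] at h ⊢
  exact ⟨subset_univ _, by rw [card_image_of_injective _ σ.symm.injective, h.2]⟩

/-- Two sets of the same size are exchanged by a permutation moving no other points. -/
lemma exists_perm_image {α : Type*} [DecidableEq α] {S T : Finset α} (h : #S = #T) :
    ∃ σ : Equiv.Perm α, S.image σ = T ∧ ∀ z, z ∉ S → z ∉ T → σ z = z := by
  induction hm : #(S \ T) generalizing S with
  | zero =>
    rw [card_eq_zero, sdiff_eq_empty_iff_subset] at hm
    exact ⟨1, by rw [Equiv.Perm.coe_one, image_id, eq_of_subset_of_card_le hm h.ge],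
      fun _ _ _ => rfl⟩
  | succ m ih =>
    obtain ⟨s, hs⟩ : (S \ T).Nonempty := card_pos.1 (by omega)
    obtain ⟨t, ht⟩ : (T \ S).Nonempty := by
      rw [← card_pos, ← card_sdiff_comm h]; omega
    rw [mem_sdiff] at hs ht
    have himg : S.image (Equiv.swap s t) = insert t (S.erase s) := by
      ext z
      simp only [mem_image, mem_insert, mem_erase]
      constructor
      · rintro ⟨y, hy, rfl⟩
        by_cases hys : y = s
        · left; rw [hys, Equiv.swap_apply_left]
        · right
          have hyt : y ≠ t := fun h => ht.2 (h ▸ hy)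
          rw [Equiv.swap_apply_of_ne_of_ne hys hyt]
          exact ⟨hys, hy⟩
      · rintro (rfl | ⟨h1, h2⟩)
        · exact ⟨s, hs.1, Equiv.swap_apply_left _ _⟩
        · exact ⟨z, h2, Equiv.swap_apply_of_ne_of_ne h1 fun h => ht.2 (h ▸ h2)⟩
    have hcard : #(insert t (S.erase s)) = #T := by
      rw [← himg, card_image_of_injective _ (Equiv.injective _), h]
    have hlt : #(insert t (S.erase s) \ T) = m := by
      have : insert t (S.erase s) \ T = (S \ T).erase s := by
        ext z
        simp only [mem_sdiff, mem_insert, mem_erase]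
        constructor
        · rintro ⟨rfl | h1, h2⟩
          · exact absurd ht.1 h2
          · exact ⟨h1.1, h1.2, h2⟩
        · rintro ⟨h1, h2, h3⟩
          exact ⟨Or.inr ⟨h1, h2⟩, h3⟩
      rw [this, card_erase_of_mem (mem_sdiff.2 hs), hm, Nat.add_sub_cancel]
    obtain ⟨σ, hσ1, hσ2⟩ := ih hcard hlt
    refine ⟨(Equiv.swap s t).trans σ, ?_, fun z hzS hzT => ?_⟩
    · rw [Equiv.coe_trans, ← image_image, himg, hσ1]
    · have hzs : z ≠ s := fun h => hzS (h ▸ hs.1)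
      have hzt : z ≠ t := fun h => hzT (h ▸ ht.1)
      rw [Equiv.trans_apply, Equiv.swap_apply_of_ne_of_ne hzs hzt]
      exact hσ2 z (by simp [hzt, hzS]) hzT

lemma exists_relabel₁ (hn : 2 ≤ n) (h𝒜 : 𝒜 ⊆ uniform n k) (hℬ : ℬ ⊆ uniform n l) {x y : Fin n}
    (hxy : x ≠ y) (hA : ∀ A ∈ 𝒜, x ∈ A ∨ y ∈ A) (hB : ∀ B ∈ ℬ, x ∈ B ∧ y ∈ B)
    (ha : #𝒜 = #(A₁ n k)) (hb : #ℬ = #(B₁ n l)) :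
    ∃ σ : Equiv.Perm (Fin n), 𝒜 = relabel σ (A₁ n k) ∧ ℬ = relabel σ (B₁ n l) := by
  obtain ⟨σ, hσ, -⟩ := exists_perm_image
    (show #{(⟨0, by omega⟩ : Fin n), (⟨1, by omega⟩ : Fin n)} = #{x, y} by
      rw [card_pair (zero_ne_one hn), card_pair hxy])
  rw [image_insert, image_singleton] at hσ
  refine ⟨σ, eq_of_subset_of_card_le (fun A hAm => ?_) (by rw [card_relabel, ha]),
    eq_of_subset_of_card_le (fun B hBm => ?_) (by rw [card_relabel, hb])⟩
  · rw [mem_relabel, A₁_eq hn, mem_filter, mem_image_symm, mem_image_symm]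
    refine ⟨image_symm_mem_uniform (h𝒜 hAm), ?_⟩
    have := congrArg (fun S => ∃ z ∈ S, z ∈ A) hσ
    simp only [mem_insert, mem_singleton, exists_eq_or_imp, exists_eq_left] at this
    rw [this]
    exact hA A hAm
  · rw [mem_relabel, B₁_eq hn, mem_filter, mem_image_symm, mem_image_symm]
    refine ⟨image_symm_mem_uniform (hℬ hBm), ?_⟩
    have := congrArg (fun S => ∀ z ∈ S, z ∈ B) hσ
    simp only [mem_insert, mem_singleton, forall_eq_or_imp, forall_eq] at this
    rw [this]
    exact hB B hBm

lemma exists_relabel₂ (hk : 0 < k) (hkn : k < n) (h𝒜 : 𝒜 ⊆ uniform n k) (hℬ : ℬ ⊆ uniform n l)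
    (h : CrossIntersecting 𝒜 ℬ) {x : Fin n} {A₀ : Finset (Fin n)} (hx : x ∉ A₀) (hA₀ : A₀ ∈ 𝒜)
    (hA : ∀ A ∈ 𝒜, x ∈ A ∨ A = A₀) (hB : ∀ B ∈ ℬ, x ∈ B)
    (ha : #𝒜 = #(A₂ n k)) (hb : #ℬ = #(B₂ n k l)) :
    ∃ σ : Equiv.Perm (Fin n), 𝒜 = relabel σ (A₂ n k) ∧ ℬ = relabel σ (B₂ n k l) := by
  have hn : 2 ≤ n := by omega
  obtain ⟨o, ho⟩ : ∃ o : Fin n, o = ⟨0, by omega⟩ := ⟨_, rfl⟩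
  have hoI : o ∉ interval n 2 (k + 1) := ho ▸ zero_notMem_interval hn
  have hxI : x ∉ (interval n 2 (k + 1)).image (Equiv.swap o x) := by
    intro hmem
    obtain ⟨y, hy, hyx⟩ := mem_image.1 hmem
    rw [Equiv.swap_apply_eq_iff, Equiv.swap_apply_right] at hyx
    exact hoI (hyx ▸ hy)
  obtain ⟨ρ, hρ1, hρ2⟩ := exists_perm_image
    (show #((interval n 2 (k + 1)).image (Equiv.swap o x)) = #A₀ by
      rw [card_image_of_injective _ (Equiv.injective _), card_interval hk hkn,
        (mem_powersetCard.1 (h𝒜 hA₀)).2])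
  obtain ⟨σ, hσ⟩ : ∃ σ : Equiv.Perm (Fin n), σ = (Equiv.swap o x).trans ρ := ⟨_, rfl⟩
  have hσo : σ o = x := by
    rw [hσ, Equiv.trans_apply, Equiv.swap_apply_left, hρ2 x hxI hx]
  have hσI : (interval n 2 (k + 1)).image σ = A₀ := by
    rw [hσ, Equiv.coe_trans, ← image_image, hρ1]
  refine ⟨σ, eq_of_subset_of_card_le (fun A hAm => ?_) (by rw [card_relabel, ha]),
    eq_of_subset_of_card_le (fun B hBm => ?_) (by rw [card_relabel, hb])⟩
  · rw [mem_relabel, mem_A₂ hn, ← ho, mem_image_symm, hσo]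
    rcases hA A hAm with h1 | rfl
    · exact Or.inl ⟨image_symm_mem_uniform (h𝒜 hAm), h1⟩
    · right
      rw [← hσI, image_image, σ.symm_comp_self, image_id]
  · rw [mem_relabel, B₂_eq hn, mem_filter, ← ho, mem_image_symm, hσo]
    refine ⟨image_symm_mem_uniform (hℬ hBm), hB B hBm, ?_⟩
    obtain ⟨z, hz⟩ := h A₀ hA₀ B hBm
    rw [mem_inter, ← hσI, mem_image] at hz
    obtain ⟨⟨y, hy, rfl⟩, hyB⟩ := hz
    exact ⟨y, mem_inter.2 ⟨mem_image_symm.2 hyB, hy⟩⟩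

end Relabel

/-! ### Pairs with the extremal product -/

/-- A singleton `{x}` in the first family forces `x` into all members of the second one; with three or
more singletons the product is too small by `Feasible.add_mul_lt`. -/
lemma card_mul_card_lt_or_of_one {N j : ℕ} {𝒜 ℬ : Finset (Finset (Fin (N + 2)))}
    (h𝒜 : 𝒜 ⊆ uniform (N + 2) 1) (hℬ : ℬ ⊆ uniform (N + 2) (j + 2))
    (h : CrossIntersecting 𝒜 ℬ) (hx : ∀ x, ∃ F ∈ 𝒜 ∪ ℬ, x ∉ F) (hN : 2 * j + 2 ≤ N) :
    #𝒜 * #ℬ < 2 * N.choose j ∨ (#𝒜 = 2 ∧ #ℬ = N.choose j ∧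
      ∃ x y, x ≠ y ∧ (∀ A ∈ 𝒜, x ∈ A ∨ y ∈ A) ∧ ∀ B ∈ ℬ, x ∈ B ∧ y ∈ B) := by
  have hpos : 0 < N.choose j := Nat.choose_pos (by omega)
  rcases 𝒜.eq_empty_or_nonempty with rfl | ⟨A, hA⟩
  · left; simpa using hpos
  rcases ℬ.eq_empty_or_nonempty with rfl | ⟨B₀, hB₀⟩
  · left; simpa using hpos
  have hmem : ∀ x, {x} ∈ 𝒜 → ∀ B ∈ ℬ, x ∈ B := by
    intro x hx B hB
    obtain ⟨z, hz⟩ := h _ hx B hB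
    rw [mem_inter, mem_singleton] at hz
    exact hz.1 ▸ hz.2
  obtain ⟨x, rfl⟩ := card_eq_one.1 (mem_powersetCard.1 (h𝒜 hA)).2
  obtain ⟨F, hF, hxF⟩ := hx x
  have hF : F ∈ 𝒜 := (mem_union.1 hF).resolve_right fun hF => hxF (hmem x hA F hF)
  obtain ⟨y, rfl⟩ := card_eq_one.1 (mem_powersetCard.1 (h𝒜 hF)).2
  have hxy : x ≠ y := by simpa using hxF
  have hsub : {{x}, {y}} ⊆ 𝒜 := by simp [insert_subset_iff, hA, hF]
  have h2 : #({{x}, {y}} : Finset (Finset (Fin (N + 2)))) = 2 := card_pair (by simpa using hxy)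
  rcases (card_le_card hsub).eq_or_lt with h3 | h3
  · have hB : ℬ ⊆ (uniform (N + 2) (j + 2)).filter fun B => x ∈ B ∧ y ∈ B :=
      fun B hB => mem_filter.2 ⟨hℬ hB, hmem x hA B hB, hmem y hF B hB⟩
    have hle := card_le_card hB
    rw [card_filter_mem_and_mem hxy, show N + 2 - 1 = N + 1 by rfl, Nat.choose_succ_succ' N j,
      Nat.add_sub_cancel, Nat.add_sub_cancel] at hle
    rw [h2] at h3
    rcases hle.eq_or_lt with h4 | h4
    · refine Or.inr ⟨h3.symm, h4, x, y, hxy, fun A hA => ?_, fun B hB' => (mem_filter.1 (hB hB')).2⟩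
      have := eq_of_subset_of_card_le hsub (by rw [← h3, h2])
      rw [← this, mem_insert, mem_singleton] at hA
      rcases hA with rfl | rfl <;> simp
    · left
      rw [← h3]
      omega
  · left
    have hf := h.feasible h𝒜 hℬ
    obtain ⟨a, ha⟩ := Nat.exists_eq_add_of_lt (h2 ▸ h3)
    have g : Feasible (N + 2) 1 (j + 2) ((N + 1).choose 0 + (N.choose 0 + (a + 1))) #ℬ :=
      hf.mono (by simp; omega) le_rfl
    have g2 : Feasible N 1 j (a + 1) #ℬ :=
      (g.peel_left (k := 0) (by omega)).peel_left (k := 0) (by omega)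
    have := g2.add_mul_lt (K := 2) (by omega) (by omega) (by omega) (by simp)
    rwa [ha, add_assoc]

/-- A pair whose product is not smaller than the bound is one of the two extremal ones. -/
theorem NontrivialCross.card_mul_card_lt_or_isoPair {n k l : ℕ}
    {𝒜 ℬ : Finset (Finset (Fin n))} (h : NontrivialCross n k l 𝒜 ℬ) (hk : 0 < k)
    (hn : (2 * l ≤ n ∧ 2 * k < 2 * l) ∨ (2 * l < n ∧ 2 * l = 2 * k)) (hl : 2 ≤ l) :
    #𝒜 * #ℬ < max (bound₁ n k l) (bound₂ n k l) ∨
      IsoPair k l 𝒜 ℬ (A₁ n k) (B₁ n l) ∨ IsoPair k l 𝒜 ℬ (A₂ n k) (B₂ n k l) := by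
  have hx := inter_eq_empty_iff.1 h.inter
  have hx' : ∀ x, ∃ F ∈ ℬ ∪ 𝒜, x ∉ F := by simpa only [union_comm] using hx
  obtain ⟨N, rfl⟩ : ∃ N, n = N + 2 := ⟨n - 2, by omega⟩
  obtain ⟨j, rfl⟩ : ∃ j, l = j + 2 := ⟨l - 2, by omega⟩
  have hQ := Nat.choose_succ_succ' N j
  have cB₁ : #(B₁ (N + 2) (j + 2)) = N.choose j := by
    rw [card_B₁ (by omega), show N + 2 - 1 = N + 1 by rfl, Nat.add_sub_cancel]
    omega
  rcases Nat.lt_or_ge 1 k with hk2 | hk2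
  swap
  · obtain rfl : k = 1 := by omega
    rcases card_mul_card_lt_or_of_one h.left h.right h.cross hx (by omega) with
      h1 | ⟨h1, h2, x, y, hxy, hA, hB⟩
    · left
      refine lt_max_of_lt_left (h1.trans_eq ?_)
      rw [bound₁, binom_of_eq (c := 0) (by norm_num), binom_of_eq (c := 0) (by norm_num),
        binom_of_eq (c := j) (by push_cast; ring)]
      simp
    · right; left
      obtain ⟨σ, hσ⟩ := exists_relabel₁ (by omega) h.left h.right hxy hA hB
        (by rw [h1, card_A₁ (by omega)]; simp) (by rw [h2, cB₁])
      exact ⟨σ, Or.inl hσ⟩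
  obtain ⟨i, rfl⟩ : ∃ i, k = i + 2 := ⟨k - 2, by omega⟩
  have hP1 := Nat.choose_succ_succ' (N + 1) (i + 1)
  have hP2 := Nat.choose_succ_succ' N (i + 1)
  simp only [add_assoc, Nat.reduceAdd] at hP1 hP2
  have cA₁ : #(A₁ (N + 2) (i + 2)) = (N + 1).choose (i + 1) + N.choose (i + 1) := by
    rw [card_A₁ (by omega), Nat.add_sub_cancel]
    omega
  have cA₂ : #(A₂ (N + 2) (i + 2)) = (N + 1).choose (i + 1) + 1 := by
    rw [card_A₂ (by omega) (by omega)]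
    rfl
  have cB₂ : #(B₂ (N + 2) (i + 2) (j + 2)) =
      (N + 1).choose (j + 1) - (N - i - 1).choose (j + 1) := by
    rw [card_B₂ (by omega) (by omega), show N + 2 - (i + 2) - 1 = N - i - 1 by omega]
    rfl
  rw [← card_A₁_mul_card_B₁ (by omega) hk (by omega),
    ← card_A₂_mul_card_B₂ hk (by omega) (by omega), cA₁, cB₁, cA₂, cB₂]
  rcases card_mul_card_lt_or h.left h.right h.cross hx (by omega) with
    h1 | ⟨h1, h2⟩ | ⟨h1, h2⟩ | ⟨rfl, h1, h2⟩ | ⟨rfl, h1, h2⟩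
  · exact Or.inl h1
  · right; left
    obtain ⟨x, y, hxy, hA, hB⟩ := exists_pair_of_card h.left h.right h.cross (by omega) (by omega)
      h1 h2
    obtain ⟨σ, hσ⟩ := exists_relabel₁ (by omega) h.left h.right hxy hA hB (by rw [h1, cA₁])
      (by rw [h2, cB₁])
    exact ⟨σ, Or.inl hσ⟩
  · right; right
    obtain ⟨x, A₀, hx, hA₀, hA, hB⟩ := exists_star_of_card h.left h.right h.cross (by omega)
      (by omega) (by omega) h1 h2
    obtain ⟨σ, hσ⟩ := exists_relabel₂ hk (by omega) h.left h.right h.cross hx hA₀ hA hB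
      (by rw [h1, cA₂]) (by rw [h2, cB₂])
    exact ⟨σ, Or.inl hσ⟩
  · right; left
    obtain ⟨x, y, hxy, hA, hB⟩ := exists_pair_of_card h.right h.left h.cross.symm (by omega)
      (by omega) h1 h2
    obtain ⟨σ, hσ1, hσ2⟩ := exists_relabel₁ (by omega) h.right h.left hxy hA hB (by rw [h1, cA₁])
      (by rw [h2, cB₁])
    exact ⟨σ, Or.inr ⟨rfl, hσ2, hσ1⟩⟩
  · right; right
    obtain ⟨x, A₀, hx, hA₀, hA, hB⟩ := exists_star_of_card h.right h.left h.cross.symm (by omega)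
      (by omega) (by omega) h1 h2
    obtain ⟨σ, hσ1, hσ2⟩ := exists_relabel₂ hk (by omega) h.right h.left h.cross.symm hx hA₀ hA hB
      (by rw [h1, cA₂]) (by rw [h2, cB₂])
    exact ⟨σ, Or.inr ⟨rfl, hσ2, hσ1⟩⟩

/-- Two cross-intersecting families of singletons have a common element, unless one is empty. -/
lemma NontrivialCross.card_mul_card_eq_zero {n : ℕ} {𝒜 ℬ : Finset (Finset (Fin n))}
    (h : NontrivialCross n 1 1 𝒜 ℬ) : #𝒜 * #ℬ = 0 := by
  by_contra hcon
  rw [Nat.mul_eq_zero, not_or, card_eq_zero, card_eq_zero] at hcon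
  obtain ⟨A, hA⟩ := nonempty_iff_ne_empty.2 hcon.1
  obtain ⟨B, hB⟩ := nonempty_iff_ne_empty.2 hcon.2
  have heq : ∀ A ∈ 𝒜, ∀ B ∈ ℬ, A = B := by
    intro A hA B hB
    obtain ⟨x, rfl⟩ := card_eq_one.1 (mem_powersetCard.1 (h.left hA)).2
    obtain ⟨y, rfl⟩ := card_eq_one.1 (mem_powersetCard.1 (h.right hB)).2
    obtain ⟨z, hz⟩ := h.cross _ hA _ hB
    simp only [mem_inter, mem_singleton] at hz
    rw [← hz.1, hz.2]
  obtain ⟨x, rfl⟩ := card_eq_one.1 (mem_powersetCard.1 (h.left hA)).2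
  obtain ⟨F, hF, hxF⟩ := inter_eq_empty_iff.1 h.inter x
  rcases mem_union.1 hF with hF | hF
  · rw [heq F hF B hB, ← heq _ hA B hB] at hxF
    simp at hxF
  · rw [← heq _ hA F hF] at hxF
    simp at hxF

end CrossInt

theorem theorem1p5 (n k ℓ : ℕ) (hk : 0 < k)
    (h : (2 * ℓ ≤ n ∧ 2 * k < 2 * ℓ) ∨ (2 * ℓ < n ∧ 2 * ℓ = 2 * k)) :
    -- the bound, and the description of all extremal pairs
    (∀ 𝒜 ℬ : Finset (Finset (Fin n)), CrossInt.NontrivialCross n k ℓ 𝒜 ℬ →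
      𝒜.card * ℬ.card ≤ max (CrossInt.bound₁ n k ℓ) (CrossInt.bound₂ n k ℓ) ∧
      (2 ≤ ℓ →
        (𝒜.card * ℬ.card = max (CrossInt.bound₁ n k ℓ) (CrossInt.bound₂ n k ℓ) ↔
          (CrossInt.bound₂ n k ℓ ≤ CrossInt.bound₁ n k ℓ ∧
            CrossInt.IsoPair k ℓ 𝒜 ℬ (CrossInt.A₁ n k) (CrossInt.B₁ n ℓ)) ∨
          (CrossInt.bound₁ n k ℓ ≤ CrossInt.bound₂ n k ℓ ∧
            CrossInt.IsoPair k ℓ 𝒜 ℬ (CrossInt.A₂ n k) (CrossInt.B₂ n k ℓ))))) ∧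
    -- both pairs are admissible and have the products in question
    (CrossInt.NontrivialCross n k ℓ (CrossInt.A₁ n k) (CrossInt.B₁ n ℓ) ∧
      (CrossInt.A₁ n k).card * (CrossInt.B₁ n ℓ).card = CrossInt.bound₁ n k ℓ) ∧
    (CrossInt.NontrivialCross n k ℓ (CrossInt.A₂ n k) (CrossInt.B₂ n k ℓ) ∧
      (CrossInt.A₂ n k).card * (CrossInt.B₂ n k ℓ).card = CrossInt.bound₂ n k ℓ) := by
  have hn : 2 ≤ n := by omega
  have hkn : k < n := by omega
  have hc1 := CrossInt.card_A₁_mul_card_B₁ (l := ℓ) hn hk (by omega)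
  have hc2 := CrossInt.card_A₂_mul_card_B₂ (l := ℓ) hk hkn (by omega)
  refine ⟨fun 𝒜 ℬ hAB => ?_, ⟨CrossInt.nontrivialCross₁ hn hk hkn, hc1⟩,
    ⟨CrossInt.nontrivialCross₂ hk hkn, hc2⟩⟩
  rcases Nat.lt_or_ge ℓ 2 with hl | hl
  · obtain rfl : ℓ = 1 := by omega
    obtain rfl : k = 1 := by omega
    rw [hAB.card_mul_card_eq_zero]
    exact ⟨Nat.zero_le _, fun h => absurd h (by omega)⟩
  have hiso1 := fun H : CrossInt.IsoPair k ℓ 𝒜 ℬ (CrossInt.A₁ n k) (CrossInt.B₁ n ℓ) =>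
    H.card_mul_card.trans hc1
  have hiso2 := fun H : CrossInt.IsoPair k ℓ 𝒜 ℬ (CrossInt.A₂ n k) (CrossInt.B₂ n k ℓ) =>
    H.card_mul_card.trans hc2
  have hmain := hAB.card_mul_card_lt_or_isoPair hk h hl
  refine ⟨?_, fun _ => ⟨fun hmax => ?_, ?_⟩⟩
  · rcases hmain with h1 | h1 | h1
    · exact h1.le
    · exact (hiso1 h1).trans_le (le_max_left _ _)
    · exact (hiso2 h1).trans_le (le_max_right _ _)
  · rcases hmain with h1 | h1 | h1
    · exact absurd hmax h1.ne
    · exact Or.inl ⟨by rw [← hiso1 h1, hmax]; exact le_max_right _ _, h1⟩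
    · exact Or.inr ⟨by rw [← hiso2 h1, hmax]; exact le_max_left _ _, h1⟩
  · rintro (⟨hle, h1⟩ | ⟨hle, h1⟩)
    · rw [hiso1 h1, max_eq_left hle]
    · rw [hiso2 h1, max_eq_right hle]
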